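/- **Model.** A sequential object is a tuple $A=(Q,q_0,O,R,\sigma)$ with $\sigma:O\times Q\to R\times Q$. Operations $a,b\in O$ commute in $q\in Q$ if executing them from $q$ in either order gives the same two responses and the same final state; they conflict, $a\asymp b$, if they fail to commute in some state. An *implementation* of $A$ consists of deterministic algorithms for $n$ asynchronous processes that communicate through atomic read-write registers; a step is a local computation with at most one read or write of a register. A process invokes an operation only when it has none pending. In an infinite execution a process is *correct* if it takes infinitely many steps or (from some time on) has no pending operation. An operation instance is *eventually step-contention-free* if it completes or from some time on only it takes steps. An execution is *eventually conflict-free* if it has a suffix in which no two concurrent operation instances have conflicting operations. An implementation is *conflict-free* if, in every infinite execution, every operation invoked by a correct process completes whenever it is eventually step-contention-free or the execution is eventually conflict-free. It is *linearizable* if each of its histories is linearizable with respect to $A$. **Traces.** A schedule is a finite sequence of operations. Two schedules are equivalent if they have the same multiset of operations and order the occurrences of any two conflicting operations in the same way; the equivalence classes are *traces*, $\mathrm{ops}(x)$ is the multiset of operations of the trace $x$, traces are concatenated through representatives, and $x\le y$ means $y=x\cdot z$ for some trace $z$. A set of traces is compatible if it has a common upper bound. $\mathsf{ret}(c,x)$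 is the response of $c$ when a representative of $x$ is executed from $q_0$. **GCA.** A (one-shot) Generalized Commit-Adopt object over traces has one operation, propose, taking a trace $s_i$ and returning a pair $(t_i,c_i)$ of a trace and a Boolean; $i$ *commits* if $c_i$ is true and *adopts* otherwise. The participants are the processes that propose. In each execution in which every process proposes at most once, an implementation of GCA has to satisfy: (Termination) every correct participant returns. (Validity) The multiset $\mathrm{ops}(t_i)$ is contained in the multiset union (maximum of multiplicities) of the $\mathrm{ops}(s_j)$. (Adoption) A committed trace is a prefix of every output trace. (Commitment) If there is a participant, all participants return and their inputs are compatible, then some process $j$ commits some $t_j\ge s_j$. (Convergence) The output traces are compatible. (Common prefix) Every common prefix of the inputs is a prefix of every output. (Weak agreement) If all inputs are equal, no process adopts. **Construction.** Fix $A$ and $n$. Commands are triples $(op,i,seq)$; they act and conflict as their operations do. The shared data are objects $\mathrm{GCA}_k$, $k\ge 1$, over traces of commands, and registers $S[i]=(0,\epsilon)$ and $M[i]=\bot$ for each process $i$. Process $i$ has persistent local variables $r=0$, $seq=0$, $s=\epsilon$. To invoke $op$, process $i$ does the following, reading arrays one register at a time: 1. $seq\gets seq+1$; $cmd\gets(op,i,seq)$;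 $M[i]\gets cmd$. 2. $(r,s)\gets$ the pair with the largest round among $S[1],\dots,S[n]$ and its current $(r,s)$, where in a tie the pairs of $S$ have priority; $u\gets\epsilon$. 3. While $cmd\notin\mathrm{ops}(u)$: $r\gets r+1$; $M_i\gets\{M[j] : M[j]\ne\bot,\ M[j]\notin\mathrm{ops}(s)\}$; $s\gets s\cdot\mathrm{trace}(M_i)$, where $\mathrm{trace}$ arranges the commands of a finite set in an arbitrary order, each once; $(s,c)\gets\mathrm{GCA}_r.\mathrm{propose}(s)$; if $c$ is true, $S[i]\gets(r,s)$; then $u\gets$ the trace of a pair with the largest round among $S[1],\dots,S[n]$. 4. Return $\mathsf{ret}(cmd,u)$. **Theorem.** Let $A$ be a sequential object and $n$ a number of processes. (1) For every family of read-write implementations of the objects $\mathrm{GCA}_k$ and every choice of the orders in $\mathrm{trace}$, the above construction is conflict-free: in every infinite execution, each operation of a correct process completes if the execution is eventually conflict-free or the operation is eventually step-contention-free. Moreover, the construction is linearizable. (2) GCA over the traces of commands has a read-write implementation. (3) Consequently, every sequential object has a read-write, linearizable, conflict-free implementation. -/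

import Mathlib

universe u v w

/-! ### Sequential objects and conflicts -/

/-- A sequential data type `(Q, q₀, O, R, σ)`. -/
structure SeqObject (Q : Type v) (O : Type u) (R : Type w) where
  q0 : Q
  σ : O → Q → R × Q

namespace SeqObject

variable {Q : Type v} {O : Type u} {R : Type w}

/-- `a` and `b` commute in `q`: both orders give the same responses and the same final state. -/
def CommuteIn (A : SeqObject Q O R) (q : Q) (a b : O) : Prop :=
  ∃ (ra rb : R) (q1 q2 q' : Q),
    A.σ a q = (ra, q1) ∧ A.σ b q1 = (rb, q') ∧ A.σ b q = (rb, q2) ∧ A.σ a q2 = (ra, q')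

/-- `a ≍ b`: the operations fail to commute in some state. -/
def Conflict (A : SeqObject Q O R) (a b : O) : Prop :=
  ∃ q, ¬ A.CommuteIn q a b

end SeqObject

/-! ### Schedules and traces -/

section Traces

variable {C : Type u}

open Classical in
/-- Two schedules are equivalent if they have the same operations with multiplicity, and if for
conflicting `a`, `b` the occurrences of `a` and `b` come in the same order in both. -/
def SchedEquiv (D : C → C → Prop) (s t : List C) : Prop :=
  s.Perm t ∧ ∀ a b, D a b →
    s.filter (fun x => x = a ∨ x = b) = t.filter (fun x => x = a ∨ x = b)

/-- Equivalence of schedules as a setoid. -/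
def schedSetoid (D : C → C → Prop) : Setoid (List C) where
  r := SchedEquiv D
  iseqv :=
    ⟨fun _ => ⟨List.Perm.refl _, fun _ _ _ => rfl⟩,
     fun h => ⟨h.1.symm, fun a b hab => (h.2 a b hab).symm⟩,
     fun h k => ⟨h.1.trans k.1, fun a b hab => (h.2 a b hab).trans (k.2 a b hab)⟩⟩

/-- Traces: equivalence classes of schedules, for the conflict relation `D`. -/
def Trace (D : C → C → Prop) : Type u := Quotient (schedSetoid D)

namespace Trace

variable {D : C → C → Prop}

/-- The trace `[s]` of a schedule `s`. -/
def mk (D : C → C → Prop) (s : List C) : Trace D := Quotient.mk (schedSetoid D) s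

/-- Some representative of a trace. -/
noncomputable def rep (x : Trace D) : List C := Quotient.out x

/-- Concatenation of traces, `[s] · [t] = [s · t]`, and the empty trace as `1`. -/
instance : Monoid (Trace D) where
  one := mk D []
  mul := Quotient.map₂ (· ++ ·) (by
    intro s s' hs t t' ht
    refine ⟨hs.1.append ht.1, fun a b hab => ?_⟩
    simp only [List.filter_append]
    rw [hs.2 a b hab, ht.2 a b hab])
  mul_assoc x y z := by
    induction x using Quotient.inductionOn
    induction y using Quotient.inductionOn
    induction z using Quotient.inductionOn
    exact congrArg (mk D) (List.append_assoc _ _ _)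
  one_mul x := by
    induction x using Quotient.inductionOn
    exact congrArg (mk D) (List.nil_append _)
  mul_one x := by
    induction x using Quotient.inductionOn
    exact congrArg (mk D) (List.append_nil _)

/-- The prefix order on traces. -/
instance : LE (Trace D) := ⟨fun x y => ∃ z, y = x * z⟩

/-- The multiset of operations of a trace. -/
def ops (x : Trace D) : Multiset C :=
  Quotient.lift (s := schedSetoid D) (fun s : List C => (s : Multiset C)) (fun s t (h : SchedEquiv D s t) => Multiset.coe_eq_coe.2 h.1) x

end Trace

/-- A set of traces is compatible if its members have a common extension. -/
def Compatible {D : C → C → Prop} (S : Set (Trace D)) : Prop :=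
  ∃ z, ∀ x ∈ S, x ≤ z

end Traces

/-! ### Read-write implementations and their executions -/

/-- What a pending operation does in one step: at most one read or write of a register together
with a local computation, or returning a response. -/
inductive StepAction (Reg : Type u) (Val : Reg → Type u) (Loc : Type u) (R : Type w) where
  | read (x : Reg) (k : Val x → Loc)
  | write (x : Reg) (y : Val x) (l : Loc)
  | skip (l : Loc)
  | ret (r : R) (l : Loc)

/-- A deterministic algorithm for `n` processes over atomic read-write registers, offering
operations in `O` with responses in `R`. The initial register contents are `mem0`, the initial
local states `loc0`; `invoke i o l` is the local state of `i` once `o` is invoked in state `l`. -/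
structure Implementation (n : ℕ) (O : Type v) (R : Type w) where
  Reg : Type u
  Val : Reg → Type u
  Loc : Type u
  mem0 : (x : Reg) → Val x
  loc0 : Fin n → Loc
  invoke : Fin n → O → Loc → Loc
  next : Fin n → Loc → StepAction Reg Val Loc R

/-- An event of an execution: process `i` invokes `o`, or process `i` takes a step. -/
inductive Event (n : ℕ) (O : Type v) where
  | invoke (i : Fin n) (o : O)
  | step (i : Fin n)

/-- The process to which an event belongs. -/
def Event.proc {n : ℕ} {O : Type v} : Event n O → Fin n
  | .invoke i _ => i
  | .step i => i

/-- An event of a history: an invocation, or a response. -/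
inductive HEvent (n : ℕ) (O : Type v) (R : Type w) where
  | inv (i : Fin n) (o : O)
  | res (i : Fin n) (r : R)

/-- The process to which an event of a history belongs. -/
def HEvent.proc {n : ℕ} {O : Type v} {R : Type w} : HEvent n O R → Fin n
  | .inv i _ => i
  | .res i _ => i

namespace Implementation

variable {n : ℕ} {O : Type v} {R : Type w}

/-- A configuration: register contents, local states, and the pending operation (if any) of each
process. -/
structure Config (I : Implementation.{u} n O R) where
  mem : (x : I.Reg) → I.Val x
  loc : Fin n → I.Loc
  pend : Fin n → Option O

variable (I : Implementation.{u} n O R)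

/-- The initial configuration. -/
def Config.initial : I.Config := ⟨I.mem0, I.loc0, fun _ => none⟩

variable {I}

/-- A process may invoke when it has no pending operation; it takes steps when it has one. -/
def Config.Enabled (c : I.Config) : Event n O → Prop
  | .invoke i _ => c.pend i = none
  | .step i => c.pend i ≠ none

open Classical in
/-- The effect of an event. -/
noncomputable def Config.after (c : I.Config) : Event n O → I.Config
  | .invoke i o =>
      { c with
        loc := Function.update c.loc i (I.invoke i o (c.loc i))
        pend := Function.update c.pend i (some o) }
  | .step i =>
      match I.next i (c.loc i) with
      | .read x k => { c with loc := Function.update c.loc i (k (c.mem x)) }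
      | .write x y l =>
          { c with mem := Function.update c.mem x y, loc := Function.update c.loc i l }
      | .skip l => { c with loc := Function.update c.loc i l }
      | .ret _ l =>
          { c with
            loc := Function.update c.loc i l
            pend := Function.update c.pend i none }

/-- The invocation or response, if any, that an event contributes to the history. -/
def Config.label (c : I.Config) : Event n O → List (HEvent n O R)
  | .invoke i o => [.inv i o]
  | .step i =>
      match I.next i (c.loc i) with
      | .ret r _ => [.res i r]
      | _ => []

variable (I)

/-- An execution: `ev t` is the event at time `t` and `conf t` the configuration before it.
`ev t = none` means that nothing happens at time `t`, so that finite executions are included. -/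
structure Execution where
  ev : ℕ → Option (Event n O)
  conf : ℕ → I.Config
  conf_zero : conf 0 = Config.initial I
  conf_none : ∀ t, ev t = none → conf (t + 1) = conf t
  conf_some : ∀ t e, ev t = some e → (conf t).Enabled e ∧ conf (t + 1) = (conf t).after e

variable {I}

namespace Execution

/-- Infinitely many events occur. -/
def IsInfinite (X : I.Execution) : Prop := ∀ T, ∃ t, T ≤ t ∧ X.ev t ≠ none

/-- A process is correct if it has infinitely many events, or from some time on has no pending
operation. -/
def Correct (X : I.Execution) (i : Fin n) : Prop :=
  (∀ T, ∃ t e, T ≤ t ∧ X.ev t = some e ∧ e.proc = i) ∨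
  (∃ T, ∀ t, T ≤ t → (X.conf t).pend i = none)

/-- The operation instance that process `i` invokes at time `t₀` gets a response. -/
def Completes (X : I.Execution) (i : Fin n) (t₀ : ℕ) : Prop :=
  ∃ t, t₀ < t ∧ (X.conf t).pend i = none

/-- The operation instance that process `i` invokes at time `t₀` completes, or from some time on
runs solo. -/
def EventuallyStepContentionFree (X : I.Execution) (i : Fin n) (t₀ : ℕ) : Prop :=
  X.Completes i t₀ ∨ ∃ T, ∀ t e, T ≤ t → X.ev t = some e → e.proc = i

/-- From some time on, no two operations pending at the same time conflict. -/
def EventuallyConflictFree (X : I.Execution) (conflict : O → O → Prop) : Prop :=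
  ∃ T, ∀ t, T ≤ t → ∀ i j o o', i ≠ j →
    (X.conf t).pend i = some o → (X.conf t).pend j = some o' → ¬ conflict o o'

/-- The history of the events before time `T`. -/
def history (X : I.Execution) : ℕ → List (HEvent n O R)
  | 0 => []
  | T + 1 => X.history T ++ (match X.ev T with
      | none => []
      | some e => (X.conf T).label e)

/-- Process `i` invokes `o` at some time. -/
def Invoked (X : I.Execution) (i : Fin n) (o : O) : Prop :=
  ∃ t, X.ev t = some (.invoke i o)

/-- Process `i` gets the response `r` at some time. -/
def Returned (X : I.Execution) (i : Fin n) (r : R) : Prop :=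
  ∃ t l, X.ev t = some (.step i) ∧ I.next i ((X.conf t).loc i) = .ret r l

/-- Every process invokes at most one operation. -/
def OneShot (X : I.Execution) : Prop :=
  ∀ t t' i o o', X.ev t = some (.invoke i o) → X.ev t' = some (.invoke i o') → t = t'

end Execution

/-- Conflict-freedom: in every infinite execution, every operation invoked by a correct process
completes if it is eventually step-contention-free or the execution is eventually
conflict-free. -/
def ConflictFree {Q : Type*} (I : Implementation.{u} n O R) (A : SeqObject Q O R) : Prop :=
  ∀ X : I.Execution, X.IsInfinite →
    ∀ (i : Fin n) (o : O) (t₀ : ℕ), X.ev t₀ = some (.invoke i o) → X.Correct i →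
      (X.EventuallyStepContentionFree i t₀ ∨ X.EventuallyConflictFree A.Conflict) →
      X.Completes i t₀

end Implementation

/-! ### Linearizability -/

section Linearizability

variable {Q : Type*} {n : ℕ} {O : Type v} {R : Type w}

/-- The sequential history of a list of operations with their responses. -/
def seqHistory (S : List (Fin n × O × R)) : List (HEvent n O R) :=
  S.flatMap fun p => [.inv p.1 p.2.1, .res p.1 p.2.2]

/-- The responses are those of the sequential object started in state `q`. -/
def LegalFrom (A : SeqObject Q O R) : Q → List (Fin n × O × R) → Prop
  | _, [] => True
  | q, p :: S => p.2.2 = (A.σ p.2.1 q).1 ∧ LegalFrom A (A.σ p.2.1 q).2 S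

open Classical in
/-- Remove the pending invocations of a (well-formed) history. -/
noncomputable def removePending : List (HEvent n O R) → List (HEvent n O R)
  | [] => []
  | .inv i o :: H =>
      if ∃ r, HEvent.res i r ∈ H then .inv i o :: removePending H else removePending H
  | .res i r :: H => .res i r :: removePending H

/-- The events of process `i`. -/
def restrict (H : List (HEvent n O R)) (i : Fin n) : List (HEvent n O R) :=
  H.filter fun e => e.proc = i

/-- The number of operations that process `i` has invoked in `H`. -/
def invCount (H : List (HEvent n O R)) (i : Fin n) : ℕ :=
  H.countP fun e => match e with
    | .inv j _ => decide (j = i)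
    | .res _ _ => false

/-- The number of responses that process `i` has received in `H`. -/
def resCount (H : List (HEvent n O R)) (i : Fin n) : ℕ :=
  H.countP fun e => match e with
    | .inv _ _ => false
    | .res j _ => decide (j = i)

/-- Real-time order: operation number `a` of process `i` returns before operation number `b` of
process `j` is invoked (operations of a process are numbered from 0). -/
def Precedes (H : List (HEvent n O R)) (i : Fin n) (a : ℕ) (j : Fin n) (b : ℕ) : Prop :=
  ∃ (H₁ H₂ H₃ : List (HEvent n O R)) (r : R) (o : O),
    H = H₁ ++ .res i r :: (H₂ ++ .inv j o :: H₃) ∧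
    resCount H₁ i = a ∧ invCount (H₁ ++ .res i r :: H₂) j = b

/-- A history is linearizable if some pending operations can be given responses and the other
pending ones be removed so that the result `H'` has, process by process, the same events as a
legal sequential history that preserves the real-time order. -/
def LinearizableHistory (A : SeqObject Q O R) (H : List (HEvent n O R)) : Prop :=
  ∃ (E : List (Fin n × R)) (S : List (Fin n × O × R)),
    (E.map Prod.fst).Nodup ∧
    (∀ p ∈ E, invCount H p.1 = resCount H p.1 + 1) ∧
    LegalFrom A A.q0 S ∧
    (let H' := removePending (H ++ E.map fun p => HEvent.res p.1 p.2)
     (∀ i, restrict H' i = restrict (seqHistory S) i) ∧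
     ∀ i a j b, Precedes H' i a j b → Precedes (seqHistory S) i a j b)

/-- An implementation is linearizable if all its (finite) histories are. -/
def Implementation.Linearizable (I : Implementation.{u} n O R) (A : SeqObject Q O R) : Prop :=
  ∀ (X : I.Execution) (T : ℕ), LinearizableHistory A (X.history T)

end Linearizability

/-! ### Generalized Commit-Adopt -/

open Classical in
/-- An algorithm implements Generalized Commit-Adopt over the traces of `D`, with operation
`propose`, if it has the following properties in each execution in which every process proposes at
most once. The participants are the processes that propose. -/
structure IsGCA {C : Type u} {D : C → C → Prop} {n : ℕ}
    (G : Implementation.{u} n (Trace D) (Trace D × Bool)) : Prop where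
  /-- Every correct participant returns. -/
  termination : ∀ X : G.Execution, X.OneShot → ∀ i s, X.Invoked i s → X.Correct i →
    ∃ r, X.Returned i r
  /-- The multiset of operations of an output lies in the union of those of the inputs. -/
  validity : ∀ X : G.Execution, X.OneShot → ∀ i t c, X.Returned i (t, c) →
    ∀ o ∈ t.ops, ∃ j s, X.Invoked j s ∧ t.ops.count o ≤ s.ops.count o
  /-- A committed trace is a prefix of every output. -/
  adoption : ∀ X : G.Execution, X.OneShot → ∀ i t, X.Returned i (t, true) →
    ∀ j t' c, X.Returned j (t', c) → t ≤ t'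
  /-- If the inputs are compatible and all participants (at least one) return, then some process
  commits an extension of its input. -/
  commitment : ∀ X : G.Execution, X.OneShot → (∃ i s, X.Invoked i s) →
    Compatible {s | ∃ i, X.Invoked i s} →
    (∀ i s, X.Invoked i s → ∃ r, X.Returned i r) →
    ∃ j s t, X.Invoked j s ∧ X.Returned j (t, true) ∧ s ≤ t
  /-- The outputs are compatible. -/
  convergence : ∀ X : G.Execution, X.OneShot → Compatible {t | ∃ i c, X.Returned i (t, c)}
  /-- Every common prefix of the inputs is a prefix of every output. -/
  common_prefix : ∀ X : G.Execution, X.OneShot → ∀ e, (∀ j s, X.Invoked j s → e ≤ s) →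
    ∀ i t c, X.Returned i (t, c) → e ≤ t
  /-- If all inputs are equal, no process adopts. -/
  weak_agreement : ∀ X : G.Execution, X.OneShot →
    (∀ i j s s', X.Invoked i s → X.Invoked j s' → s = s') →
    ∀ i t c, X.Returned i (t, c) → c = true

/-! ### The helping-based universal construction -/

/-- Commands `(op, i, seq)`. -/
structure Cmd (n : ℕ) (O : Type u) : Type u where
  op : O
  proc : Fin n
  seq : ℕ

section Construction

variable {Q : Type v} {O : Type u} {R : Type w}

/-- The object `A` with commands as operations. -/
def SeqObject.cmdObj (A : SeqObject Q O R) (n : ℕ) : SeqObject Q (Cmd n O) R :=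
  ⟨A.q0, fun c q => A.σ c.op q⟩

/-- Traces of commands, for the conflict relation of the object on commands. -/
abbrev SeqObject.CmdTrace (A : SeqObject Q O R) (n : ℕ) : Type u :=
  Trace (A.cmdObj n).Conflict

open Classical in
/-- The response of the first occurrence of `o` when a schedule is run from state `q`
(for a schedule without `o`, the response that `o` would have at its end). -/
noncomputable def SeqObject.retFrom (A : SeqObject Q O R) (o : O) : Q → List O → R
  | q, [] => (A.σ o q).1
  | q, a :: s => if a = o then (A.σ a q).1 else A.retFrom o (A.σ a q).2 s

/-- The return value of `o` in a trace, computed on a representative from the initial state. -/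
noncomputable def SeqObject.ret (A : SeqObject Q O R) (o : O) (x : Trace A.Conflict) : R :=
  A.retFrom o A.q0 x.rep

namespace Helping

variable {n : ℕ} (A : SeqObject Q O R)
  (G : ℕ → Implementation.{u} n (A.CmdTrace n) (A.CmdTrace n × Bool))

/-- The registers: the announcements `M[i]`, the records `S[i]`, and the registers of each
`GCA_k`. -/
inductive Reg : Type u where
  | M (i : Fin n)
  | S (i : Fin n)
  | gca (k : ℕ) (x : (G k).Reg)

/-- The contents of the registers: a command or `⊥`, a round with a trace, and what `GCA_k`
stores. -/
def Val : Reg A G → Type u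
  | .M _ => Option (Cmd n O)
  | .S _ => ℕ × A.CmdTrace n
  | .gca k x => (G k).Val x

/-- Where a process is in the code of `invoke`, with its temporary variables. The list `todo`
holds the indices of the registers still to be read. -/
inductive Phase : Type u where
  /-- No pending operation. -/
  | idle
  /-- About to execute `M[i] ← cmd`. -/
  | announce (cmd : Cmd n O)
  /-- Reading `S` before the loop. -/
  | start (cmd : Cmd n O) (todo : List (Fin n)) (best : ℕ × A.CmdTrace n)
  /-- Reading `M` in order to find the commands to append. -/
  | help (cmd : Cmd n O) (todo : List (Fin n)) (found : Finset (Cmd n O))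
  /-- Inside `GCA_k.propose`, in local state `l` of `GCA_k`. -/
  | propose (cmd : Cmd n O) (k : ℕ) (l : (G k).Loc)
  /-- About to execute `S[i] ← (r, s)`. -/
  | record (cmd : Cmd n O)
  /-- Reading `S` at the end of the loop body. -/
  | check (cmd : Cmd n O) (todo : List (Fin n)) (best : ℕ × A.CmdTrace n)

/-- The local state: the variables `r`, `seq`, `s`, which persist between operations, and the
phase. -/
structure Local : Type u where
  r : ℕ
  seq : ℕ
  s : A.CmdTrace n
  phase : Phase A G

/-- The pair with the larger round; the second one in case of a tie. -/
def later (p q : ℕ × A.CmdTrace n) : ℕ × A.CmdTrace n := if p.1 ≤ q.1 then q else p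

/-- Invocation of `o`: `seq ← seq + 1; cmd ← (o, i, seq)`. -/
def invoke (i : Fin n) (o : O) (L : Local A G) : Local A G :=
  { L with seq := L.seq + 1, phase := .announce ⟨o, i, L.seq + 1⟩ }

open Classical in
/-- One step of process `i` inside `invoke`. The operator `arr` arranges sets of commands. -/
noncomputable def next (arr : Fin n → Finset (Cmd n O) → List (Cmd n O)) (i : Fin n)
    (L : Local A G) : StepAction (Reg A G) (Val A G) (Local A G) R :=
  match L.phase with
  | .idle => .skip L
  -- `M[i] ← cmd`
  | .announce cmd =>
      .write (.M i) (some cmd) { L with phase := .start cmd (List.finRange n) (L.r, L.s) }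
  -- `(r, s) ←` the pair with the largest round among the `S[j]` and the current `(r, s)`
  | .start cmd (j :: js) best =>
      .read (.S j) fun p => { L with phase := .start cmd js (later A best p) }
  -- enter the loop (`u = ε`): `r ← r + 1`
  | .start cmd [] best =>
      .skip { L with r := best.1 + 1, s := best.2, phase := .help cmd (List.finRange n) ∅ }
  -- collect the announced commands that are missing in `s`
  | .help cmd (j :: js) found =>
      .read (.M j) fun m =>
        { L with phase := .help cmd js (match m with
            | none => found
            | some d => if d ∈ L.s.ops then found else insert d found) }
  -- `s ← s · trace(M_i)`, and call `GCA_r.propose(s)`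
  | .help cmd [] found =>
      .skip { L with
        s := L.s * Trace.mk _ (arr i found)
        phase := .propose cmd L.r
          ((G L.r).invoke i (L.s * Trace.mk _ (arr i found)) ((G L.r).loc0 i)) }
  -- a step of `GCA_k`; on return of `(t, c)`, `s ← t`, and go on to `S[i] ← (r, s)` if `c` holds
  | .propose cmd k l =>
      match (G k).next i l with
      | .read x f => .read (.gca k x) fun y => { L with phase := .propose cmd k (f y) }
      | .write x y l' => .write (.gca k x) y { L with phase := .propose cmd k l' }
      | .skip l' => .skip { L with phase := .propose cmd k l' }
      | .ret (t, c) _ =>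
          .skip { L with
            s := t
            phase := if c = true then .record cmd else .check cmd (List.finRange n) (0, 1) }
  -- `S[i] ← (r, s)`
  | .record cmd =>
      .write (.S i) (L.r, L.s) { L with phase := .check cmd (List.finRange n) (0, 1) }
  -- `(_, u) ←` the pair with the largest round among the `S[j]`
  | .check cmd (j :: js) best =>
      .read (.S j) fun p => { L with phase := .check cmd js (later A best p) }
  -- return if `cmd ∈ ops u`, and otherwise do the next iteration, with `r ← r + 1`
  | .check cmd [] best =>
      if cmd ∈ best.2.ops then .ret ((A.cmdObj n).ret cmd best.2) { L with phase := .idle }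
      else .skip { L with r := L.r + 1, phase := .help cmd (List.finRange n) ∅ }

/-- The helping-based universal construction for the object `A` over the objects `GCA_k`. -/
noncomputable def construction (arr : Fin n → Finset (Cmd n O) → List (Cmd n O)) :
    Implementation.{u} n O R where
  Reg := Reg A G
  Val := Val A G
  Loc := Local A G
  mem0
    | .M _ => (none : Option (Cmd n O))
    | .S _ => ((0, 1) : ℕ × A.CmdTrace n)
    | .gca k x => (G k).mem0 x
  loc0 _ := ⟨0, 0, 1, .idle⟩
  invoke := invoke A G
  next := next A G arr

end Helping

end Construction

/-! Traces form a left-cancellative monoid in which a prefix of `a · z` either starts with `a` or is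
a prefix of `z` that commutes with `a` (`Trace.le_cons`). By induction on representatives,
compatible finite sets have joins and nonempty sets have meets (`Trace.exists_isLUB`,
`Trace.exists_isGLB`). The response of a command survives in every extension of a trace
(`SeqObject.ret_eq_of_le`).

GCA from registers: a process publishes its input, takes a snapshot of the inputs (its view),
publishes the view, and takes a snapshot of the views. Views are linearly ordered by inclusion.
Joins of compatible views grow with the view, meets of incompatible views shrink, and such a meet
lies below the join of any compatible view. So the possible outputs form a chain. A process commits
the join of a view if every view it sees is compatible and no process can still arrive with a view
of smaller join. Views contained in all others make a commit unavoidable when the inputs are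
compatible.

Safety of the construction: round `k` is a one-shot execution of `GCA_k` (`proj`, `proj_oneShot`),
and every input of round `k + 1` extends an output of round `k`. A trace committed in round `k` is a
prefix of all outputs of that round by adoption, and of all later inputs and outputs by the common
prefix property (`com_le_out`). Hence the records in `S` form a chain. Representatives that extend
each other turn the growing latest record into a growing legal sequential history. A command takes
effect when it is first recorded. This happens after its announcement, because traces contain only
announced commands, and before its response, because the process must first read it in a record.
Validity bounds multiplicities, so no command occurs twice.

Progress: a process that is stuck with `c` runs through all rounds from some round on, and helping
puts `c` into all inputs of late rounds (`exists_mem_input`). In a solo run it is the only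
participant of late rounds, so weak agreement makes it commit `c`. In an eventually conflict-free
execution, late inputs extend a fixed record by commands that do not conflict with `c`, so `c` can
directly follow that record; by the common prefix property every late commit contains `c`. If a late
commit is recorded, `c` returns. Otherwise the records become constant, the unrecorded announced
commands stay pending and pairwise non-conflicting, and every late input consists of the last record
and exactly these commands. The inputs are then equal as traces, and weak agreement produces the
missing commit. -/

/-! ### Equivalence of schedules: cancelling and moving single operations -/

namespace SchedEquiv

variable {C : Type u} {D : C → C → Prop}

theorem cons_cancel {a : C} {s t : List C} (h : SchedEquiv D (a :: s) (a :: t)) :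
    SchedEquiv D s t := by
  refine ⟨(List.perm_cons a).1 h.1, fun c d hcd => ?_⟩
  have h2 := h.2 c d hcd
  by_cases hc : a = c ∨ a = d
  · simpa [List.filter_cons, hc] using h2
  · simpa [List.filter_cons, hc] using h2

-- Cut `t` at its first `a`. If some `b` in front of it conflicted with `a`, the projection of `t`
-- to these two operations would begin inside `t₁`, hence not with `a`, while that of `a :: s`
-- begins with `a`. Both orders of the arguments are kept because `D` is not assumed symmetric.
open Classical in
theorem eq_append_of_cons {a : C} {s t : List C} (h : SchedEquiv D (a :: s) t) :
    ∃ t₁ t₂, t = t₁ ++ a :: t₂ ∧ a ∉ t₁ ∧ ∀ b ∈ t₁, ¬ D a b ∧ ¬ D b a := by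
  obtain ⟨t₁, t₂, rfl, ha⟩ := List.eq_append_cons_of_mem (h.1.subset List.mem_cons_self)
  have key : ∀ b ∈ t₁, ∀ c d : C, (a = c ∨ a = d) → (b = c ∨ b = d) → ¬ D c d := by
    intro b hb c d hac hbd hD
    have h2 := h.2 c d hD
    have hmem : b ∈ t₁.filter (fun x => decide (x = c ∨ x = d)) := by simp [hb, hbd]
    rw [List.filter_append] at h2
    cases hf : t₁.filter (fun x => decide (x = c ∨ x = d)) with
    | nil => rw [hf] at hmem; simp at hmem
    | cons x l =>
      rw [hf] at h2
      have hx : x ∈ t₁.filter (fun x => decide (x = c ∨ x = d)) := by rw [hf]; simp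
      simp only [List.filter_cons, hac, decide_true, if_true, List.cons_append,
        List.cons.injEq] at h2
      exact ha (h2.1 ▸ (List.mem_filter.1 hx).1)
  exact ⟨t₁, t₂, rfl, ha, fun b hb =>
    ⟨key b hb a b (.inl rfl) (.inr rfl), key b hb b a (.inr rfl) (.inl rfl)⟩⟩

open Classical in
theorem move_front {a : C} {t₁ : List C} (ha : a ∉ t₁) (h : ∀ b ∈ t₁, ¬ D a b ∧ ¬ D b a)
    (t₂ : List C) : SchedEquiv D (t₁ ++ a :: t₂) (a :: (t₁ ++ t₂)) := by
  refine ⟨List.perm_middle, fun c d hcd => ?_⟩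
  by_cases hc : a = c ∨ a = d
  · have : t₁.filter (fun x => decide (x = c ∨ x = d)) = [] := by
      rw [List.filter_eq_nil_iff]
      intro b hb hb'
      simp only [decide_eq_true_eq] at hb'
      have hne : b ≠ a := fun e => ha (e ▸ hb)
      rcases hc with rfl | rfl
      · rcases hb' with rfl | rfl
        · exact hne rfl
        · exact (h b hb).1 hcd
      · rcases hb' with rfl | rfl
        · exact (h b hb).2 hcd
        · exact hne rfl
    rw [List.filter_append, this, List.filter_cons_of_pos (by simpa using hc),
      List.filter_cons_of_pos (by simpa using hc), List.filter_append, this]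
    rfl
  · rw [List.filter_append, List.filter_cons_of_neg (by simpa using hc),
      List.filter_cons_of_neg (by simpa using hc), List.filter_append]

theorem trans' {s t r : List C} (h : SchedEquiv D s t) (k : SchedEquiv D t r) :
    SchedEquiv D s r := (schedSetoid D).iseqv.trans h k

-- The projection to a conflicting pair keeps at most one element, also when the pair is `a, a`, and
-- a permutation of such a list is trivial. Later this identifies inputs that add the same
-- non-conflicting commands in different orders.
open Classical in
theorem of_pairwise {s t : List C} (hp : s.Perm t) (hs : s.Nodup)
    (h : ∀ a ∈ s, ∀ b ∈ s, a ≠ b → ¬ D a b) : SchedEquiv D s t := by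
  refine ⟨hp, fun a b hab => ?_⟩
  have hp' := hp.filter (fun x => decide (x = a ∨ x = b))
  have hn : (s.filter (fun x => decide (x = a ∨ x = b))).Nodup := hs.filter _
  have hall : ∀ x ∈ s.filter (fun x => decide (x = a ∨ x = b)), ∀ y ∈ s.filter (fun x => decide (x = a ∨ x = b)),
      x = y := by
    intro x hx y hy
    simp only [List.mem_filter, decide_eq_true_eq] at hx hy
    by_contra hne
    rcases hx with ⟨hx, rfl | rfl⟩ <;> rcases hy with ⟨hy, rfl | rfl⟩
    · exact hne rfl
    · exact h _ hx _ hy hne hab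
    · exact h _ hy _ hx (Ne.symm hne) hab
    · exact hne rfl
  match hf : s.filter (fun x => decide (x = a ∨ x = b)) with
  | [] => rw [hf] at hp'; exact (List.nil_perm.1 hp').symm
  | [x] => rw [hf] at hp'; exact List.singleton_perm.1 hp'
  | x :: y :: l =>
    rw [hf] at hn hall
    have := hall x (by simp) y (by simp)
    simp [this] at hn

end SchedEquiv

/-! ### The prefix order on traces: cancellation, joins and meets -/

namespace Trace

variable {C : Type u} {D : C → C → Prop}

theorem mk_eq_iff {s t : List C} : mk D s = mk D t ↔ SchedEquiv D s t :=
  ⟨fun h => Quotient.exact h, fun h => Quotient.sound (s := schedSetoid D) h⟩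

theorem mk_rep (x : Trace D) : mk D x.rep = x := Quotient.out_eq x

theorem exists_mk (x : Trace D) : ∃ s, mk D s = x := ⟨x.rep, mk_rep x⟩

theorem mk_append (s t : List C) : mk D (s ++ t) = mk D s * mk D t := rfl

theorem mk_nil : mk D [] = 1 := rfl

theorem mk_cons (a : C) (s : List C) : mk D (a :: s) = mk D [a] * mk D s := rfl

@[simp] theorem ops_mk (s : List C) : (mk D s).ops = (s : Multiset C) := rfl

@[simp] theorem ops_one : (1 : Trace D).ops = 0 := rfl

@[simp] theorem ops_mul (x y : Trace D) : (x * y).ops = x.ops + y.ops := by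
  obtain ⟨s, rfl⟩ := exists_mk x
  obtain ⟨t, rfl⟩ := exists_mk y
  rw [← mk_append]; simp

theorem coe_rep (x : Trace D) : (x.rep : Multiset C) = x.ops := by
  conv_rhs => rw [← mk_rep x]
  rfl

theorem eq_one_of_ops {x : Trace D} (h : x.ops = 0) : x = 1 := by
  obtain ⟨s, rfl⟩ := exists_mk x
  simp only [ops_mk, Multiset.coe_eq_zero] at h
  rw [h, mk_nil]

theorem le_mul (x y : Trace D) : x ≤ x * y := ⟨y, rfl⟩

theorem ops_le {x y : Trace D} (h : x ≤ y) : x.ops ≤ y.ops := by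
  obtain ⟨z, rfl⟩ := h
  simp

instance : PartialOrder (Trace D) where
  le := (· ≤ ·)
  le_refl x := ⟨1, (mul_one x).symm⟩
  le_trans := by
    rintro x _ _ ⟨y, rfl⟩ ⟨z, rfl⟩
    exact ⟨y * z, mul_assoc _ _ _⟩
  le_antisymm := by
    rintro x _ ⟨y, rfl⟩ ⟨z, h⟩
    have := congrArg ops h
    have hy : y.ops = 0 := by
      simp only [ops_mul, add_assoc, left_eq_add] at this
      exact (add_eq_zero.1 this).1
    rw [eq_one_of_ops hy, mul_one]

theorem one_le (x : Trace D) : 1 ≤ x := ⟨x, (one_mul x).symm⟩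

theorem cons_cancel {a : C} {x y : Trace D} (h : mk D [a] * x = mk D [a] * y) : x = y := by
  obtain ⟨s, rfl⟩ := exists_mk x
  obtain ⟨t, rfl⟩ := exists_mk y
  rw [← mk_append, ← mk_append, mk_eq_iff] at h
  exact mk_eq_iff.2 h.cons_cancel

theorem mul_cancel {x y z : Trace D} (h : x * y = x * z) : y = z := by
  obtain ⟨s, rfl⟩ := exists_mk x
  induction s with
  | nil => simpa [mk_nil] using h
  | cons a s ih =>
    rw [mk_cons, mul_assoc, mul_assoc] at h
    exact ih (cons_cancel h)

theorem mul_le_mul_left' {x y : Trace D} (z : Trace D) (h : x ≤ y) : z * x ≤ z * y := by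
  obtain ⟨w, rfl⟩ := h
  exact ⟨w, (mul_assoc _ _ _).symm⟩

theorem le_of_mul_le {x y z : Trace D} (h : z * x ≤ z * y) : x ≤ y := by
  obtain ⟨w, h⟩ := h
  rw [mul_assoc] at h
  exact ⟨w, mul_cancel h⟩

/-- A prefix `y` of `a · z` either starts with `a`, or is a prefix of `z` that commutes with `a`. -/
theorem le_cons {a : C} {y z : Trace D} (h : y ≤ mk D [a] * z) :
    (∃ y', y = mk D [a] * y' ∧ y' ≤ z) ∨
      (a ∉ y.ops ∧ y ≤ z ∧ mk D [a] * y = y * mk D [a]) := by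
  obtain ⟨w, h⟩ := h
  obtain ⟨t, rfl⟩ := exists_mk z
  obtain ⟨s, rfl⟩ := exists_mk y
  obtain ⟨r, rfl⟩ := exists_mk w
  rw [← mk_append, ← mk_append, mk_eq_iff] at h
  obtain ⟨t₁, t₂, h₁, ha, hD⟩ := h.eq_append_of_cons
  have h₂ : SchedEquiv D t (t₁ ++ t₂) := by
    have := h
    rw [h₁] at this
    exact (this.trans' (SchedEquiv.move_front ha hD t₂)).cons_cancel
  -- The end of `y` falls before or after the first `a` of the product. Before it, all of `y`
  -- commutes with `a`; after it, `a` can be moved to the front of `y`. An empty `bs` is again the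
  -- first situation.
  rcases List.append_eq_append_iff.1 h₁ with ⟨as, rfl, rfl⟩ | ⟨bs, rfl, h₃⟩
  · right
    simp only [List.mem_append, not_or] at ha
    refine ⟨by simpa using ha.1, ?_, ?_⟩
    · rw [mk_eq_iff.2 h₂, List.append_assoc, mk_append]
      exact le_mul _ _
    · have := SchedEquiv.move_front ha.1 (fun b hb => hD b (List.mem_append_left _ hb)) []
      rw [List.append_nil] at this
      exact (mk_eq_iff.2 this).symm
  · cases bs with
    | nil =>
      right
      simp only [List.append_nil, List.nil_append] at h₃ hD ha ⊢
      refine ⟨by simpa using ha, ?_, ?_⟩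
      · rw [mk_eq_iff.2 h₂, mk_append]
        exact le_mul _ _
      · have := SchedEquiv.move_front ha hD []
        rw [List.append_nil] at this
        exact (mk_eq_iff.2 this).symm
    | cons b bs =>
      left
      simp only [List.cons_append, List.cons.injEq] at h₃
      obtain ⟨rfl, rfl⟩ := h₃
      refine ⟨mk D (t₁ ++ bs), mk_eq_iff.2 (SchedEquiv.move_front ha hD bs), ?_⟩
      rw [mk_eq_iff.2 h₂, ← List.append_assoc, mk_append (t₁ ++ bs)]
      exact le_mul _ _

open Classical in
/-- Two traces with a common extension have a least one, which contains each operation as often as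
one of the two. -/
theorem exists_lub (x y : Trace D) (h : ∃ z, x ≤ z ∧ y ≤ z) :
    ∃ j, x ≤ j ∧ y ≤ j ∧ (∀ z, x ≤ z → y ≤ z → j ≤ z) ∧
      ∀ o, j.ops.count o = max (x.ops.count o) (y.ops.count o) := by
  obtain ⟨s, rfl⟩ := exists_mk x
  induction s generalizing y with
  | nil => exact ⟨y, one_le y, le_rfl, fun z _ hz => hz, by simp⟩
  | cons a s ih =>
    obtain ⟨z, ⟨w, rfl⟩, hy⟩ := h
    rw [mk_cons a s, mul_assoc] at hy
    rw [mk_cons a s]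
    have hcons : ∀ {x z : Trace D}, mk D [a] * x ≤ z → ∃ z', z = mk D [a] * z' ∧ x ≤ z' := by
      rintro x _ ⟨v, rfl⟩
      exact ⟨x * v, mul_assoc _ _ _, le_mul _ _⟩
    -- If `y` also starts with `a`, strip `a` from both traces. Otherwise `a` commutes with `y`, and
    -- the join is `a` followed by the join of `y` with the rest of `x`.
    rcases le_cons hy with ⟨y', rfl, hy'⟩ | ⟨ha, hyz, hcomm⟩
    · obtain ⟨j, hxj, hyj, hj, hc⟩ := ih y' ⟨_, le_mul _ _, hy'⟩
      refine ⟨mk D [a] * j, mul_le_mul_left' _ hxj, mul_le_mul_left' _ hyj, fun z hxz hyz => ?_,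
        fun o => ?_⟩
      · obtain ⟨z', rfl, hz'⟩ := hcons hxz
        exact mul_le_mul_left' _ (hj _ hz' (le_of_mul_le hyz))
      · simp only [ops_mul, Multiset.count_add, hc]
        omega
    · obtain ⟨j, hxj, hyj, hj, hc⟩ := ih y ⟨_, le_mul _ _, hyz⟩
      refine ⟨mk D [a] * j, mul_le_mul_left' _ hxj, ?_, fun z hxz hyz => ?_, fun o => ?_⟩
      · obtain ⟨w, rfl⟩ := hyj
        rw [← mul_assoc, hcomm, mul_assoc]
        exact le_mul _ _
      · obtain ⟨z', rfl, hz'⟩ := hcons hxz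
        refine mul_le_mul_left' _ (hj _ hz' ?_)
        rcases le_cons hyz with ⟨y', rfl, -⟩ | ⟨-, h, -⟩
        · simp at ha
        · exact h
      · simp only [ops_mul, Multiset.count_add, hc]
        by_cases h : o = a
        · subst h
          rw [Multiset.count_eq_zero.2 ha]
          omega
        · have : Multiset.count o (mk D [a]).ops = 0 := by
            rw [Multiset.count_eq_zero]
            simpa using h
          omega

-- Iterate the binary join: the common bound also bounds the join obtained so far. The
-- multiplicities are maxima, so each is attained by some member, which is what validity of GCA asks
-- for.
open Classical in
theorem exists_isLUB (S : Set (Trace D)) (hS : S.Finite) (h : Compatible S) :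
    ∃ j, IsLUB S j ∧ ∀ o ∈ j.ops, ∃ x ∈ S, j.ops.count o ≤ x.ops.count o := by
  induction S, hS using Set.Finite.induction_on with
  | empty => exact ⟨1, ⟨by simp, fun z _ => one_le z⟩, by simp⟩
  | @insert x S _ _ ih =>
    obtain ⟨z, hz⟩ := h
    obtain ⟨j, hj, hc⟩ := ih ⟨z, fun y hy => hz y (Set.mem_insert_of_mem _ hy)⟩
    obtain ⟨k, hxk, hjk, hk, hkc⟩ := exists_lub x j
      ⟨z, hz x (Set.mem_insert _ _), hj.2 fun y hy => hz y (Set.mem_insert_of_mem _ hy)⟩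
    refine ⟨k, ⟨?_, fun w hw => hk _ (hw (Set.mem_insert _ _))
      (hj.2 fun y hy => hw (Set.mem_insert_of_mem _ hy))⟩, fun o ho => ?_⟩
    · rintro y (rfl | hy)
      · exact hxk
      · exact (hj.1 hy).trans hjk
    · rcases le_total (x.ops.count o) (j.ops.count o) with hle | hle
      · have e : k.ops.count o = j.ops.count o := by rw [hkc, max_eq_right hle]
        obtain ⟨y, hy, hyc⟩ := hc o (Multiset.count_pos.1 (e ▸ Multiset.count_pos.2 ho))
        exact ⟨y, Set.mem_insert_of_mem _ hy, e ▸ hyc⟩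
      · exact ⟨x, Set.mem_insert _ _, by rw [hkc, max_eq_left hle]⟩

/-- A common prefix with the largest number of operations works. Its join with any other common
prefix exists, since one member of `S` bounds both, and is again a common prefix; having no more
operations, it is the same trace. -/
theorem exists_isGLB (S : Set (Trace D)) (hS : S.Nonempty) : ∃ m, IsGLB S m := by
  obtain ⟨x, hx⟩ := hS
  have hb : ∃ N, ∃ m ∈ lowerBounds S, m.ops.card = N :=
    ⟨0, 1, fun y _ => one_le y, by simp⟩
  have hle : ∀ N, (∃ m ∈ lowerBounds S, m.ops.card = N) → N ≤ x.ops.card := by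
    rintro N ⟨m, hm, rfl⟩
    exact Multiset.card_le_card (ops_le (hm hx))
  classical
  obtain ⟨N₀, hN₀⟩ := hb
  obtain ⟨m, hm, hmc⟩ := Nat.findGreatest_spec (P := fun N => ∃ m ∈ lowerBounds S, m.ops.card = N)
    (hle _ hN₀) hN₀
  refine ⟨m, hm, fun e he => ?_⟩
  obtain ⟨j, hej, hmj, hj, -⟩ := exists_lub e m ⟨x, he hx, hm hx⟩
  have hjl : j ∈ lowerBounds S := fun y hy => hj _ (he hy) (hm hy)
  have hcard : j.ops.card ≤ m.ops.card := by
    rw [hmc]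
    exact Nat.le_findGreatest (hle _ ⟨j, hjl, rfl⟩) ⟨j, hjl, rfl⟩
  obtain ⟨z, rfl⟩ := hmj
  have : z = 1 := eq_one_of_ops (by
    rw [ops_mul, Multiset.card_add] at hcard
    exact Multiset.card_eq_zero.1 (by omega))
  rwa [this, mul_one] at hej

/-- An operation that occurs in `y` and commutes with all others in `y` can be moved to the
front. -/
theorem singleton_le {a : C} {y : Trace D} (ha : a ∈ y.ops)
    (h : ∀ b ∈ y.ops, b ≠ a → ¬ D a b ∧ ¬ D b a) : mk D [a] ≤ y := by
  obtain ⟨s, rfl⟩ := exists_mk y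
  obtain ⟨t₁, t₂, rfl, ha'⟩ := List.eq_append_cons_of_mem (by simpa using ha : a ∈ s)
  refine ⟨mk D (t₁ ++ t₂), mk_eq_iff.2 (SchedEquiv.move_front ha' (fun b hb => ?_) t₂)⟩
  exact h b (by simp [hb]) (fun e => ha' (e ▸ hb))

theorem eq_of_ops {x y : Trace D} (h : x.ops = y.ops) (hn : x.ops.Nodup)
    (hD : ∀ a ∈ x.ops, ∀ b ∈ x.ops, a ≠ b → ¬ D a b) : x = y := by
  obtain ⟨s, rfl⟩ := exists_mk x
  obtain ⟨t, rfl⟩ := exists_mk y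
  exact mk_eq_iff.2 (SchedEquiv.of_pairwise (Multiset.coe_eq_coe.1 h) (by simpa using hn)
    (by simpa using hD))

/-- An increasing sequence of traces has representatives that extend each other. -/
theorem exists_rep_seq (U : ℕ → Trace D) (h0 : U 0 = 1) (h : ∀ t, U t ≤ U (t + 1)) :
    ∃ w : ℕ → List C, w 0 = [] ∧ (∀ t, w t <+: w (t + 1)) ∧ ∀ t, mk D (w t) = U t := by
  choose z hz using h
  refine ⟨fun t => Nat.rec [] (fun t l => l ++ (z t).rep) t, rfl, fun t => ⟨_, rfl⟩, fun t => ?_⟩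
  induction t with
  | zero => exact h0.symm
  | succ t ih =>
    change mk D (_ ++ (z t).rep) = _
    rw [mk_append, ih, mk_rep, hz]

end Trace

/-! ### Responses depend only on the trace and survive in extensions -/

namespace SeqObject

variable {Q : Type v} {O : Type u} {R : Type w} (A : SeqObject Q O R)

theorem retFrom_append {o : O} {s : List O} (h : o ∈ s) (q : Q) (t : List O) :
    A.retFrom o q (s ++ t) = A.retFrom o q s := by
  induction s generalizing q with
  | nil => simp at h
  | cons a s ih =>
    by_cases ha : a = o
    · simp [retFrom, ha]
    · simp only [List.cons_append, retFrom, ha, if_false]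
      exact ih (by simpa [Ne.symm ha] using h) _

theorem not_conflict {a b : O} (h : ¬ A.Conflict a b) (q : Q) :
    (A.σ b (A.σ a q).2).2 = (A.σ a (A.σ b q).2).2 ∧
      (A.σ b (A.σ a q).2).1 = (A.σ b q).1 ∧ (A.σ a (A.σ b q).2).1 = (A.σ a q).1 := by
  simp only [Conflict, not_exists, not_not] at h
  obtain ⟨ra, rb, q1, q2, q', h1, h2, h3, h4⟩ := h q
  simp [h1, h2, h3, h4]

/-- Exchange `a` with its predecessors one at a time: an exchange of commuting operations preserves
both responses and the state reached. -/
theorem retFrom_move_front (o : O) {a : O} {s : List O} (ha : a ∉ s)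
    (h : ∀ b ∈ s, ¬ A.Conflict a b) (q : Q) (t : List O) :
    A.retFrom o q (s ++ a :: t) = A.retFrom o q (a :: (s ++ t)) := by
  induction s generalizing q with
  | nil => rfl
  | cons b s ih =>
    have hab : a ≠ b := by rintro rfl; simp at ha
    have hc := A.not_conflict (h b (by simp)) q
    simp only [List.cons_append, retFrom]
    rw [ih (by simp at ha; exact ha.2) (fun c hc => h c (by simp [hc]))]
    simp only [retFrom]
    by_cases hb : b = o
    · subst hb
      simp only [if_true, hab, if_false]
      exact hc.2.1.symm
    · simp only [hb, if_false]
      by_cases ho : a = o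
      · simp only [ho, if_true]
        subst ho
        exact hc.2.2
      · simp only [ho, if_false]
        rw [hc.1]

theorem retFrom_equiv (o : O) {s t : List O} (h : SchedEquiv A.Conflict s t) (q : Q) :
    A.retFrom o q s = A.retFrom o q t := by
  induction s generalizing q t with
  | nil => rw [List.nil_perm.1 h.1]
  | cons a s ih =>
    obtain ⟨t₁, t₂, rfl, ha, hD⟩ := h.eq_append_of_cons
    have h' := (h.trans' (SchedEquiv.move_front ha hD t₂)).cons_cancel
    rw [A.retFrom_move_front o ha (fun b hb => (hD b hb).1)]
    simp only [retFrom]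
    rw [ih h']

/-- A representative of `x` can be continued to one equivalent to `s`, and what follows the first
`o` has no influence on its response. So a process may compute its response from an outdated record.
-/
theorem ret_eq_of_le {o : O} {x : Trace A.Conflict} {s : List O} (ho : o ∈ x.ops)
    (h : x ≤ Trace.mk _ s) : A.ret o x = A.retFrom o A.q0 s := by
  obtain ⟨z, hz⟩ := h
  have ho' : o ∈ x.rep := by rwa [← Multiset.mem_coe, Trace.coe_rep]
  rw [← Trace.mk_rep x, ← Trace.mk_rep z, ← Trace.mk_append, Trace.mk_eq_iff] at hz
  rw [ret, A.retFrom_equiv o hz, A.retFrom_append ho']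

end SeqObject

/-! ### Executions in general: truncation, pending operations, histories -/

namespace Implementation

variable {n : ℕ} {O : Type v} {R : Type w} {I : Implementation.{u} n O R}

theorem Config.after_other (c : I.Config) (e : Event n O) {i : Fin n} (h : e.proc ≠ i) :
    (c.after e).loc i = c.loc i ∧ (c.after e).pend i = c.pend i := by
  cases e with
  | invoke j o =>
    have : i ≠ j := fun e => h e.symm
    simp [Config.after, this]
  | step j =>
    have : i ≠ j := fun e => h e.symm
    simp only [Config.after]
    split <;> simp [this]

namespace Execution

variable (X : I.Execution)

/-- The execution `X` until time `T`, when everything stops. -/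
def trunc (T : ℕ) : I.Execution where
  ev t := if t < T then X.ev t else none
  conf t := X.conf (min t T)
  conf_zero := by simpa using X.conf_zero
  conf_none t ht := by
    by_cases h : t < T
    · rw [if_pos h] at ht
      rw [Nat.min_eq_left h.le, Nat.min_eq_left h]
      exact X.conf_none t ht
    · rw [Nat.min_eq_right (by omega), Nat.min_eq_right (by omega)]
  conf_some t e ht := by
    by_cases h : t < T
    · rw [if_pos h] at ht
      rw [Nat.min_eq_left h.le, Nat.min_eq_left h]
      exact X.conf_some t e ht
    · simp [h] at ht

theorem trunc_ev {T t : ℕ} {e : Event n O} :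
    (X.trunc T).ev t = some e ↔ t < T ∧ X.ev t = some e := by
  simp [trunc]

theorem trunc_oneShot {T : ℕ} (h : X.OneShot) : (X.trunc T).OneShot :=
  fun t t' i o o' h1 h2 => h t t' i o o' (X.trunc_ev.1 h1).2 (X.trunc_ev.1 h2).2

theorem trunc_returned {T t : ℕ} {i : Fin n} {r : R} {l : I.Loc} (hT : t < T)
    (he : X.ev t = some (.step i)) (hl : I.next i ((X.conf t).loc i) = .ret r l) :
    (X.trunc T).Returned i r :=
  ⟨t, l, X.trunc_ev.2 ⟨hT, he⟩, by
    simp only [trunc]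
    rw [Nat.min_eq_left hT.le]
    exact hl⟩

theorem conf_other {t : ℕ} {i : Fin n} (h : ∀ e, X.ev t = some e → e.proc ≠ i) :
    (X.conf (t + 1)).loc i = (X.conf t).loc i ∧ (X.conf (t + 1)).pend i = (X.conf t).pend i := by
  cases he : X.ev t with
  | none => rw [X.conf_none t he]; exact ⟨rfl, rfl⟩
  | some e =>
    rw [(X.conf_some t e he).2]
    exact (X.conf t).after_other e (h e he)

theorem pend_of_step {t : ℕ} {i : Fin n} (h : X.ev t = some (.step i)) :
    (X.conf t).pend i ≠ none := (X.conf_some t _ h).1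

theorem pend_of_invoke {t : ℕ} {i : Fin n} {o : O} (h : X.ev t = some (.invoke i o)) :
    (X.conf t).pend i = none ∧ (X.conf (t + 1)).pend i = some o := by
  refine ⟨(X.conf_some t _ h).1, ?_⟩
  rw [(X.conf_some t _ h).2]
  simp [Config.after]

/-- A pending operation stays pending as long as it does not return. -/
theorem pend_succ_of_not_ret {t : ℕ} {i : Fin n} {o : O} (hp : (X.conf t).pend i = some o)
    (h : ∀ r l, X.ev t = some (.step i) → I.next i ((X.conf t).loc i) ≠ .ret r l) :
    (X.conf (t + 1)).pend i = some o := by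
  cases he : X.ev t with
  | none => rw [X.conf_none t he]; exact hp
  | some e =>
    by_cases hi : e.proc = i
    · have hc := X.conf_some t e he
      cases e with
      | invoke j o' =>
        obtain rfl : j = i := hi
        have := hc.1
        simp [Config.Enabled, hp] at this
      | step j =>
        obtain rfl : j = i := hi
        rw [hc.2]
        simp only [Config.after]
        split
        · exact hp
        · exact hp
        · exact hp
        · next r l hr => exact absurd hr (h r l he)
    · rw [(X.conf_other (t := t) (i := i) (by rw [he]; rintro _ ⟨⟩; exact hi)).2, hp]

/-- An event contributes at most one entry, so every entry of the history has a time of its own, and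
the history up to that time is exactly what precedes the entry. -/
theorem exists_of_history_eq {T : ℕ} {H₁ H₂ : List (HEvent n O R)} {x : HEvent n O R}
    (h : X.history T = H₁ ++ x :: H₂) :
    ∃ t e, t < T ∧ X.history t = H₁ ∧ X.ev t = some e ∧ (X.conf t).label e = [x] := by
  induction T generalizing H₂ with
  | zero => simp [history] at h
  | succ T ih =>
    simp only [history] at h
    cases he : X.ev T with
    | none =>
      rw [he] at h
      simp only [List.append_nil] at h
      obtain ⟨t, e, ht, hh⟩ := ih h
      exact ⟨t, e, ht.trans T.lt_succ_self, hh⟩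
    | some e =>
      rw [he] at h
      have hl : (X.conf T).label e = [] ∨ ∃ y, (X.conf T).label e = [y] := by
        cases e with
        | invoke => exact .inr ⟨_, rfl⟩
        | step => simp only [Config.label]; split <;> simp
      rcases hl with hl | ⟨y, hl⟩
      · simp only [hl, List.append_nil] at h
        obtain ⟨t, e, ht, hh⟩ := ih h
        exact ⟨t, e, ht.trans T.lt_succ_self, hh⟩
      · simp only [hl] at h
        rcases List.eq_nil_or_concat H₂ with rfl | ⟨L, z, rfl⟩
        · obtain ⟨h1, h2⟩ := List.append_inj' h rfl
          exact ⟨T, e, T.lt_succ_self, h1, he, by rw [hl, h2]⟩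
        · rw [List.concat_eq_append, ← List.cons_append, ← List.append_assoc] at h
          obtain ⟨t, e, ht, hh⟩ := ih (List.append_inj' h rfl).1
          exact ⟨t, e, ht.trans T.lt_succ_self, hh⟩

end Execution

end Implementation

/-! ### A criterion for linearizability -/

section Linearizability

variable {Q : Type*} {n : ℕ} {O : Type v} {R : Type w}

theorem seqHistory_append (S S' : List (Fin n × O × R)) :
    seqHistory (S ++ S') = seqHistory S ++ seqHistory S' := List.flatMap_append

theorem seqHistory_cons (p : Fin n × O × R) (S : List (Fin n × O × R)) :
    seqHistory (p :: S) = .inv p.1 p.2.1 :: .res p.1 p.2.2 :: seqHistory S := rfl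

theorem invCount_cons (e : HEvent n O R) (H : List (HEvent n O R)) (i : Fin n) :
    invCount (e :: H) i = invCount H i + invCount [e] i := by
  simp only [invCount, List.countP_cons, List.countP_nil, zero_add]

theorem resCount_res (i : Fin n) (r : R) : resCount ([.res i r] : List (HEvent n O R)) i = 1 := by
  simp [resCount]

theorem resCount_inv (i j : Fin n) (o : O) :
    resCount ([.inv j o] : List (HEvent n O R)) i = 0 := by
  simp [resCount]

theorem invCount_res (i j : Fin n) (r : R) :
    invCount ([.res j r] : List (HEvent n O R)) i = 0 := by
  simp [invCount]

theorem invCount_inv (i : Fin n) (o : O) : invCount ([.inv i o] : List (HEvent n O R)) i = 1 := by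
  simp [invCount]

theorem resCount_append (H H' : List (HEvent n O R)) (i : Fin n) :
    resCount (H ++ H') i = resCount H i + resCount H' i := List.countP_append

theorem invCount_append (H H' : List (HEvent n O R)) (i : Fin n) :
    invCount (H ++ H') i = invCount H i + invCount H' i := List.countP_append

theorem resCount_restrict (H : List (HEvent n O R)) (i : Fin n) :
    resCount (restrict H i) i = resCount H i := by
  rw [resCount, restrict, List.countP_filter]
  refine List.countP_congr fun e _ => ?_
  cases e <;> simp +contextual [HEvent.proc]

theorem invCount_restrict (H : List (HEvent n O R)) (i : Fin n) :
    invCount (restrict H i) i = invCount H i := by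
  rw [invCount, restrict, List.countP_filter]
  refine List.countP_congr fun e _ => ?_
  cases e <;> simp +contextual [HEvent.proc]

theorem restrict_append (H H' : List (HEvent n O R)) (i : Fin n) :
    restrict (H ++ H') i = restrict H i ++ restrict H' i := List.filter_append ..

/-- The entries of process `i` in a sequential history. -/
def entries (S : List (Fin n × O × R)) (i : Fin n) : List (Fin n × O × R) :=
  S.filter fun p => p.1 = i

theorem entries_append (S S' : List (Fin n × O × R)) (i : Fin n) :
    entries (S ++ S') i = entries S i ++ entries S' i := List.filter_append ..

theorem restrict_seqHistory (S : List (Fin n × O × R)) (i : Fin n) :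
    restrict (seqHistory S) i = seqHistory (entries S i) := by
  induction S with
  | nil => rfl
  | cons p S ih =>
    rw [seqHistory_cons]
    have h1 : ∀ (e : HEvent n O R) H, restrict (e :: H) i =
        if e.proc = i then e :: restrict H i else restrict H i := by
      intro e H
      simp [restrict, List.filter_cons]
    rw [h1, h1, ih]
    by_cases h : p.1 = i
    · simp [HEvent.proc, h, entries, seqHistory_cons]
    · simp [HEvent.proc, h, entries]

theorem count_seqHistory (S : List (Fin n × O × R)) (i : Fin n) :
    resCount (seqHistory S) i = (entries S i).length ∧
      invCount (seqHistory S) i = (entries S i).length := by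
  induction S with
  | nil => exact ⟨rfl, rfl⟩
  | cons p S ih =>
    simp only [resCount, invCount, entries] at ih ⊢
    rw [seqHistory_cons]
    by_cases h : p.1 = i
    · simp [h, ih]
    · simp [h, ih]

theorem entries_entries (S : List (Fin n × O × R)) (i : Fin n) :
    entries (entries S i) i = entries S i := by
  simp [entries, List.filter_filter]

theorem mem_restrict {H : List (HEvent n O R)} {e : HEvent n O R} {i : Fin n} :
    e ∈ restrict H i ↔ e ∈ H ∧ e.proc = i := by
  simp [restrict]

theorem restrict_removePending (H : List (HEvent n O R)) (i : Fin n) :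
    restrict (removePending H) i = removePending (restrict H i) := by
  induction H with
  | nil => rfl
  | cons e H ih =>
    cases e with
    | res j r =>
      by_cases h : j = i
      · simp only [restrict, removePending, List.filter_cons, HEvent.proc, h, decide_true,
          if_true] at ih ⊢
        rw [ih]
      · simp only [restrict, removePending, List.filter_cons, HEvent.proc, h, decide_false,
          Bool.false_eq_true, if_false] at ih ⊢
        rw [ih]
    | inv j o =>
      by_cases h : j = i
      · subst h
        have hr : restrict (.inv j o :: H) j = .inv j o :: restrict H j := by
          simp [restrict, HEvent.proc]
        have hex : (∃ r, HEvent.res j r ∈ restrict H j) ↔ ∃ r, HEvent.res j r ∈ H := by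
          simp [mem_restrict, HEvent.proc]
        rw [hr]
        by_cases hx : ∃ r, HEvent.res j r ∈ H
        · rw [removePending, removePending, if_pos hx, if_pos (hex.2 hx), ← ih]
          simp [restrict, HEvent.proc]
        · rw [removePending, removePending, if_neg hx, if_neg (fun h => hx (hex.1 h)), ih]
      · have hr : ∀ H : List (HEvent n O R), restrict (.inv j o :: H) i = restrict H i := by
          intro H
          simp [restrict, HEvent.proc, h]
        rw [hr, ← ih]
        simp only [removePending]
        split_ifs
        · rw [hr]
        · rfl

theorem removePending_seqHistory (S : List (Fin n × O × R)) (i : Fin n) (hS : ∀ p ∈ S, p.1 = i)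
    (H : List (HEvent n O R)) (hH : removePending H = []) :
    removePending (seqHistory S ++ H) = seqHistory S := by
  induction S with
  | nil => exact hH
  | cons p S ih =>
    rw [seqHistory_cons, List.cons_append, List.cons_append, removePending, if_pos
      ⟨p.2.2, List.mem_cons_self⟩, removePending, ih fun q hq => hS q (List.mem_cons_of_mem _ hq)]

/-- Only invocations are deleted, and only those with no later response of the same process. Hence
the response counts in front of a surviving entry do not change, nor do the invocation counts of a
process that responds at or after it. This carries positions in the completed history back to the
original one. -/
theorem removePending_split {L A B : List (HEvent n O R)} {x : HEvent n O R}
    (h : removePending L = A ++ x :: B) :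
    ∃ A₀ B₀, L = A₀ ++ x :: B₀ ∧ removePending B₀ = B ∧ (∀ i, resCount A i = resCount A₀ i) ∧
      (∀ j, (∃ r, HEvent.res j r ∈ x :: B₀) → invCount A j = invCount A₀ j) ∧
      ∀ j o, x = .inv j o → ∃ r, HEvent.res j r ∈ B₀ := by
  induction L generalizing A with
  | nil => simp [removePending] at h
  | cons e L ih =>
    have keep : ∀ (_ : removePending (e :: L) = e :: removePending L)
        (_ : ∀ j o, e = .inv j o → ∃ r, HEvent.res j r ∈ L), ∃ A₀ B₀, e :: L = A₀ ++ x :: B₀ ∧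
        removePending B₀ = B ∧ (∀ i, resCount A i = resCount A₀ i) ∧
        (∀ j, (∃ r, HEvent.res j r ∈ x :: B₀) → invCount A j = invCount A₀ j) ∧
        ∀ j o, x = .inv j o → ∃ r, HEvent.res j r ∈ B₀ := by
      intro hk hx
      rw [hk] at h
      cases A with
      | nil =>
        simp only [List.nil_append, List.cons.injEq] at h
        obtain ⟨rfl, rfl⟩ := h
        exact ⟨[], L, rfl, rfl, fun _ => rfl, fun _ _ => rfl, hx⟩
      | cons a A =>
        simp only [List.cons_append, List.cons.injEq] at h
        obtain ⟨rfl, h⟩ := h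
        obtain ⟨A₀, B₀, rfl, h1, h2, h3, h4⟩ := ih h
        refine ⟨e :: A₀, B₀, rfl, h1, fun i => ?_, fun j hj => ?_, h4⟩
        · rw [resCount, resCount, List.countP_cons, List.countP_cons]
          exact congrArg (· + _) (h2 i)
        · rw [invCount, invCount, List.countP_cons, List.countP_cons]
          exact congrArg (· + _) (h3 j hj)
    cases e with
    | res j r => exact keep rfl (by simp)
    | inv j o =>
      by_cases hj : ∃ r, HEvent.res j r ∈ L
      · refine keep (by rw [removePending, if_pos hj]) ?_
        rintro _ _ ⟨⟩
        exact hj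
      · rw [removePending, if_neg hj] at h
        obtain ⟨A₀, B₀, rfl, h1, h2, h3, h4⟩ := ih h
        refine ⟨.inv j o :: A₀, B₀, rfl, h1, fun i => ?_, fun k hk => ?_, h4⟩
        · rw [h2]
          simp [resCount]
        · rw [h3 k hk]
          have : j ≠ k := by
            rintro rfl
            obtain ⟨r, hr⟩ := hk
            exact hj ⟨r, List.mem_append_right _ hr⟩
          simp [invCount, this]

theorem exists_split_entries {S : List (Fin n × O × R)} {i : Fin n} {a : ℕ}
    (h : a < (entries S i).length) :
    ∃ P p P', S = P ++ p :: P' ∧ p.1 = i ∧ (entries P i).length = a := by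
  induction S generalizing a with
  | nil => simp [entries] at h
  | cons p S ih =>
    by_cases hp : p.1 = i
    · cases a with
      | zero => exact ⟨[], p, S, rfl, hp, rfl⟩
      | succ a =>
        obtain ⟨P, q, P', rfl, hq, hl⟩ := ih (a := a) (by
          simpa [entries, List.filter_cons, hp] using h)
        exact ⟨p :: P, q, P', rfl, hq, by simpa [entries, List.filter_cons, hp] using hl⟩
    · obtain ⟨P, q, P', rfl, hq, hl⟩ := ih (a := a) (by
        simpa [entries, List.filter_cons, hp] using h)
      exact ⟨p :: P, q, P', rfl, hq, by simpa [entries, List.filter_cons, hp] using hl⟩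

/-- Operation `a` of `i` lies inside `S`, while the operation of `j` numbered by its entries in `S`
is the first one of `j` in `S'`. -/
theorem precedes_seqHistory {S S' : List (Fin n × O × R)} {i j : Fin n} {a : ℕ}
    (ha : a < (entries S i).length) (hb : (entries S j).length < (entries (S ++ S') j).length) :
    Precedes (seqHistory (S ++ S')) i a j (entries S j).length := by
  obtain ⟨P, ⟨i, o, r⟩, P', rfl, rfl, hP⟩ := exists_split_entries ha
  rw [entries_append _ S', List.length_append] at hb
  obtain ⟨N, ⟨j, o', r'⟩, N', rfl, rfl, hN⟩ :=
    exists_split_entries (S := S') (i := j) (a := 0) (by omega)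
  refine ⟨seqHistory P ++ [.inv i o], seqHistory P' ++ seqHistory N,
    .res j r' :: seqHistory N', r, o', ?_, ?_, ?_⟩
  · simp [seqHistory_append, seqHistory_cons]
  · rw [resCount_append, (count_seqHistory _ _).1]
    simp only at hP ⊢
    rw [hP]
    simp [resCount]
  · have : seqHistory P ++ [.inv i o] ++ HEvent.res i r :: (seqHistory P' ++ seqHistory N) =
        seqHistory ((P ++ (i, o, r) :: P') ++ N) := by
      simp [seqHistory_append, seqHistory_cons]
    rw [this, (count_seqHistory _ _).2, entries_append, List.length_append]
    simp only at hN ⊢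
    rw [hN, add_zero]

/-- The events `h` of process `i`, whose pending operation is `p`, are those of the entries `f` of a
sequential history, up to a pending operation. -/
def Matches (p : Option O) (i : Fin n) (h : List (HEvent n O R)) (f : List (Fin n × O × R)) :
    Prop :=
  (p = none ∧ h = seqHistory f) ∨
    ∃ o, p = some o ∧ (h = seqHistory f ++ [.inv i o] ∨ ∃ r, h ++ [.res i r] = seqHistory f)

/-- An execution is linearizable at all times if there is an increasing sequence of legal sequential
histories that match the history process by process. -/
theorem linearizable_of_matches {I : Implementation.{u} n O R} {A : SeqObject Q O R}
    (X : I.Execution) (S : ℕ → List (Fin n × O × R)) (hmono : ∀ t, S t <+: S (t + 1))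
    (hlegal : ∀ t, LegalFrom A A.q0 (S t))
    (hS : ∀ t i, Matches ((X.conf t).pend i) i (restrict (X.history t) i) (entries (S t) i))
    (T : ℕ) : LinearizableHistory A (X.history T) := by
  classical
  have hmono' : ∀ {t t'}, t ≤ t' → S t <+: S t' := by
    intro t t' h
    induction h with
    | refl => exact List.prefix_rfl
    | step _ ih => exact ih.trans (hmono _)
  set H := X.history T with hH
  -- `r` is the response to be appended for `i`. Only an operation that is pending but already
  -- present in `S T` needs one; a pending operation that is not yet in `S T` is removed.
  have hex : ∀ i, ∃ r : Option R,
      (r = none → removePending (restrict H i) = seqHistory (entries (S T) i)) ∧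
      ∀ x, r = some x → restrict H i ++ [.res i x] = seqHistory (entries (S T) i) := by
    intro i
    have hi : ∀ p ∈ entries (S T) i, p.1 = i := by simp [entries]
    rcases hS T i with ⟨-, h⟩ | ⟨o, -, h | ⟨r, h⟩⟩
    · refine ⟨none, fun _ => ?_, by simp⟩
      have := removePending_seqHistory _ i hi [] rfl
      rw [List.append_nil] at this
      rw [h, this]
    · refine ⟨none, fun _ => ?_, by simp⟩
      rw [h, removePending_seqHistory _ i hi [.inv i o] (by simp [removePending])]
    · exact ⟨some r, by simp, by rintro _ ⟨⟩; exact h⟩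
  choose r hr0 hr1 using hex
  let E : List (Fin n × R) := (List.finRange n).filterMap fun i => (r i).map fun x => (i, x)
  have hE : ∀ p, p ∈ E ↔ r p.1 = some p.2 := by
    rintro ⟨i, x⟩
    simp [E, Option.map_eq_some_iff]
  have hnodup : (E.map Prod.fst).Nodup := by
    have : E.map Prod.fst = (List.finRange n).filter fun i => (r i).isSome := by
      simp only [E, List.map_filterMap]
      rw [← List.filterMap_eq_filter]
      refine List.filterMap_congr fun i _ => ?_
      cases h : r i <;> simp [h, Option.guard]
    rw [this]
    exact (List.nodup_finRange n).filter _
  have hEr : ∀ i, restrict (E.map fun p => (HEvent.res p.1 p.2 : HEvent n O R)) i =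
      match r i with
      | none => []
      | some x => [.res i x] := by
    intro i
    have h1 : restrict (E.map fun p => (HEvent.res p.1 p.2 : HEvent n O R)) i =
        (E.filter fun p => p.1 = i).map fun p => (HEvent.res p.1 p.2) := by
      simp only [restrict, List.filter_map]
      congr 1
    have h2 : (E.filter fun p => p.1 = i) = ((List.finRange n).filter fun j => j = i).filterMap
        fun i => (r i).map fun x => (i, x) := by
      simp only [E]
      rw [List.filter_filterMap, List.filterMap_filter]
      refine List.filterMap_congr fun j _ => ?_
      by_cases hj : j = i
      · cases h : r j <;> simp [hj, Option.filter]
      · cases h : r j <;> simp [hj, Option.filter]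
    have h3 : ((List.finRange n).filter fun j => j = i) = [i] := by
      refine List.perm_singleton.1 ((List.perm_ext_iff_of_nodup
        ((List.nodup_finRange n).filter _) (List.nodup_singleton i)).2 fun j => ?_)
      simp
    rw [h1, h2, h3]
    cases h : r i <;> simp [h]
  set H' := removePending (H ++ E.map fun p => HEvent.res p.1 p.2) with hH'
  have hmatch : ∀ i, restrict H' i = restrict (seqHistory (S T)) i := by
    intro i
    rw [hH', restrict_removePending, restrict_append, hEr, restrict_seqHistory]
    cases h : r i with
    | none => simpa using hr0 i h
    | some x =>
      simp only
      rw [hr1 i x h]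
      have := removePending_seqHistory (entries (S T) i) i (by simp [entries]) [] rfl
      simpa using this
  refine ⟨E, S T, hnodup, fun p hp => ?_, hlegal T, hmatch, ?_⟩
  · have h := hr1 p.1 p.2 ((hE p).1 hp)
    have h1 := congrArg (fun L => resCount L p.1) h
    have h2 := congrArg (fun L => invCount L p.1) h
    simp only [resCount_append, invCount_append, resCount_restrict, invCount_restrict,
      (count_seqHistory _ _).1, (count_seqHistory _ _).2] at h1 h2
    rw [resCount_res] at h1
    rw [invCount_res] at h2
    omega
  · rintro i a j b ⟨H₁, H₂, H₃, x, o, heq, ha, hb⟩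
    obtain ⟨A₀, B₀, hL, hB₀, hres, hinv, -⟩ := removePending_split heq
    obtain ⟨A₁, B₁, rfl, -, -, hinv', hlater⟩ := removePending_split hB₀
    obtain ⟨y, hy⟩ := hlater j o rfl
    have hA₀ := hinv j ⟨y, by simp [hy]⟩
    have hA₁ := hinv' j ⟨y, by simp [hy]⟩
    have hb' : invCount (A₀ ++ .res i x :: A₁) j = b := by
      rw [← hb, invCount_append, invCount_append, hA₀]
      simp only [invCount, List.countP_cons] at hA₁ ⊢
      rw [hA₁]
    -- The appended completions are responses, so the invocation by `j`, and everything in front of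
    -- it, lies in `H` itself.
    have hHs : ∃ B', H = (A₀ ++ .res i x :: A₁) ++ .inv j o :: B' := by
      have hL' : H ++ (E.map fun p => HEvent.res p.1 p.2) =
          (A₀ ++ .res i x :: A₁) ++ (.inv j o :: B₁) := by
        rw [hL]; simp
      rcases List.append_eq_append_iff.1 hL' with ⟨L, -, h2⟩ | ⟨L, h1, h2⟩
      · have : HEvent.inv j o ∈ (E.map fun p => (HEvent.res p.1 p.2 : HEvent n O R)) := by
          rw [h2]; simp
        simp at this
      · cases L with
        | nil =>
          have : HEvent.inv j o ∈ (E.map fun p => (HEvent.res p.1 p.2 : HEvent n O R)) := by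
            rw [List.nil_append] at h2
            rw [← h2]; simp
          simp at this
        | cons z L =>
          simp only [List.cons_append, List.cons.injEq] at h2
          exact ⟨L, by rw [h1, h2.1]⟩
    obtain ⟨B', hB'⟩ := hHs
    -- `t` is the time of this invocation. At that time `S t` already contains operation `a` of `i`
    -- and exactly `b` operations of `j`, so operation `b` of `j` appears only in the extension of
    -- `S t` to `S T`.
    obtain ⟨t, e, ht, hht, he, hl⟩ := X.exists_of_history_eq hB'
    have hpend : (X.conf t).pend j = none := by
      have hen := (X.conf_some t e he).1
      cases e with
      | invoke k o' =>
        simp only [Implementation.Config.label, List.cons.injEq, HEvent.inv.injEq] at hl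
        obtain ⟨⟨rfl, rfl⟩, -⟩ := hl
        exact hen
      | step k =>
        simp only [Implementation.Config.label] at hl
        split at hl <;> simp at hl
    have hjt : (entries (S t) j).length = b := by
      rcases hS t j with ⟨-, h⟩ | ⟨o, h, -⟩
      · have := congrArg (fun L => invCount L j) h
        simp only [invCount_restrict, (count_seqHistory _ _).2, entries_entries] at this
        rw [← this, hht, hb']
      · rw [hpend] at h; cases h
    have hit : a < (entries (S t) i).length := by
      have h1 : a < resCount (X.history t) i := by
        rw [hht, resCount_append, ← hres, ha]
        simp [resCount]
      refine lt_of_lt_of_le h1 ?_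
      rcases hS t i with ⟨-, h⟩ | ⟨o, -, h | ⟨r, h⟩⟩
      all_goals
        have := congrArg (fun L => resCount L i) h
        simp only [resCount_append, resCount_restrict, (count_seqHistory _ _).1,
          entries_entries, resCount_inv] at this
        omega
    have hjT : b < (entries (S T) j).length := by
      have h1 := congrArg (fun L => invCount L j) (hmatch j)
      simp only [invCount_restrict, (count_seqHistory _ _).2] at h1
      rw [← h1, ← hb, hH', heq]
      rw [invCount_append, invCount_append, invCount_cons (.res i x) H₂]
      have : invCount (.res i x :: (H₂ ++ .inv j o :: H₃)) j =
        invCount H₂ j + (invCount H₃ j + 1) + invCount [(.res i x : HEvent n O R)] j := by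
        rw [invCount_cons, invCount_append, invCount_cons, invCount_inv]
      omega
    obtain ⟨S', hS'⟩ := hmono' ht.le
    rw [← hS'] at hjT ⊢
    rw [← hjt] at hjT ⊢
    exact precedes_seqHistory hit hjT

end Linearizability

/-! ### A read-write implementation of Generalized Commit-Adopt -/

namespace GCA

section Outcome

variable {C : Type u} {D : C → C → Prop} {n : ℕ}

variable (D n) in
/-- A view: the inputs that have been seen. -/
abbrev View := Fin n → Option (Trace D)

/-- The larger view extends the smaller one. -/
def Sub {α : Type u} (V V' : Fin n → Option α) : Prop := ∀ j x, V j = some x → V' j = some x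

theorem Sub.trans {α : Type u} {V V' V'' : Fin n → Option α} (h : Sub V V') (h' : Sub V' V'') :
    Sub V V'' := fun j x hx => h' j x (h j x hx)

/-- The inputs in a view. -/
def View.inputs (V : View D n) : Set (Trace D) := {s | ∃ j, V j = some s}

open Classical in
/-- The least common extension of the inputs in a view. -/
noncomputable def View.join (V : View D n) : Trace D :=
  if h : ∃ x, IsLUB V.inputs x then h.choose else 1

open Classical in
/-- The greatest common prefix of the inputs in a view. -/
noncomputable def View.meet (V : View D n) : Trace D :=
  if h : ∃ x, IsGLB V.inputs x then h.choose else 1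

/-- No process outside the views `W` can have a compatible view with a smaller join than `V`. -/
def Settled (W : Fin n → Option (View D n)) (V : View D n) : Prop :=
  ∀ r s, V r = some s → V.join ≤ s ∨ ∃ V', W r = some V' ∧ Sub V V'

open Classical in
/-- The output of process `i`, when it has seen the views `W`. -/
noncomputable def outcome (W : Fin n → Option (View D n)) (i : Fin n) : Trace D × Bool :=
  if h : (∀ j V, W j = some V → Compatible V.inputs) ∧ ∃ V, (∃ j, W j = some V) ∧ Settled W V then
    (h.2.choose.join, true)
  else if h : ∃ V, (∃ j, W j = some V) ∧ Compatible V.inputs ∧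
      ∀ j V', W j = some V' → Compatible V'.inputs → V'.join ≤ V.join then
    (h.choose.join, false)
  else (((W i).getD fun _ => none).meet, false)

theorem View.finite_inputs (V : View D n) : V.inputs.Finite := by
  have : V.inputs ⊆ (fun o : Option (Trace D) => o.getD 1) '' Set.range V := by
    rintro s ⟨j, hj⟩
    exact ⟨some s, ⟨j, hj⟩, rfl⟩
  exact ((Set.finite_range V).image _).subset this

theorem View.isLUB_join {V : View D n} (h : Compatible V.inputs) : IsLUB V.inputs V.join := by
  have hx : ∃ x, IsLUB V.inputs x := (Trace.exists_isLUB _ V.finite_inputs h).imp fun _ h => h.1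
  rw [View.join, dif_pos hx]
  exact hx.choose_spec

theorem View.isGLB_meet {V : View D n} (h : V.inputs.Nonempty) : IsGLB V.inputs V.meet := by
  have hx : ∃ x, IsGLB V.inputs x := Trace.exists_isGLB _ h
  rw [View.meet, dif_pos hx]
  exact hx.choose_spec

theorem Sub.inputs {V V' : View D n} (h : Sub V V') : V.inputs ⊆ V'.inputs :=
  fun _ ⟨j, hj⟩ => ⟨j, h j _ hj⟩

theorem Sub.compatible {V V' : View D n} (h : Sub V V') (hc : Compatible V'.inputs) :
    Compatible V.inputs := hc.imp fun _ hz x hx => hz x (h.inputs hx)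

theorem Sub.join_le {V V' : View D n} (h : Sub V V') (hc : Compatible V'.inputs) :
    V.join ≤ V'.join :=
  (View.isLUB_join (h.compatible hc)).2 fun _ hx => (View.isLUB_join hc).1 (h.inputs hx)

theorem exists_max_of_chain {S : Set (Trace D)} (hS : S.Finite) (hne : S.Nonempty)
    (hc : ∀ x ∈ S, ∀ y ∈ S, x ≤ y ∨ y ≤ x) : ∃ m ∈ S, ∀ x ∈ S, x ≤ m := by
  obtain ⟨m, hm⟩ := hS.exists_maximal hne
  refine ⟨m, hm.1, fun x hx => ?_⟩
  rcases hc x hx m hm.1 with h | h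
  · exact h
  · exact hm.2 hx h

/-- What is known about an execution of the algorithm: `inp t` and `vw t` are the inputs and the
views that have been written by time `t`, each view is a snapshot of the inputs, and each output is
computed from a snapshot of the views. -/
structure Facts (inp : ℕ → View D n) (vw : ℕ → Fin n → Option (View D n))
    (Inv : Fin n → Trace D → Prop) (Ret : Fin n → Trace D × Bool → Prop) : Prop where
  inp_mono : ∀ t t', t ≤ t' → Sub (inp t) (inp t')
  vw_mono : ∀ t t', t ≤ t' → Sub (vw t) (vw t')
  inp_inv : ∀ t j s, inp t j = some s → Inv j s
  vw_snap : ∀ t j V, vw t j = some V → V j ≠ none ∧ ∃ t', V = inp t'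
  ret_snap : ∀ i r, Ret i r → ∃ t, vw t i ≠ none ∧ r = outcome (vw t) i

namespace Facts

variable {inp : ℕ → View D n} {vw : ℕ → Fin n → Option (View D n)}
  {Inv : Fin n → Trace D → Prop} {Ret : Fin n → Trace D × Bool → Prop}
  (F : Facts inp vw Inv Ret)

include F

/-- Views are contents of the same growing array at two times. All comparisons of outputs rest on
this linear order. -/
theorem chain {t t' : ℕ} {j j' : Fin n} {V V' : View D n} (h : vw t j = some V)
    (h' : vw t' j' = some V') : Sub V V' ∨ Sub V' V := by
  obtain ⟨-, a, rfl⟩ := F.vw_snap _ _ _ h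
  obtain ⟨-, b, rfl⟩ := F.vw_snap _ _ _ h'
  exact (le_total a b).imp (F.inp_mono _ _) (F.inp_mono _ _)

theorem vw_unique {t t' : ℕ} {j : Fin n} {V V' : View D n} (h : vw t j = some V)
    (h' : vw t' j = some V') : V = V' := by
  rcases le_total t t' with hle | hle
  · exact Option.some.inj ((F.vw_mono _ _ hle _ _ h).symm.trans h')
  · exact Option.some.inj (h.symm.trans (F.vw_mono _ _ hle _ _ h'))

theorem inv_of_view {t : ℕ} {j k : Fin n} {V : View D n} {s : Trace D} (h : vw t j = some V)
    (hs : V k = some s) : Inv k s := by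
  obtain ⟨-, a, rfl⟩ := F.vw_snap _ _ _ h
  exact F.inp_inv _ _ _ hs

theorem exists_self {t : ℕ} {j : Fin n} {V : View D n} (h : vw t j = some V) :
    ∃ s, V j = some s := Option.ne_none_iff_exists'.1 (F.vw_snap _ _ _ h).1

/-- Most properties do not depend on which branch produced a join. The meet is output only if no
visible view is compatible: otherwise the joins of the compatible ones form a nonempty finite chain,
and its maximum would satisfy the second condition of `outcome`. -/
theorem ret_cases {i : Fin n} {x : Trace D} {c : Bool} (h : Ret i (x, c)) :
    ∃ t, (∃ j V, vw t j = some V ∧ Compatible V.inputs ∧ x = V.join) ∨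
      (c = false ∧ (∀ j V, vw t j = some V → ¬ Compatible V.inputs) ∧
        ∃ V, vw t i = some V ∧ x = V.meet) := by
  obtain ⟨t, hi, he⟩ := F.ret_snap _ _ h
  refine ⟨t, ?_⟩
  rw [outcome] at he
  split_ifs at he with h1 h2
  · obtain ⟨⟨j, hj⟩, hs⟩ := h1.2.choose_spec
    exact .inl ⟨j, _, hj, h1.1 _ _ hj, (Prod.mk.inj he).1⟩
  · obtain ⟨⟨j, hj⟩, hc, -⟩ := h2.choose_spec
    exact .inl ⟨j, _, hj, hc, (Prod.mk.inj he).1⟩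
  · obtain ⟨V, hV⟩ := Option.ne_none_iff_exists'.1 hi
    refine .inr ⟨(Prod.mk.inj he).2, fun j V hV hc => h2 ?_, V, hV, ?_⟩
    · obtain ⟨_, ⟨V, j, hV, hc, rfl⟩, hm⟩ := exists_max_of_chain
        (S := {x | ∃ V j, vw t j = some V ∧ Compatible V.inputs ∧ x = V.join}) (by
          refine ((Set.finite_range (vw t)).image fun o =>
            (o.getD fun _ => none).join).subset ?_
          rintro _ ⟨V, j, hV, -, rfl⟩
          exact ⟨some V, ⟨j, hV⟩, rfl⟩)
        ⟨_, V, j, hV, hc, rfl⟩ (by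
          rintro _ ⟨V, j, hV, hc, rfl⟩ _ ⟨V', j', hV', hc', rfl⟩
          exact (F.chain hV hV').imp (fun h => h.join_le hc') (fun h => h.join_le hc))
      exact ⟨V, ⟨j, hV⟩, hc, fun j' V' hV' hc' => hm _ ⟨V', j', hV', hc', rfl⟩⟩
    · rw [hV] at he
      exact (Prod.mk.inj he).1

theorem ret_commit {i : Fin n} {x : Trace D} (h : Ret i (x, true)) :
    ∃ t j V, vw t j = some V ∧ x = V.join ∧ (∀ j V, vw t j = some V → Compatible V.inputs) ∧
      Settled (vw t) V := by
  obtain ⟨t, hi, he⟩ := F.ret_snap _ _ h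
  rw [outcome] at he
  split_ifs at he with h1 h2
  · obtain ⟨⟨j, hj⟩, hs⟩ := h1.2.choose_spec
    exact ⟨t, j, _, hj, (Prod.mk.inj he).1, h1.1, hs⟩
  · simp at he
  · simp at he

theorem validity {i : Fin n} {x : Trace D} {c : Bool} (h : Ret i (x, c)) [DecidableEq C] :
    ∀ o ∈ x.ops, ∃ j s, Inv j s ∧ x.ops.count o ≤ s.ops.count o := by
  intro o ho
  obtain ⟨t, ⟨j, V, hV, hc, rfl⟩ | ⟨-, -, V, hV, rfl⟩⟩ := F.ret_cases h
  · obtain ⟨y, hy, hyc⟩ := Trace.exists_isLUB _ V.finite_inputs hc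
    obtain rfl : V.join = y := (View.isLUB_join hc).unique hy
    obtain ⟨s, ⟨k, hk⟩, hs⟩ := hyc o ho
    exact ⟨k, s, F.inv_of_view hV hk, by convert hs⟩
  · obtain ⟨s, hs⟩ := F.exists_self hV
    exact ⟨i, s, F.inv_of_view hV hs,
      Multiset.count_le_of_le _ (Trace.ops_le ((View.isGLB_meet ⟨s, i, hs⟩).1 ⟨i, hs⟩))⟩

/-- Let the committed trace be the join of `V` and the other output the join of the view `W` of
process `r`. If `V ⊆ W`, joins are monotone. If `W ⊆ V`, the input of `r` occurs in `V`, and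
settledness says that the join of `V` is below this input, or that `r` had published a view
containing `V`, which must be `W`. The other output cannot be a meet: the later of the two snapshots
of views contains the views seen by the earlier one, and one of these would be both compatible and
incompatible. -/
theorem adoption {i : Fin n} {x : Trace D} (h : Ret i (x, true)) {j : Fin n} {y : Trace D}
    {c : Bool} (h' : Ret j (y, c)) : x ≤ y := by
  obtain ⟨t, k, V, hV, rfl, hgood, hset⟩ := F.ret_commit h
  obtain ⟨t', ⟨r, W, hW, hc, rfl⟩ | ⟨-, hbad, V', hV', rfl⟩⟩ := F.ret_cases h'
  · rcases F.chain hV hW with hs | hs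
    · exact hs.join_le hc
    · obtain ⟨s, hs'⟩ := F.exists_self hW
      rcases hset r s (hs r s hs') with hle | ⟨V', hV', hsub⟩
      · exact hle.trans ((View.isLUB_join hc).1 ⟨r, hs'⟩)
      · exact Sub.join_le (F.vw_unique hV' hW ▸ hsub) hc
  · exfalso
    rcases le_total t t' with hle | hle
    · exact hbad _ _ (F.vw_mono _ _ hle _ _ hV) (hgood _ _ hV)
    · exact hbad _ _ hV' (hgood _ _ (F.vw_mono _ _ hle _ _ hV'))

/-- Assign to a published view its join if it is compatible and its meet otherwise. Every output has
this form. Along the chain of views the joins increase and the meets decrease, and a meet lies below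
the join of a smaller compatible view because the two views share an input. So the values form a
finite chain, whose maximum bounds all outputs. -/
theorem convergence : Compatible {x | ∃ i c, Ret i (x, c)} := by
  classical
  let f : View D n → Trace D := fun V => if Compatible V.inputs then V.join else V.meet
  let S : Set (Trace D) := {x | ∃ t j V, vw t j = some V ∧ x = f V}
  have hsub : {x | ∃ i c, Ret i (x, c)} ⊆ S := by
    rintro x ⟨i, c, h⟩
    obtain ⟨t, ⟨j, V, hV, hc, rfl⟩ | ⟨-, hbad, V, hV, rfl⟩⟩ := F.ret_cases h
    · exact ⟨t, j, V, hV, by simp [f, hc]⟩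
    · exact ⟨t, i, V, hV, by simp [f, hbad _ _ hV]⟩
  rcases S.eq_empty_or_nonempty with h0 | hne
  · exact ⟨1, fun x hx => absurd (hsub hx) (by simp [h0])⟩
  have hfin : S.Finite := by
    have : S ⊆ ⋃ j : Fin n, {x | ∃ t V, vw t j = some V ∧ x = f V} := by
      rintro x ⟨t, j, V, h⟩
      exact Set.mem_iUnion.2 ⟨j, t, V, h⟩
    refine (Set.finite_iUnion fun j => Set.Subsingleton.finite ?_).subset this
    rintro _ ⟨t, V, hV, rfl⟩ _ ⟨t', V', hV', rfl⟩
    rw [F.vw_unique hV hV']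
  have hchain : ∀ {t j V t' j' V'}, vw t j = some V → vw t' j' = some V' → Sub V V' →
      f V ≤ f V' ∨ f V' ≤ f V := by
    intro t j V t' j' V' hV hV' hs
    obtain ⟨s, hj⟩ := F.exists_self hV
    obtain ⟨s', hj'⟩ := F.exists_self hV'
    by_cases hc' : Compatible V'.inputs
    · left
      simp only [f, hc', hs.compatible hc', if_true]
      exact hs.join_le hc'
    · right
      by_cases hc : Compatible V.inputs
      · simp only [f, hc', hc, if_true, if_false]
        exact ((View.isGLB_meet ⟨_, _, hj'⟩).1 ⟨j, hs _ _ hj⟩).trans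
          ((View.isLUB_join hc).1 ⟨j, hj⟩)
      · simp only [f, hc', hc, if_false]
        exact (View.isGLB_meet ⟨_, _, hj⟩).2 fun x hx =>
          (View.isGLB_meet ⟨_, _, hj'⟩).1 (hs.inputs hx)
  obtain ⟨m, -, hm⟩ := exists_max_of_chain hfin hne (by
    rintro _ ⟨t, j, V, hV, rfl⟩ _ ⟨t', j', V', hV', rfl⟩
    rcases F.chain hV hV' with hs | hs
    · exact hchain hV hV' hs
    · exact (hchain hV' hV hs).symm)
  exact ⟨m, fun x hx => hm x (hsub hx)⟩

theorem common_prefix {e : Trace D} (he : ∀ j s, Inv j s → e ≤ s) {i : Fin n} {x : Trace D}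
    {c : Bool} (h : Ret i (x, c)) : e ≤ x := by
  obtain ⟨t, ⟨j, V, hV, hc, rfl⟩ | ⟨-, -, V, hV, rfl⟩⟩ := F.ret_cases h
  · obtain ⟨s, hs⟩ := F.exists_self hV
    exact (he _ _ (F.inv_of_view hV hs)).trans ((View.isLUB_join hc).1 ⟨j, hs⟩)
  · obtain ⟨s, hs⟩ := F.exists_self hV
    refine (View.isGLB_meet ⟨s, i, hs⟩).2 ?_
    rintro y ⟨k, hk⟩
    exact he _ _ (F.inv_of_view hV hk)

/-- With equal inputs the join of any view is below every input, so the process's own view is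
settled by the first alternative, whatever the other processes have published. -/
theorem weak_agreement (hI : ∀ i j s s', Inv i s → Inv j s' → s = s') {i : Fin n} {x : Trace D}
    {c : Bool} (h : Ret i (x, c)) : c = true := by
  obtain ⟨t, hi, he⟩ := F.ret_snap _ _ h
  obtain ⟨V, hV⟩ := Option.ne_none_iff_exists'.1 hi
  have hcomp : ∀ j V, vw t j = some V → Compatible V.inputs := by
    intro j V hV
    obtain ⟨s, hs⟩ := F.exists_self hV
    refine ⟨s, ?_⟩
    rintro y ⟨k, hk⟩
    exact (hI _ _ _ _ (F.inv_of_view hV hk) (F.inv_of_view hV hs)).le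
  have hset : Settled (vw t) V := by
    refine fun r s hs => .inl ((View.isLUB_join (hcomp _ _ hV)).2 ?_)
    rintro y ⟨k, hk⟩
    exact (hI _ _ _ _ (F.inv_of_view hV hk) (F.inv_of_view hV hs)).le
  rw [outcome, dif_pos ⟨hcomp, V, ⟨i, hV⟩, hset⟩] at he
  exact (Prod.mk.inj he).2

/-- A published view `V₀` with fewest inputs is contained in all published views. Among the
processes whose inputs it contains, let `q` be the one with the latest snapshot of views, at time `τ
q`. By then each of these processes has published a view, and this view contains `V₀`, so `V₀` is
settled for `q`. -/
theorem commitment (hne : ∃ i s, Inv i s) (hc : Compatible {s | ∃ i, Inv i s})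
    (hret : ∀ i s, Inv i s → ∃ r, Ret i r) :
    ∃ j s x, Inv j s ∧ Ret j (x, true) ∧ s ≤ x := by
  classical
  have hcomp : ∀ t j V, vw t j = some V → Compatible V.inputs := by
    intro t j V hV
    obtain ⟨z, hz⟩ := hc
    refine ⟨z, ?_⟩
    rintro s ⟨k, hk⟩
    exact hz s ⟨k, F.inv_of_view hV hk⟩
  have hret' : ∀ i s, Inv i s → ∃ t, vw t i ≠ none ∧ Ret i (outcome (vw t) i) := by
    intro i s hi
    obtain ⟨r, hr⟩ := hret i s hi
    obtain ⟨t, ht, rfl⟩ := F.ret_snap _ _ hr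
    exact ⟨t, ht, hr⟩
  let d : View D n → ℕ := fun V => (Finset.univ.filter fun j => V j ≠ none).card
  obtain ⟨V₀, ⟨t₀, p, hV₀⟩, hmin⟩ : ∃ V₀, (∃ t j, vw t j = some V₀) ∧
      ∀ t j V, vw t j = some V → d V₀ ≤ d V := by
    have hex : ∃ m V, (∃ t j, vw t j = some V) ∧ d V = m := by
      obtain ⟨i, s, hi⟩ := hne
      obtain ⟨t, ht, -⟩ := hret' i s hi
      obtain ⟨V, hV⟩ := Option.ne_none_iff_exists'.1 ht
      exact ⟨_, V, ⟨t, i, hV⟩, rfl⟩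
    obtain ⟨V₀, h₀, hd⟩ := Nat.find_spec hex
    exact ⟨V₀, h₀, fun t j V hV => hd ▸ Nat.find_min' hex ⟨V, ⟨t, j, hV⟩, rfl⟩⟩
  have hsub : ∀ t j V, vw t j = some V → Sub V₀ V := by
    intro t j V hV
    rcases F.chain hV₀ hV with h | h
    · exact h
    · have heq : (Finset.univ.filter fun j => V j ≠ none) =
          Finset.univ.filter fun j => V₀ j ≠ none := by
        refine Finset.eq_of_subset_of_card_le (fun k hk => ?_) (hmin _ _ _ hV)
        simp only [Finset.mem_filter, Finset.mem_univ, true_and] at hk ⊢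
        obtain ⟨s, hs⟩ := Option.ne_none_iff_exists'.1 hk
        rw [h k s hs]
        simp
      intro k s hs
      have hk : k ∈ Finset.univ.filter fun j => V j ≠ none := by
        rw [heq]
        simp [hs]
      obtain ⟨s', hs'⟩ := Option.ne_none_iff_exists'.1 (Finset.mem_filter.1 hk).2
      rw [hs', ← h k s' hs', hs]
  have hτ : ∀ r, ∃ t, V₀ r ≠ none → vw t r ≠ none ∧ Ret r (outcome (vw t) r) := by
    intro r
    by_cases hr : V₀ r = none
    · exact ⟨0, fun h => absurd hr h⟩
    · obtain ⟨s, hs⟩ := Option.ne_none_iff_exists'.1 hr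
      obtain ⟨t, ht⟩ := hret' r s (F.inv_of_view hV₀ hs)
      exact ⟨t, fun _ => ht⟩
  choose τ hτ using hτ
  obtain ⟨q, hq, hmax⟩ := (Finset.univ.filter fun j => V₀ j ≠ none).exists_max_image τ
    ⟨p, by simpa using (F.vw_snap _ _ _ hV₀).1⟩
  simp only [Finset.mem_filter, Finset.mem_univ, true_and] at hq hmax
  have hall : ∀ r, V₀ r ≠ none → ∃ V, vw (τ q) r = some V := by
    intro r hr
    obtain ⟨V, hV⟩ := Option.ne_none_iff_exists'.1 (hτ r hr).1
    exact ⟨V, F.vw_mono _ _ (hmax r hr) _ _ hV⟩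
  obtain ⟨V₁, hV₁⟩ := hall p (F.vw_snap _ _ _ hV₀).1
  obtain rfl := F.vw_unique hV₀ hV₁
  have hcond : (∀ j V, vw (τ q) j = some V → Compatible V.inputs) ∧
      ∃ V, (∃ j, vw (τ q) j = some V) ∧ Settled (vw (τ q)) V := by
    refine ⟨hcomp _, V₀, ⟨p, hV₁⟩, fun r s hr => .inr ?_⟩
    obtain ⟨V, hV⟩ := hall r (by simp [hr])
    exact ⟨V, hV, hsub _ _ _ hV⟩
  obtain ⟨s, hs⟩ := Option.ne_none_iff_exists'.1 hq
  have hr := (hτ q hq).2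
  rw [outcome, dif_pos hcond] at hr
  -- The committed join may belong to another settled view than `V₀`, but every published view
  -- contains `V₀` and with it the input of `q`.
  obtain ⟨⟨j, hj⟩, -⟩ := hcond.2.choose_spec
  exact ⟨q, s, _, F.inv_of_view hV₀ hs, hr,
    (View.isLUB_join (hcomp _ _ _ hj)).1 ⟨q, hsub _ _ _ hj _ _ hs⟩⟩

end Facts

end Outcome

/-! #### The algorithm -/

section Algorithm

variable {C : Type u} (D : C → C → Prop) (n : ℕ)

/-- Two arrays of registers, one for the inputs (`false`) and one for the views (`true`). -/
inductive Reg : Type u where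
  | cell (b : Bool) (i : Fin n)

/-- The values in the two arrays. -/
def Cell : Bool → Type u
  | false => Trace D
  | true => View D n

/-- The contents of the registers. -/
def Val : Reg.{u} n → Type u
  | .cell b _ => Option (Cell D n b)

/-- Where a process is: about to write its cell of an array, or reading the array until a pass over
it finds nothing that was not known before. -/
inductive Phase : Type u where
  | idle
  | write (b : Bool) (x : Cell D n b)
  | scan (b : Bool) (K : Fin n → Option (Cell D n b)) (changed : Bool) (todo : List (Fin n))

variable {D n}

/-- What follows after `v` is read in cell `j`. -/
def afterRead (b : Bool) (K : Fin n → Option (Cell D n b)) (changed : Bool) (j : Fin n)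
    (todo : List (Fin n)) (v : Option (Cell D n b)) : Phase D n :=
  match K j, v with
  | none, some x => .scan b (Function.update K j (some x)) true todo
  | _, _ => .scan b K changed todo

/-- One step of process `i`. -/
noncomputable def next (i : Fin n) :
    Phase D n → StepAction (Reg.{u} n) (Val D n) (Phase D n) (Trace D × Bool)
  | .idle => .skip .idle
  | .write b x => .write (.cell b i) (some x) (.scan b (fun _ => none) true [])
  | .scan b K ch (j :: js) => .read (.cell b j) (afterRead b K ch j js)
  | .scan b K true [] => .skip (.scan b K false (List.finRange n))
  | .scan false K false [] => .skip (.write true K)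
  | .scan true K false [] => .ret (outcome K i) .idle

variable (D n) in
/-- Generalized Commit-Adopt from registers: publish the input, take a snapshot of the inputs,
publish it, take a snapshot of the published views, and compute the output. -/
noncomputable def algorithm : Implementation.{u} n (Trace D) (Trace D × Bool) where
  Reg := Reg n
  Val := Val D n
  Loc := Phase D n
  mem0 := fun | .cell _ _ => none
  loc0 _ := .idle
  invoke _ s _ := .write false s
  next := next

variable (X : (algorithm D n).Execution)

/-- The contents of cell `j` of an array at time `t`. -/
def cell (t : ℕ) (b : Bool) (j : Fin n) : Option (Cell D n b) := (X.conf t).mem (.cell b j)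

/-- The phase of process `i` at time `t`. -/
def phase (t : ℕ) (i : Fin n) : Phase D n := (X.conf t).loc i

variable {X} {t : ℕ} {i : Fin n}

theorem phase_zero : phase X 0 i = .idle := by
  rw [phase, X.conf_zero]; rfl

theorem cell_zero (b : Bool) : cell X 0 b i = none := by
  rw [cell, X.conf_zero]; rfl

theorem phase_other (h : ∀ e, X.ev t = some e → e.proc ≠ i) : phase X (t + 1) i = phase X t i :=
  (X.conf_other h).1

theorem phase_invoke {s : Trace D} (h : X.ev t = some (.invoke i s)) :
    phase X (t + 1) i = .write false s := by
  rw [phase, (X.conf_some t _ h).2]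
  simp [Implementation.Config.after, algorithm]

open Classical in
theorem step_write {b : Bool} {x : Cell D n b} (h : X.ev t = some (.step i))
    (hp : phase X t i = .write b x) :
    phase X (t + 1) i = .scan b (fun _ => none) true [] ∧ cell X (t + 1) b i = some x ∧
      ∀ b' j, (b', j) ≠ (b, i) → cell X (t + 1) b' j = cell X t b' j := by
  have hn : (algorithm D n).next i ((X.conf t).loc i) =
      .write (.cell b i) (some x) (.scan b (fun _ => none) true []) := by
    rw [phase] at hp
    rw [hp]
    rfl
  simp only [phase, cell]
  rw [(X.conf_some t _ h).2]
  simp only [Implementation.Config.after, hn]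
  refine ⟨Function.update_self .., Function.update_self .., fun b' j hne => ?_⟩
  refine Function.update_of_ne (fun e => hne ?_) _ _
  cases e
  rfl

theorem step_of_skip {l : Phase D n} (h : X.ev t = some (.step i))
    (hn : next i (phase X t i) = .skip l) :
    phase X (t + 1) i = l ∧ ∀ b j, cell X (t + 1) b j = cell X t b j := by
  have hn' : (algorithm D n).next i ((X.conf t).loc i) = .skip l := hn
  simp only [phase, cell]
  rw [(X.conf_some t _ h).2]
  simp only [Implementation.Config.after, hn']
  exact ⟨Function.update_self .., fun _ _ => rfl⟩

theorem step_read {b : Bool} {K : Fin n → Option (Cell D n b)} {ch : Bool} {j : Fin n}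
    {js : List (Fin n)} (h : X.ev t = some (.step i))
    (hp : phase X t i = .scan b K ch (j :: js)) :
    phase X (t + 1) i = afterRead b K ch j js (cell X t b j) ∧
      ∀ b j, cell X (t + 1) b j = cell X t b j := by
  have hn : (algorithm D n).next i ((X.conf t).loc i) = .read (.cell b j) (afterRead b K ch j js) := by
    rw [phase] at hp
    rw [hp]
    rfl
  simp only [phase, cell]
  rw [(X.conf_some t _ h).2]
  simp only [Implementation.Config.after, hn]
  exact ⟨Function.update_self .., fun _ _ => rfl⟩

theorem step_ret {K : Fin n → Option (Cell D n true)} (h : X.ev t = some (.step i))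
    (hp : phase X t i = .scan true K false []) :
    phase X (t + 1) i = .idle ∧ ∀ b j, cell X (t + 1) b j = cell X t b j := by
  have hn : (algorithm D n).next i ((X.conf t).loc i) = .ret (outcome K i) .idle := by
    rw [phase] at hp
    rw [hp]
    rfl
  simp only [phase, cell]
  rw [(X.conf_some t _ h).2]
  simp only [Implementation.Config.after, hn]
  exact ⟨Function.update_self .., fun _ _ => rfl⟩

/-- How the phase of a process changes and the cells change in a step. -/
inductive Move (i : Fin n) (c c' : (b : Bool) → Fin n → Option (Cell D n b)) :
    Phase D n → Phase D n → Prop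
  | idle : c' = c → Move i c c' .idle .idle
  | write (b : Bool) (x : Cell D n b) : c' b i = some x →
      (∀ b' j, (b', j) ≠ (b, i) → c' b' j = c b' j) →
      Move i c c' (.write b x) (.scan b (fun _ => none) true [])
  | new (b : Bool) (K : Fin n → Option (Cell D n b)) (ch : Bool) (j : Fin n) (js : List (Fin n))
      (x : Cell D n b) : K j = none → c b j = some x → c' = c →
      Move i c c' (.scan b K ch (j :: js)) (.scan b (Function.update K j (some x)) true js)
  | known (b : Bool) (K : Fin n → Option (Cell D n b)) (ch : Bool) (j : Fin n) (js : List (Fin n)) :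
      (K j = none → c b j = none) → c' = c →
      Move i c c' (.scan b K ch (j :: js)) (.scan b K ch js)
  | restart (b : Bool) (K : Fin n → Option (Cell D n b)) : c' = c →
      Move i c c' (.scan b K true []) (.scan b K false (List.finRange n))
  | view (K : View D n) : c' = c → Move i c c' (.scan false K false []) (.write true K)
  | ret (K : Fin n → Option (View D n)) : c' = c → Move i c c' (.scan true K false []) .idle

theorem move_of_step (h : X.ev t = some (.step i)) :
    Move i (cell X t) (cell X (t + 1)) (phase X t i) (phase X (t + 1) i) := by
  have aux : (∀ b j, cell X (t + 1) b j = cell X t b j) → cell X (t + 1) = cell X t :=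
    fun h => funext fun b => funext fun j => h b j
  cases hp : phase X t i with
  | idle =>
    obtain ⟨h1, h2⟩ := step_of_skip (l := .idle) h (by rw [hp]; rfl)
    rw [h1]
    exact .idle (aux h2)
  | write b x =>
    obtain ⟨h1, h2, h3⟩ := step_write h hp
    rw [h1]
    exact .write b x h2 h3
  | scan b K ch todo =>
    match b, K, ch, todo, hp with
    | b, K, ch, j :: js, hp =>
      obtain ⟨h1, h2⟩ := step_read h hp
      rw [h1]
      cases hK : K j with
      | some y =>
        have : afterRead b K ch j js (cell X t b j) = .scan b K ch js := by
          simp [afterRead, hK]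
        rw [this]
        exact .known b K ch j js (by simp [hK]) (aux h2)
      | none =>
        cases hc : cell X t b j with
        | none =>
          have : afterRead b K ch j js none = .scan b K ch js := by
            simp [afterRead, hK]
          rw [this]
          exact .known b K ch j js (fun _ => hc) (aux h2)
        | some x =>
          have : afterRead b K ch j js (some x) =
              .scan b (Function.update K j (some x)) true js := by
            simp [afterRead, hK]
          rw [this]
          exact .new b K ch j js x hK hc (aux h2)
    | b, K, true, [], hp =>
      obtain ⟨h1, h2⟩ := step_of_skip (l := .scan b K false (List.finRange n)) h (by
        rw [hp]; cases b <;> rfl)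
      rw [h1]
      exact .restart b K (aux h2)
    | false, K, false, [], hp =>
      obtain ⟨h1, h2⟩ := step_of_skip (l := .write true K) h (by rw [hp]; rfl)
      rw [h1]
      exact .view K (aux h2)
    | true, K, false, [], hp =>
      obtain ⟨h1, h2⟩ := step_ret h hp
      rw [h1]
      exact .ret K (aux h2)

theorem cell_not_step (h : ∀ i, X.ev t ≠ some (.step i)) : cell X (t + 1) = cell X t := by
  funext b j
  cases he : X.ev t with
  | none => rw [cell, X.conf_none t he]; rfl
  | some e =>
    cases e with
    | invoke k s => rw [cell, (X.conf_some t _ he).2]; rfl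
    | step k => exact absurd he (h k)

theorem cell_other (h : X.ev t ≠ some (.step i)) (b : Bool) :
    cell X (t + 1) b i = cell X t b i := by
  by_cases hk : ∃ k, X.ev t = some (.step k)
  · obtain ⟨k, hk⟩ := hk
    have hne : k ≠ i := by rintro rfl; exact h hk
    have := move_of_step hk
    generalize phase X (t + 1) k = q at this
    generalize phase X t k = p at this
    cases this with
    | write b' x h1 h2 => exact h2 _ _ (by simp [Ne.symm hne])
    | _ => simp_all
  · rw [cell_not_step (by simpa using hk)]

/-- The process has not invoked `propose` before time `t`. -/
def Fresh (X : (algorithm D n).Execution) (t : ℕ) (i : Fin n) : Prop :=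
  ∀ t' < t, ∀ s, X.ev t' ≠ some (.invoke i s)

/-- Cells of an array which the process is yet to write are empty. -/
def Unwritten (p : Phase D n) (c : (b : Bool) → Option (Cell D n b)) : Prop :=
  match p with
  | .write false _ => c false = none ∧ c true = none
  | .write true _ => c true = none
  | .scan false _ _ _ => c true = none
  | _ => True

/-- In a one-shot execution a process writes each of its two cells at most once. The part about
`Fresh` is needed at an invocation, where both cells must still be empty. -/
theorem unwritten (hX : X.OneShot) (t : ℕ) (i : Fin n) :
    (Fresh X t i → phase X t i = .idle ∧ ∀ b, cell X t b i = none) ∧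
      Unwritten (phase X t i) (fun b => cell X t b i) := by
  induction t with
  | zero => exact ⟨fun _ => ⟨phase_zero, cell_zero⟩, by rw [phase_zero]; trivial⟩
  | succ t ih =>
    have hf : Fresh X (t + 1) i → Fresh X t i := fun h t' ht' => h t' (ht'.trans t.lt_succ_self)
    by_cases hs : X.ev t = some (.step i)
    · have hm := move_of_step hs
      refine ⟨fun h => ?_, ?_⟩
      · obtain ⟨h1, h2⟩ := ih.1 (hf h)
        rw [h1] at hm
        generalize hq : phase X (t + 1) i = q at hm ⊢
        cases hm with
        | idle hc => exact ⟨rfl, fun b => by rw [hc]; exact h2 b⟩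
      · have ih' := ih.2
        generalize phase X (t + 1) i = q at hm ⊢
        generalize phase X t i = p at hm ih'
        cases hm with
        | idle => trivial
        | write b x h1 h2 =>
          cases b with
          | false =>
            change cell X (t + 1) true i = none
            rw [h2 _ _ (by simp)]
            exact ih'.2
          | true => trivial
        | new b K ch j js x h1 h2 h3 => rw [h3]; cases b <;> exact ih'
        | known b K ch j js h1 h3 => rw [h3]; cases b <;> exact ih'
        | restart b K h3 => rw [h3]; cases b <;> exact ih'
        | view K h3 => rw [h3]; exact ih'
        | ret K h3 => trivial
    · have hc : ∀ b, cell X (t + 1) b i = cell X t b i := cell_other hs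
      by_cases hi : ∃ s, X.ev t = some (.invoke i s)
      · obtain ⟨s, hi⟩ := hi
        refine ⟨fun h => absurd hi (h t t.lt_succ_self s), ?_⟩
        have hfr : Fresh X t i := fun t' ht' s' hs' => ht'.ne (hX _ _ _ _ _ hs' hi)
        rw [phase_invoke hi]
        exact ⟨(hc _).trans ((ih.1 hfr).2 _), (hc _).trans ((ih.1 hfr).2 _)⟩
      · have hp : phase X (t + 1) i = phase X t i := phase_other (by
          rintro (⟨k, s⟩ | k) he rfl
          · exact hi ⟨s, he⟩
          · exact hs he)
        rw [hp]
        simp only [hc]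
        exact ⟨fun h => ih.1 (hf h), ih.2⟩

/-- Cells are written only while empty. This lets two agreeing passes over an array stand for a
snapshot. -/
theorem cell_mono (hX : X.OneShot) {t t' : ℕ} (h : t ≤ t') (b : Bool) :
    Sub (cell X t b) (cell X t' b) := by
  induction h with
  | refl => exact fun _ _ h => h
  | @step t' _ ih =>
    refine ih.trans fun j x hx => ?_
    by_cases hs : X.ev t' = some (.step j)
    · have hm := move_of_step hs
      have hu := (unwritten hX t' j).2
      generalize phase X (t' + 1) j = q at hm
      generalize phase X t' j = p at hm hu
      cases hm with
      | write b' y h1 h2 =>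
        by_cases hb : b = b'
        · subst hb
          cases b with
          | false => rw [show cell X t' false j = none from hu.1] at hx; cases hx
          | true => rw [show cell X t' true j = none from hu] at hx; cases hx
        · rw [h2 _ _ (by simp [hb]), hx]
      | _ => simp_all
    · rw [cell_other hs, hx]

/-- The known values `K` are those in the array at some time since the process wrote to it. -/
def Snapshot (X : (algorithm D n).Execution) (t : ℕ) (i : Fin n) (b : Bool)
    (K : Fin n → Option (Cell D n b)) : Prop :=
  ∃ t' ≤ t, cell X t' b i ≠ none ∧ K = cell X t' b

/-- What holds at time `t` when process `i` is in a phase. -/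
def Scanning (X : (algorithm D n).Execution) (t : ℕ) (i : Fin n) : Phase D n → Prop
  | .idle => True
  | .write false s => ∃ t', X.ev t' = some (.invoke i s)
  | .write true V => Snapshot X t i false V
  | .scan b K ch todo => cell X t b i ≠ none ∧ Sub K (cell X t b) ∧
      (ch = false → ∃ t' ≤ t, cell X t' b i ≠ none ∧ Sub K (cell X t' b) ∧
        ∀ j, j ∉ todo → cell X t' b j = K j)

theorem Scanning.mono (hX : X.OneShot) {t t' : ℕ} (ht : t ≤ t') {p : Phase D n}
    (h : Scanning X t i p) : Scanning X t' i p := by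
  cases p with
  | idle => trivial
  | write b x =>
    cases b with
    | false => exact h
    | true =>
      obtain ⟨a, ha, hh⟩ := h
      exact ⟨a, ha.trans ht, hh⟩
  | scan b K ch todo =>
    obtain ⟨h0, h1, h2⟩ := h
    refine ⟨?_, h1.trans (cell_mono hX ht b), fun hch => ?_⟩
    · obtain ⟨x, hx⟩ := Option.ne_none_iff_exists'.1 h0
      rw [cell_mono hX ht b _ _ hx]
      simp
    · obtain ⟨a, ha, hh⟩ := h2 hch
      exact ⟨a, ha.trans ht, hh⟩

theorem Scanning.snapshot {b : Bool} {K : Fin n → Option (Cell D n b)}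
    (h : Scanning X t i (.scan b K false [])) : Snapshot X t i b K := by
  obtain ⟨-, -, h2⟩ := h
  obtain ⟨a, ha, h3, -, h4⟩ := h2 rfl
  exact ⟨a, ha, h3, funext fun j => (h4 j (by simp)).symm⟩

/-- As long as a pass finds nothing new, the known values agree with the array at the start of the
pass in every cell already passed. A finished clean pass therefore has read the array as it was at
that one moment, and this moment is after the process's own write. -/
theorem scanning (hX : X.OneShot) (t : ℕ) (i : Fin n) :
    Scanning X t i (phase X t i) ∧
      (∀ s, cell X t false i = some s → ∃ t', X.ev t' = some (.invoke i s)) ∧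
      (∀ V, cell X t true i = some V → Snapshot X t i false V) := by
  induction t with
  | zero => simp [phase_zero, cell_zero, Scanning]
  | succ t ih =>
    obtain ⟨ih1, ih2, ih3⟩ := ih
    have hsnap : ∀ V, Snapshot X t i false V → Snapshot X (t + 1) i false V := by
      rintro V ⟨a, ha, hh⟩
      exact ⟨a, ha.trans t.le_succ, hh⟩
    by_cases hs : X.ev t = some (.step i)
    · have hm := move_of_step hs
      replace ih1 := ih1
      generalize phase X (t + 1) i = q at hm ⊢
      generalize phase X t i = p at hm ih1
      cases hm with
      | idle hc => rw [hc]; exact ⟨trivial, ih2, fun V hV => hsnap V (ih3 V hV)⟩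
      | write b x h1 h2 =>
        refine ⟨⟨by simp [h1], by simp [Sub], by simp⟩, fun s hs => ?_, fun V hV => ?_⟩
        · cases b with
          | false =>
            rw [h1] at hs
            cases hs
            exact ih1
          | true =>
            rw [h2 _ _ (by simp)] at hs
            exact ih2 s hs
        · cases b with
          | false =>
            rw [h2 _ _ (by simp)] at hV
            exact hsnap V (ih3 V hV)
          | true =>
            rw [h1] at hV
            cases hV
            exact hsnap _ ih1
      | new b K ch j js x h1 h2 h3 =>
        rw [h3]
        refine ⟨?_, ih2, fun V hV => hsnap V (ih3 V hV)⟩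
        obtain ⟨g0, g1, g2⟩ := ih1
        refine ⟨by rwa [h3], ?_, by simp⟩
        rw [h3]
        intro k y hy
        by_cases hk : k = j
        · subst hk
          rw [Function.update_self] at hy
          rw [h2, hy]
        · rw [Function.update_of_ne hk] at hy
          exact g1 k y hy
      | known b K ch j js h1 h3 =>
        rw [h3]
        refine ⟨?_, ih2, fun V hV => hsnap V (ih3 V hV)⟩
        obtain ⟨g0, g1, g2⟩ := ih1
        refine ⟨by rwa [h3], by rwa [h3], fun hch => ?_⟩
        obtain ⟨a, ha, k1, k2, k3⟩ := g2 hch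
        refine ⟨a, ha.trans t.le_succ, k1, k2, fun k hk => ?_⟩
        -- Cell `j` has just been passed. If its value was known, it was there at time `a`; if it is
        -- empty now, it was empty at `a`, since cells never lose a value.
        by_cases hkj : k = j
        · subst hkj
          cases hK : K k with
          | some x => exact k2 _ _ hK
          | none =>
            cases hc : cell X a b k with
            | none => rfl
            | some x =>
              have := cell_mono hX ha b _ _ hc
              rw [h1 hK] at this
              cases this
        · exact k3 k (by simp [hkj, hk])
      | restart b K h3 =>
        rw [h3]
        refine ⟨?_, ih2, fun V hV => hsnap V (ih3 V hV)⟩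
        obtain ⟨g0, g1, -⟩ := ih1
        -- The snapshot of the new pass is dated to its start `t`; no cell has been passed yet.
        refine ⟨by rwa [h3], by rwa [h3], fun _ => ⟨t, t.le_succ, g0, g1, fun j hj => ?_⟩⟩
        exact absurd (List.mem_finRange j) hj
      | view K h3 =>
        rw [h3]
        exact ⟨hsnap _ ih1.snapshot, ih2, fun V hV => hsnap V (ih3 V hV)⟩
      | ret K h3 =>
        rw [h3]
        exact ⟨trivial, ih2, fun V hV => hsnap V (ih3 V hV)⟩
    · simp only [cell_other hs]
      refine ⟨?_, ih2, fun V hV => hsnap V (ih3 V hV)⟩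
      by_cases hi : ∃ s, X.ev t = some (.invoke i s)
      · obtain ⟨s, hi⟩ := hi
        rw [phase_invoke hi]
        exact ⟨t, hi⟩
      · have hp : phase X (t + 1) i = phase X t i := phase_other (by
          rintro (⟨k, s⟩ | k) he rfl
          · exact hi ⟨s, he⟩
          · exact hs he)
        rw [hp]
        exact ih1.mono hX t.le_succ

theorem phase_of_ret {r : Trace D × Bool} {l : Phase D n}
    (h : next i (phase X t i) = .ret r l) :
    ∃ K, phase X t i = .scan true K false [] ∧ r = outcome K i := by
  cases hp : phase X t i with
  | idle => rw [hp] at h; simp [next] at h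
  | write b x => rw [hp] at h; simp [next] at h
  | scan b K ch todo =>
    match b, K, ch, todo, hp with
    | b, K, ch, j :: js, hp => rw [hp] at h; simp [next] at h
    | b, K, true, [], hp => rw [hp] at h; cases b <;> simp [next] at h
    | false, K, false, [], hp => rw [hp] at h; simp [next] at h
    | true, K, false, [], hp =>
      rw [hp] at h
      simp only [next, StepAction.ret.injEq] at h
      exact ⟨K, rfl, h.1.symm⟩

theorem facts (hX : X.OneShot) :
    Facts (fun t => cell X t false) (fun t => cell X t true) X.Invoked X.Returned where
  inp_mono _ _ h := cell_mono hX h false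
  vw_mono _ _ h := cell_mono hX h true
  inp_inv t j s h := (scanning hX t j).2.1 s h
  vw_snap t j V h := by
    obtain ⟨a, -, h1, rfl⟩ := (scanning hX t j).2.2 V h
    exact ⟨h1, a, rfl⟩
  ret_snap := by
    rintro i r ⟨t, l, -, hl⟩
    obtain ⟨K, hK, rfl⟩ := phase_of_ret (X := X) hl
    have := (scanning hX t i).1
    rw [hK] at this
    obtain ⟨a, -, h1, rfl⟩ := this.snapshot
    exact ⟨a, h1, rfl⟩

open Classical in
/-- A bound on the number of steps until the process returns. -/
noncomputable def remaining : Phase D n → ℕ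
  | .idle => 0
  | .write b _ => (if b then 0 else (2 * n + 1) * (n + 1) + 2) + (2 * n + 1) * (n + 1) + 2
  -- A pass takes `n + 1` steps. An unknown cell counts for two passes and a set flag for one, so a
  -- discovery, which may set the flag, still saves one pass. The first summand pays for the array
  -- of views when the array of inputs is being read.
  | .scan b K ch todo => (if b then 0 else (2 * n + 1) * (n + 1) + 2) +
      (2 * (Finset.univ.filter fun j => K j = none).card + if ch then 1 else 0) * (n + 1) +
      todo.length + 1

theorem Move.remaining_lt {c c' : (b : Bool) → Fin n → Option (Cell D n b)} {p q : Phase D n}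
    (h : Move i c c' p q) (hp : p ≠ .idle) : remaining q < remaining p := by
  classical
  cases h with
  | idle => exact absurd rfl hp
  | write b x =>
    simp [remaining]
  | new b K ch j js x h1 h2 =>
    have hu : (Finset.univ.filter fun k => Function.update K j (some x) k = none) =
        (Finset.univ.filter fun k => K k = none).erase j := by
      ext k
      by_cases hk : k = j
      · subst hk; simp
      · simp [hk]
    have hc : (Finset.univ.filter fun k => Function.update K j (some x) k = none).card + 1 =
        (Finset.univ.filter fun k => K k = none).card := by
      rw [hu]
      exact Finset.card_erase_add_one (by simpa using h1)
    simp only [remaining, ← hc, List.length_cons, if_true]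
    have : (2 * (Finset.univ.filter fun k => Function.update K j (some x) k = none).card + 1) *
        (n + 1) ≤ (2 * ((Finset.univ.filter fun k =>
          Function.update K j (some x) k = none).card + 1) + if ch then 1 else 0) * (n + 1) :=
      Nat.mul_le_mul_right _ (by omega)
    omega
  | known b K ch j js => simp [remaining]
  | restart b K =>
    simp only [remaining, if_true, Bool.false_eq_true, if_false, List.length_finRange,
      List.length_nil, add_mul]
    omega
  | view K =>
    simp only [remaining, if_true, Bool.false_eq_true, if_false]
    omega
  | ret K => simp [remaining]

/-- The phase `idle` is the only one in which a step need not lower `remaining`; it is excluded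
while an operation is pending. -/
theorem pend_invoked (t : ℕ) (i : Fin n) {s : Trace D} (h : (X.conf t).pend i = some s) :
    phase X t i ≠ .idle := by
  induction t generalizing s with
  | zero => rw [X.conf_zero] at h; simp [Implementation.Config.initial] at h
  | succ t ih =>
    cases he : X.ev t with
    | none =>
      rw [X.conf_none t he] at h
      rw [phase, X.conf_none t he]
      exact ih h
    | some e =>
      by_cases hi : e.proc = i
      · cases e with
        | invoke j s' =>
          obtain rfl : j = i := hi
          rw [phase_invoke he]
          simp
        | step j =>
          obtain rfl : j = i := hi
          obtain ⟨s', hs'⟩ := Option.ne_none_iff_exists'.1 (X.pend_of_step he)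
          have hne := ih hs'
          have hm := move_of_step he
          have hr : ∀ K, phase X t j ≠ .scan true K false [] := by
            intro K hK
            have hn : (algorithm D n).next j ((X.conf t).loc j) = .ret (outcome K j) .idle := by
              rw [phase] at hK
              rw [hK]
              rfl
            rw [(X.conf_some t _ he).2] at h
            simp [Implementation.Config.after, hn] at h
          generalize phase X (t + 1) j = q at hm ⊢
          generalize phase X t j = p at hm hne hr
          cases hm with
          | idle => exact absurd rfl hne
          | ret K => exact absurd rfl (hr K)
          | _ => simp
      · have ho : ∀ e, X.ev t = some e → e.proc ≠ i := by rw [he]; rintro _ ⟨⟩; exact hi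
        rw [phase_other ho]
        rw [(X.conf_other ho).2] at h
        exact ih h

/-- Own steps lower `remaining` and other processes do not affect it, so infinitely many steps
without a return would be an infinite descent. -/
theorem termination (s : Trace D) (hi : X.Invoked i s) (hc : X.Correct i) :
    ∃ r, X.Returned i r := by
  by_contra hr
  obtain ⟨t₀, h₀⟩ := hi
  have hpend : ∀ t, t₀ < t → (X.conf t).pend i = some s := by
    intro t ht
    induction t, ht using Nat.le_induction with
    | base => exact (X.pend_of_invoke h₀).2
    | succ t _ ih =>
      exact X.pend_succ_of_not_ret ih fun r l he hl => hr ⟨r, t, l, he, hl⟩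
  rcases hc with hc | ⟨T, hT⟩
  · have hstep : ∀ t e, t₀ < t → X.ev t = some e → e.proc = i → X.ev t = some (.step i) := by
      rintro t (⟨j, s'⟩ | j) ht he hj
      · obtain rfl : j = i := hj
        have := (X.pend_of_invoke he).1
        rw [hpend t ht] at this
        cases this
      · obtain rfl : j = i := hj
        exact he
    have hlt : ∀ t, t₀ < t → X.ev t = some (.step i) →
        remaining (phase X (t + 1) i) < remaining (phase X t i) := fun t ht he =>
      (move_of_step he).remaining_lt (pend_invoked t i (hpend t ht))
    have hle : ∀ t t', t₀ < t → t ≤ t' → remaining (phase X t' i) ≤ remaining (phase X t i) := by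
      intro t t' ht htt'
      induction t', htt' using Nat.le_induction with
      | base => exact le_rfl
      | succ t' htt' ih =>
        refine le_trans ?_ ih
        by_cases he : X.ev t' = some (.step i)
        · exact (hlt t' (ht.trans_le htt') he).le
        · rw [phase_other fun e h hp => he (hstep t' e (ht.trans_le htt') h hp)]
    have : ∀ m t, t₀ < t → remaining (phase X t i) = m → False := by
      intro m
      induction m using Nat.strong_induction_on with
      | _ m ih =>
        intro t ht hm
        obtain ⟨t', e, htt', he, hp⟩ := hc t
        have he' := hstep t' e (ht.trans_le htt') he hp
        have h1 := hlt t' (ht.trans_le htt') he'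
        have h2 := hle t t' ht htt'
        exact ih _ (by omega) (t' + 1) (by omega) rfl
    exact this _ _ t₀.lt_succ_self rfl
  · have := hT (max T (t₀ + 1)) (le_max_left _ _)
    rw [hpend _ (lt_of_lt_of_le t₀.lt_succ_self (le_max_right _ _))] at this
    cases this

theorem isGCA : IsGCA (algorithm D n) where
  termination _ _ _ s hi hc := termination s hi hc
  validity _ hX _ _ _ h := by
    classical
    intro o ho
    obtain ⟨j, s, h1, h2⟩ := (facts hX).validity h o ho
    exact ⟨j, s, h1, by convert h2⟩
  adoption _ hX _ _ h _ _ _ h' := (facts hX).adoption h h'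
  commitment _ hX hne hc hr := (facts hX).commitment hne hc hr
  convergence _ hX := (facts hX).convergence
  common_prefix _ hX _ he _ _ _ h := (facts hX).common_prefix he h
  weak_agreement _ hX hI _ _ _ h := (facts hX).weak_agreement hI h

end Algorithm

end GCA

/-! ### The steps of the construction -/

namespace Implementation

variable {n : ℕ} {O : Type v} {R : Type w}

open Classical in
/-- The registers and the local state after a step of process `i` in local state `l`. -/
noncomputable def effect (I : Implementation.{u} n O R) (i : Fin n) (m : (x : I.Reg) → I.Val x)
    (l : I.Loc) : ((x : I.Reg) → I.Val x) × I.Loc :=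
  match I.next i l with
  | .read x k => (m, k (m x))
  | .write x y l' => (Function.update m x y, l')
  | .skip l' => (m, l')
  | .ret _ l' => (m, l')

theorem Config.after_step {I : Implementation.{u} n O R} (c : I.Config) (i : Fin n) :
    (c.after (.step i)).mem = (I.effect i c.mem (c.loc i)).1 ∧
      (c.after (.step i)).loc = Function.update c.loc i (I.effect i c.mem (c.loc i)).2 ∧
      (c.after (.step i)).pend = match I.next i (c.loc i) with
        | .ret _ _ => Function.update c.pend i none
        | _ => c.pend := by
  simp only [Config.after, effect]
  cases I.next i (c.loc i) <;> exact ⟨rfl, rfl, rfl⟩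

end Implementation

namespace Helping

variable {n : ℕ} {Q : Type v} {O : Type u} {R : Type w}

section Moves

variable (A : SeqObject Q O R) (G : ℕ → Implementation.{u} n (A.CmdTrace n) (A.CmdTrace n × Bool))
  (arr : Fin n → Finset (Cmd n O) → List (Cmd n O))

/-- The contents of the registers, by array. -/
@[ext] structure Mem where
  M : Fin n → Option (Cmd n O)
  S : Fin n → ℕ × A.CmdTrace n
  g : (k : ℕ) → (x : (G k).Reg) → (G k).Val x

open Classical in
/-- How a step of process `i` changes the registers and its local state, and its response. -/
inductive Move (i : Fin n) (m m' : Mem A G) : Local A G → Local A G → Option R → Prop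
  | idle (L : Local A G) : L.phase = .idle → m' = m → Move i m m' L L none
  | announce (r seq : ℕ) (s : A.CmdTrace n) (cmd : Cmd n O) :
      m' = { m with M := Function.update m.M i (some cmd) } →
      Move i m m' ⟨r, seq, s, .announce cmd⟩ ⟨r, seq, s, .start cmd (List.finRange n) (r, s)⟩ none
  | startRead (r seq : ℕ) (s : A.CmdTrace n) (cmd : Cmd n O) (j : Fin n) (js : List (Fin n))
      (best : ℕ × A.CmdTrace n) : m' = m →
      Move i m m' ⟨r, seq, s, .start cmd (j :: js) best⟩
        ⟨r, seq, s, .start cmd js (later A best (m.S j))⟩ none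
  | startEnd (r seq : ℕ) (s : A.CmdTrace n) (cmd : Cmd n O) (best : ℕ × A.CmdTrace n) : m' = m →
      Move i m m' ⟨r, seq, s, .start cmd [] best⟩
        ⟨best.1 + 1, seq, best.2, .help cmd (List.finRange n) ∅⟩ none
  | helpNew (r seq : ℕ) (s : A.CmdTrace n) (cmd : Cmd n O) (j : Fin n) (js : List (Fin n))
      (found : Finset (Cmd n O)) (d : Cmd n O) : m.M j = some d → d ∉ s.ops → m' = m →
      Move i m m' ⟨r, seq, s, .help cmd (j :: js) found⟩
        ⟨r, seq, s, .help cmd js (insert d found)⟩ none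
  | helpSkip (r seq : ℕ) (s : A.CmdTrace n) (cmd : Cmd n O) (j : Fin n) (js : List (Fin n))
      (found : Finset (Cmd n O)) : (∀ d, m.M j = some d → d ∈ s.ops) → m' = m →
      Move i m m' ⟨r, seq, s, .help cmd (j :: js) found⟩ ⟨r, seq, s, .help cmd js found⟩ none
  | helpEnd (r seq : ℕ) (s : A.CmdTrace n) (cmd : Cmd n O) (found : Finset (Cmd n O)) : m' = m →
      Move i m m' ⟨r, seq, s, .help cmd [] found⟩
        ⟨r, seq, s * Trace.mk _ (arr i found), .propose cmd r
          ((G r).invoke i (s * Trace.mk _ (arr i found)) ((G r).loc0 i))⟩ none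
  | propStep (r seq : ℕ) (s : A.CmdTrace n) (cmd : Cmd n O) (k : ℕ) (l : (G k).Loc) :
      (∀ y l', (G k).next i l ≠ .ret y l') → m'.M = m.M → m'.S = m.S →
      m'.g k = ((G k).effect i (m.g k) l).1 → (∀ k', k' ≠ k → m'.g k' = m.g k') →
      Move i m m' ⟨r, seq, s, .propose cmd k l⟩
        ⟨r, seq, s, .propose cmd k ((G k).effect i (m.g k) l).2⟩ none
  | propRet (r seq : ℕ) (s : A.CmdTrace n) (cmd : Cmd n O) (k : ℕ) (l l' : (G k).Loc)
      (x : A.CmdTrace n) (c : Bool) : (G k).next i l = .ret (x, c) l' → m' = m →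
      Move i m m' ⟨r, seq, s, .propose cmd k l⟩
        ⟨r, seq, x, if c = true then .record cmd else .check cmd (List.finRange n) (0, 1)⟩ none
  | record (r seq : ℕ) (s : A.CmdTrace n) (cmd : Cmd n O) :
      m' = { m with S := Function.update m.S i (r, s) } →
      Move i m m' ⟨r, seq, s, .record cmd⟩ ⟨r, seq, s, .check cmd (List.finRange n) (0, 1)⟩ none
  | checkRead (r seq : ℕ) (s : A.CmdTrace n) (cmd : Cmd n O) (j : Fin n) (js : List (Fin n))
      (best : ℕ × A.CmdTrace n) : m' = m →
      Move i m m' ⟨r, seq, s, .check cmd (j :: js) best⟩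
        ⟨r, seq, s, .check cmd js (later A best (m.S j))⟩ none
  | checkRet (r seq : ℕ) (s : A.CmdTrace n) (cmd : Cmd n O) (best : ℕ × A.CmdTrace n) :
      cmd ∈ best.2.ops → m' = m →
      Move i m m' ⟨r, seq, s, .check cmd [] best⟩ ⟨r, seq, s, .idle⟩
        (some ((A.cmdObj n).ret cmd best.2))
  | checkLoop (r seq : ℕ) (s : A.CmdTrace n) (cmd : Cmd n O) (best : ℕ × A.CmdTrace n) :
      cmd ∉ best.2.ops → m' = m →
      Move i m m' ⟨r, seq, s, .check cmd [] best⟩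
        ⟨r + 1, seq, s, .help cmd (List.finRange n) ∅⟩ none

end Moves

variable {A : SeqObject Q O R} {G : ℕ → Implementation.{u} n (A.CmdTrace n) (A.CmdTrace n × Bool)}
  {arr : Fin n → Finset (Cmd n O) → List (Cmd n O)}

/-- The registers at time `t`. -/
def mem (X : (construction A G arr).Execution) (t : ℕ) : Mem A G :=
  ⟨fun i => (X.conf t).mem (.M i), fun i => (X.conf t).mem (.S i),
    fun k x => (X.conf t).mem (.gca k x)⟩

/-- The local state of process `i` at time `t`. -/
def loc (X : (construction A G arr).Execution) (t : ℕ) (i : Fin n) : Local A G := (X.conf t).loc i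

/-- The pending operation of process `i` at time `t`. -/
def pend (X : (construction A G arr).Execution) (t : ℕ) (i : Fin n) : Option O := (X.conf t).pend i

variable {X : (construction A G arr).Execution} {t : ℕ} {i : Fin n}

theorem loc_zero : loc X 0 i = ⟨0, 0, 1, .idle⟩ := by
  rw [loc, X.conf_zero]; rfl

theorem pend_zero : pend X 0 i = none := by
  rw [pend, X.conf_zero]; rfl

theorem mem_zero : mem X 0 = ⟨fun _ => none, fun _ => (0, 1), fun k => (G k).mem0⟩ := by
  rw [mem, X.conf_zero]; rfl

theorem after_effect (h : X.ev t = some (.step i)) {m' : (x : Reg A G) → Val A G x}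
    {L' : Local A G}
    (he : (construction A G arr).effect i (X.conf t).mem ((X.conf t).loc i) = (m', L')) :
    mem X (t + 1) = ⟨fun i => m' (.M i), fun i => m' (.S i), fun k x => m' (.gca k x)⟩ ∧
      loc X (t + 1) i = L' := by
  obtain ⟨h1, h2, -⟩ := (X.conf t).after_step i
  rw [he] at h1 h2
  rw [mem, loc, (X.conf_some t _ h).2, h1, h2]
  exact ⟨rfl, Function.update_self ..⟩

theorem pend_label_of_not_ret (h : X.ev t = some (.step i))
    (hn : ∀ r l, next A G arr i (loc X t i) ≠ .ret r l) :
    pend X (t + 1) i = pend X t i ∧ (X.conf t).label (.step i) = [] := by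
  obtain ⟨-, -, h3⟩ := (X.conf t).after_step i
  rw [pend, pend, (X.conf_some t _ h).2, h3]
  simp only [Implementation.Config.label]
  have hn' : ∀ r l, (construction A G arr).next i ((X.conf t).loc i) ≠ .ret r l := hn
  revert hn'
  generalize (construction A G arr).next i ((X.conf t).loc i) = a
  intro hn'
  cases a with
  | ret r l => exact absurd rfl (hn' r l)
  | _ => exact ⟨rfl, rfl⟩

-- This turns the code in `next` into the relation `Move`; every invariant of the construction is
-- then proved by cases on `Move`.
open Classical in
theorem move_of_step (h : X.ev t = some (.step i)) :
    ∃ y, Move A G arr i (mem X t) (mem X (t + 1)) (loc X t i) (loc X (t + 1) i) y ∧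
      pend X (t + 1) i = (if y = none then pend X t i else none) ∧
      (X.conf t).label (.step i) = y.toList.map (.res i) := by
  have skip : ∀ {L L' : Local A G}, loc X t i = L → next A G arr i L = .skip L' →
      mem X (t + 1) = mem X t ∧ loc X (t + 1) i = L' ∧ pend X (t + 1) i = pend X t i ∧
        (X.conf t).label (.step i) = [] := by
    rintro L L' rfl hn
    have hn' : (construction A G arr).next i ((X.conf t).loc i) = .skip L' := hn
    obtain ⟨h1, h2⟩ := after_effect (m' := (X.conf t).mem) (L' := L') h (by
      rw [Implementation.effect, hn']; rfl)
    exact ⟨h1, h2, pend_label_of_not_ret h (by rw [hn]; simp)⟩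
  have read : ∀ {L : Local A G} {x : Reg A G} {f : Val A G x → Local A G}, loc X t i = L →
      next A G arr i L = .read x f →
      mem X (t + 1) = mem X t ∧ loc X (t + 1) i = f ((X.conf t).mem x) ∧
        pend X (t + 1) i = pend X t i ∧ (X.conf t).label (.step i) = [] := by
    rintro L x f rfl hn
    have hn' : (construction A G arr).next i ((X.conf t).loc i) = .read x f := hn
    obtain ⟨h1, h2⟩ := after_effect (m' := (X.conf t).mem) (L' := f ((X.conf t).mem x)) h (by
      rw [Implementation.effect, hn']; rfl)
    exact ⟨h1, h2, pend_label_of_not_ret h (by rw [hn]; simp)⟩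
  have write : ∀ {L L' : Local A G} {x : Reg A G} {y : Val A G x}, loc X t i = L →
      next A G arr i L = .write x y L' →
      ∃ m' : (z : Reg A G) → Val A G z, m' x = y ∧ (∀ z, z ≠ x → m' z = (X.conf t).mem z) ∧
        mem X (t + 1) = ⟨fun i => m' (.M i), fun i => m' (.S i), fun k z => m' (.gca k z)⟩ ∧
        loc X (t + 1) i = L' ∧ pend X (t + 1) i = pend X t i ∧ (X.conf t).label (.step i) = [] := by
    rintro L L' x y rfl hn
    have hn' : (construction A G arr).next i ((X.conf t).loc i) = .write x y L' := hn
    obtain ⟨h1, h2⟩ := after_effect (m' := Function.update (X.conf t).mem x y) (L' := L') h (by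
      rw [Implementation.effect, hn']; rfl)
    exact ⟨_, Function.update_self _ _ _, fun z hz => Function.update_of_ne hz _ _, h1, h2,
      pend_label_of_not_ret h (by rw [hn]; simp)⟩
  rcases hL : loc X t i with ⟨r, seq, s, ph⟩
  cases ph with
  | idle =>
    obtain ⟨h1, h2, h3, h4⟩ := skip hL rfl
    refine ⟨none, ?_, by simpa using h3, by simpa using h4⟩
    rw [h2]
    exact .idle _ rfl h1
  | announce cmd =>
    obtain ⟨m', hself, hother, h1, h2, h3, h4⟩ := write hL rfl
    refine ⟨none, h2 ▸ .announce r seq s cmd (h1.trans ?_), by simpa using h3, by simpa using h4⟩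
    ext1
    · funext j
      by_cases hj : j = i
      · subst hj
        (simp only [Function.update_self]; exact hself)
      · simp only [Function.update_of_ne hj]
        exact hother _ (by simpa using hj)
    · funext j
      exact hother _ (by simp)
    · funext k z
      exact hother _ (by simp)
  | start cmd todo best =>
    cases todo with
    | nil =>
      obtain ⟨h1, h2, h3, h4⟩ := skip hL rfl
      exact ⟨none, h2 ▸ .startEnd _ _ _ _ _ h1, by simpa using h3, by simpa using h4⟩
    | cons j js =>
      obtain ⟨h1, h2, h3, h4⟩ := read hL rfl
      exact ⟨none, h2 ▸ .startRead _ _ _ _ _ _ _ h1, by simpa using h3, by simpa using h4⟩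
  | help cmd todo found =>
    cases todo with
    | nil =>
      obtain ⟨h1, h2, h3, h4⟩ := skip hL rfl
      exact ⟨none, h2 ▸ .helpEnd _ _ _ _ _ h1, by simpa using h3, by simpa using h4⟩
    | cons j js =>
      obtain ⟨h1, h2, h3, h4⟩ := read hL rfl
      refine ⟨none, ?_, by simpa using h3, by simpa using h4⟩
      rw [h2]
      cases hm : (mem X t).M j with
      | none =>
        have hm' : (X.conf t).mem (.M j) = (none : Option (Cmd n O)) := hm
        simp only [hm']
        exact .helpSkip _ _ _ _ _ _ _ (by simp [hm]) h1
      | some d =>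
        have hm' : (X.conf t).mem (.M j) = (some d : Option (Cmd n O)) := hm
        simp only [hm']
        split_ifs with hd
        · exact .helpSkip _ _ _ _ _ _ _ (by simpa [hm] using hd) h1
        · convert Move.helpNew _ _ _ _ _ _ _ _ hm hd h1
  | propose cmd k l =>
    cases hn : (G k).next i l with
    | read x f =>
      obtain ⟨h1, h2, h3, h4⟩ := read (x := .gca k x)
        (f := fun y => ⟨r, seq, s, .propose cmd k (f y)⟩) hL (by simp only [next, hn])
      refine ⟨none, ?_, by simpa using h3, by simpa using h4⟩
      have := Move.propStep (A := A) (G := G) (arr := arr) (i := i) (m := mem X t)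
        (m' := mem X (t + 1)) r seq s cmd k l (by simp [hn]) (by rw [h1]) (by rw [h1])
        (by rw [h1, Implementation.effect, hn]) (by simp [h1])
      simp only [Implementation.effect, hn] at this
      rw [h2]
      exact this
    | write x y l' =>
      obtain ⟨m', hself, hother, h1, h2, h3, h4⟩ := write (x := .gca k x) (y := y)
        (L' := ⟨r, seq, s, .propose cmd k l'⟩) hL (by simp only [next, hn])
      refine ⟨none, ?_, by simpa using h3, by simpa using h4⟩
      have := Move.propStep (A := A) (G := G) (arr := arr) (i := i) (m := mem X t)
        (m' := mem X (t + 1)) r seq s cmd k l (by simp [hn])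
        (by
          rw [h1]
          funext j
          exact hother _ (by simp))
        (by
          rw [h1]
          funext j
          exact hother _ (by simp))
        (by
          rw [h1, Implementation.effect, hn]
          funext z
          by_cases hz : z = x
          · subst hz
            exact hself.trans (Function.update_self ..).symm
          · simp only [Function.update_of_ne hz]
            exact hother _ (by simpa using hz))
        (by
          intro k' hk
          rw [h1]
          funext z
          exact hother _ (by simp [hk]))
      simp only [Implementation.effect, hn] at this
      rw [h2]
      exact this
    | skip l' =>
      obtain ⟨h1, h2, h3, h4⟩ := skip (L' := ⟨r, seq, s, .propose cmd k l'⟩) hL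
        (by simp only [next, hn])
      refine ⟨none, ?_, by simpa using h3, by simpa using h4⟩
      have := Move.propStep (A := A) (G := G) (arr := arr) (i := i) (m := mem X t)
        (m' := mem X (t + 1)) r seq s cmd k l (by simp [hn]) (by rw [h1]) (by rw [h1])
        (by rw [h1, Implementation.effect, hn]) (by simp [h1])
      simp only [Implementation.effect, hn] at this
      rw [h2]
      exact this
    | ret y l' =>
      obtain ⟨x, c⟩ := y
      obtain ⟨h1, h2, h3, h4⟩ := skip (L' := ⟨r, seq, x,
        if c = true then .record cmd else .check cmd (List.finRange n) (0, 1)⟩) hL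
        (by simp only [next, hn])
      refine ⟨none, ?_, by simpa using h3, by simpa using h4⟩
      rw [h2]
      exact .propRet _ _ _ _ _ _ l' _ _ hn h1
  | record cmd =>
    obtain ⟨m', hself, hother, h1, h2, h3, h4⟩ := write hL rfl
    refine ⟨none, h2 ▸ .record r seq s cmd (h1.trans ?_), by simpa using h3, by simpa using h4⟩
    ext1
    · funext j
      exact hother _ (by simp)
    · funext j
      by_cases hj : j = i
      · subst hj
        (simp only [Function.update_self]; exact hself)
      · simp only [Function.update_of_ne hj]
        exact hother _ (by simpa using hj)
    · funext k z
      exact hother _ (by simp)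
  | check cmd todo best =>
    cases todo with
    | cons j js =>
      obtain ⟨h1, h2, h3, h4⟩ := read hL rfl
      exact ⟨none, h2 ▸ .checkRead _ _ _ _ _ _ _ h1, by simpa using h3, by simpa using h4⟩
    | nil =>
      by_cases hc : cmd ∈ best.2.ops
      · have hn : (construction A G arr).next i ((X.conf t).loc i) =
            .ret ((A.cmdObj n).ret cmd best.2) ⟨r, seq, s, .idle⟩ := by
          rw [loc] at hL
          rw [hL]
          simp only [construction, next, if_pos hc]
        obtain ⟨h1, h2⟩ := after_effect (m' := (X.conf t).mem) (L' := ⟨r, seq, s, .idle⟩) h (by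
          rw [Implementation.effect, hn]; rfl)
        refine ⟨some ((A.cmdObj n).ret cmd best.2), ?_, ?_, ?_⟩
        · rw [h2]
          exact .checkRet _ _ _ _ _ hc h1
        · obtain ⟨-, -, h3⟩ := (X.conf t).after_step i
          rw [pend, (X.conf_some t _ h).2, h3, hn]
          simp
        · simp [Implementation.Config.label, hn]
      · obtain ⟨h1, h2, h3, h4⟩ := skip (L' := ⟨r + 1, seq, s, .help cmd (List.finRange n) ∅⟩) hL
          (by simp only [next, if_neg hc])
        exact ⟨none, h2 ▸ .checkLoop _ _ _ _ _ hc h1, by simpa using h3, by simpa using h4⟩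

end Helping

/-! ### Rounds, phases and pending commands of a process -/

namespace Helping

variable {n : ℕ} {Q : Type v} {O : Type u} {R : Type w}
variable {A : SeqObject Q O R} {G : ℕ → Implementation.{u} n (A.CmdTrace n) (A.CmdTrace n × Bool)}
  {arr : Fin n → Finset (Cmd n O) → List (Cmd n O)}

theorem later_fst (p q : ℕ × A.CmdTrace n) : (later A p q).1 = max p.1 q.1 := by
  rw [later]
  split_ifs with h
  · rw [max_eq_right h]
  · rw [max_eq_left (by omega)]

theorem later_eq (p q : ℕ × A.CmdTrace n) : later A p q = p ∨ later A p q = q := by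
  rw [later]
  split_ifs <;> simp

/-- What happens to process `i` at time `t`. -/
inductive Trans (X : (construction A G arr).Execution) (t : ℕ) (i : Fin n) : Prop
  | other : (∀ e, X.ev t = some e → e.proc ≠ i) → loc X (t + 1) i = loc X t i →
      pend X (t + 1) i = pend X t i → Trans X t i
  | inv (o : O) : X.ev t = some (.invoke i o) → pend X t i = none → pend X (t + 1) i = some o →
      loc X (t + 1) i = invoke A G i o (loc X t i) → mem X (t + 1) = mem X t → Trans X t i
  | step (y : Option R) : X.ev t = some (.step i) →
      Move A G arr i (mem X t) (mem X (t + 1)) (loc X t i) (loc X (t + 1) i) y →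
      pend X t i ≠ none → pend X (t + 1) i = (if y = none then pend X t i else none) →
      (X.conf t).label (.step i) = y.toList.map (.res i) → Trans X t i

section

variable (X : (construction A G arr).Execution) (t : ℕ) (i : Fin n)

theorem mem_of_not_step (h : ∀ i, X.ev t ≠ some (.step i)) : mem X (t + 1) = mem X t := by
  cases he : X.ev t with
  | none => rw [mem, X.conf_none t he]; rfl
  | some e =>
    cases e with
    | invoke k s => rw [mem, (X.conf_some t _ he).2]; rfl
    | step k => exact absurd he (h k)

theorem trans_cases : Trans X t i := by
  by_cases h : ∀ e, X.ev t = some e → e.proc ≠ i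
  · exact .other h (X.conf_other h).1 (X.conf_other h).2
  · push Not at h
    obtain ⟨e, he, hi⟩ := h
    cases e with
    | invoke j o =>
      obtain rfl : j = i := hi
      refine .inv o he (X.pend_of_invoke he).1 (X.pend_of_invoke he).2 ?_
        (mem_of_not_step X t (by simp [he]))
      rw [loc, (X.conf_some t _ he).2]
      simp [Implementation.Config.after, construction, loc]
    | step j =>
      obtain rfl : j = i := hi
      obtain ⟨y, h1, h2, h3⟩ := move_of_step he
      exact .step y he h1 (X.pend_of_step he) h2 h3

end

/-- The command that a process is executing. -/
def Phase.cmd : Phase A G → Option (Cmd n O)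
  | .idle => none
  | .announce c => some c
  | .start c _ _ => some c
  | .help c _ _ => some c
  | .propose c _ _ => some c
  | .record c => some c
  | .check c _ _ => some c

/-- Relations between the variables of a process. -/
def Local.WF (L : Local A G) : Prop :=
  match L.phase with
  | .idle => True
  | .announce _ => True
  | .start _ _ best => L.r ≤ best.1
  | .propose _ k _ => k = L.r ∧ 1 ≤ L.r
  | _ => 1 ≤ L.r

/-- A process that has not started `GCA_k`. -/
def Before (k : ℕ) (L : Local A G) : Prop :=
  L.r < k ∨ L.r = k ∧ ∃ c todo found, L.phase = .help c todo found

section MoveLemmas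

variable {i : Fin n} {m m' : Mem A G} {L L' : Local A G} {y : Option R}

theorem Move.wf (h : Move A G arr i m m' L L' y) (hL : L.WF) : L'.WF := by
  cases h with
  | idle _ _ => exact hL
  | announce => simp [Local.WF]
  | startRead =>
    simp only [Local.WF, later_fst] at hL ⊢
    omega
  | propRet r seq s cmd k l l' x c =>
    simp only [Local.WF] at hL ⊢
    cases c <;> exact hL.2
  | _ => simp_all [Local.WF]

theorem Move.r_le (h : Move A G arr i m m' L L' y) (hL : L.WF) : L.r ≤ L'.r := by
  cases h with
  | startEnd => simp only [Local.WF] at hL ⊢; omega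
  | checkLoop => simp
  | _ => exact le_rfl

/-- The round never decreases, and the two moves into a collection phase from outside strictly raise
it, by `Local.WF` when the loop is entered. So round `k` cannot be entered again once it has been
started. -/
theorem Move.before {k : ℕ} (h : Move A G arr i m m' L L' y) (hL : L.WF) (hb : Before k L') :
    Before k L := by
  cases h with
  | startEnd =>
    simp only [Local.WF, Before] at hL hb ⊢
    left
    rcases hb with hb | ⟨hb, -⟩ <;> omega
  | checkLoop =>
    simp only [Local.WF, Before] at hL hb ⊢
    left
    rcases hb with hb | ⟨hb, -⟩ <;> omega
  | propRet r seq s cmd k l l' x c =>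
    cases c <;> simpa [Before] using hb
  | _ => simp_all [Before]

theorem Move.seq_eq (h : Move A G arr i m m' L L' y) : L'.seq = L.seq := by
  cases h <;> rfl

theorem Move.cmd_eq (h : Move A G arr i m m' L L' y) :
    L'.phase.cmd = if y = none then L.phase.cmd else none := by
  cases h with
  | propRet r seq s cmd k l l' x c => cases c <;> rfl
  | _ => simp [Phase.cmd]

end MoveLemmas

section

variable (X : (construction A G arr).Execution) (t : ℕ) (i : Fin n)

theorem wf : (loc X t i).WF := by
  induction t with
  | zero => rw [loc_zero]; trivial
  | succ t ih =>
    cases trans_cases X t i with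
    | other _ h _ => rw [h]; exact ih
    | inv o _ _ _ h => rw [h]; trivial
    | step y _ h => exact h.wf ih

theorem cmd_eq : (loc X t i).phase.cmd = (pend X t i).map fun o => ⟨o, i, (loc X t i).seq⟩ := by
  induction t with
  | zero => rw [loc_zero, pend_zero]; rfl
  | succ t ih =>
    cases trans_cases X t i with
    | other _ h h' => rw [h, h']; exact ih
    | inv o _ _ h' h => rw [h, h']; rfl
    | step y _ h _ h' =>
      rw [h', h.cmd_eq, h.seq_eq]
      split_ifs
      · exact ih
      · rfl

theorem before_of_succ {k : ℕ} (h : Before k (loc X (t + 1) i)) : Before k (loc X t i) := by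
  cases trans_cases X t i with
  | other _ h' _ => rwa [h'] at h
  | inv o _ _ _ h' =>
    rw [h'] at h
    simpa [Before, invoke] using Or.inl h
  | step y _ h' => exact h'.before (wf X t i) h

theorem r_le_succ : (loc X t i).r ≤ (loc X (t + 1) i).r := by
  cases trans_cases X t i with
  | other _ h' _ => rw [h']
  | inv o _ _ _ h' => rw [h']; exact le_rfl
  | step y _ h' => exact h'.r_le (wf X t i)

variable {X i}

theorem r_mono {t t' : ℕ} (h : t ≤ t') : (loc X t i).r ≤ (loc X t' i).r :=
  monotone_nat_of_le_succ (f := fun t => (loc X t i).r) (fun t => r_le_succ X t i) h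

theorem before_anti {k : ℕ} {t t' : ℕ} (h : t ≤ t') (hb : Before k (loc X t' i)) :
    Before k (loc X t i) := by
  induction t', h using Nat.le_induction with
  | base => exact hb
  | succ t' _ ih => exact ih (before_of_succ X t' i hb)

end

/-! ### The executions of the objects `GCA_k` -/

variable (arr) in
/-- The event of `GCA_k` that a step of process `i` in local state `L` is. -/
def projStep (k : ℕ) (i : Fin n) (L : Local A G) : Option (Event n (A.CmdTrace n)) :=
  match L.phase with
  | .help _ [] found => if L.r = k then some (.invoke i (L.s * Trace.mk _ (arr i found))) else none
  | .propose _ k' _ => if k' = k then some (.step i) else none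
  | _ => none

/-- The event of `GCA_k` at time `t`. -/
def projEv (X : (construction A G arr).Execution) (k t : ℕ) : Option (Event n (A.CmdTrace n)) :=
  match X.ev t with
  | some (.step i) => projStep arr k i (loc X t i)
  | _ => none

/-- The configuration of `GCA_k` at time `t`. -/
noncomputable def projConf (X : (construction A G arr).Execution) (k : ℕ) : ℕ → (G k).Config
  | 0 => Implementation.Config.initial (G k)
  | t + 1 => match projEv X k t with
    | none => projConf X k t
    | some e => (projConf X k t).after e

variable (X : (construction A G arr).Execution) (k t : ℕ)

theorem projConf_succ_none (h : projEv X k t = none) : projConf X k (t + 1) = projConf X k t := by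
  simp only [projConf, h]

theorem projConf_succ_some {e : Event n (A.CmdTrace n)} (h : projEv X k t = some e) :
    projConf X k (t + 1) = (projConf X k t).after e := by
  simp only [projConf, h]

theorem projStep_proc {i : Fin n} {L : Local A G} {e : Event n (A.CmdTrace n)}
    (h : projStep arr k i L = some e) : e.proc = i := by
  rw [projStep] at h
  split at h
  · split_ifs at h
    cases h
    rfl
  · split_ifs at h
    cases h
    rfl
  · cases h

theorem projEv_of_step {i : Fin n} (h : X.ev t = some (.step i)) :
    projEv X k t = projStep arr k i (loc X t i) := by
  rw [projEv, h]

theorem projEv_eq_some {e : Event n (A.CmdTrace n)} (h : projEv X k t = some e) :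
    X.ev t = some (.step e.proc) ∧ projStep arr k e.proc (loc X t e.proc) = some e := by
  rw [projEv] at h
  split at h
  · next i he =>
    obtain rfl := projStep_proc k h
    exact ⟨he, h⟩
  · cases h

theorem projConf_other {i : Fin n} (h : ∀ e, X.ev t = some e → e.proc ≠ i) :
    (projConf X k (t + 1)).loc i = (projConf X k t).loc i ∧
      (projConf X k (t + 1)).pend i = (projConf X k t).pend i := by
  cases he : projEv X k t with
  | none => rw [projConf_succ_none X k t he]; exact ⟨rfl, rfl⟩
  | some e =>
    rw [projConf_succ_some X k t he]
    exact (projConf X k t).after_other e (h _ (projEv_eq_some X k t he).1)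

/-- How the configurations of `GCA_k` and of the construction are related. -/
structure Related (i : Fin n) : Prop where
  before : Before k (loc X t i) →
    (projConf X k t).pend i = none ∧ (projConf X k t).loc i = (G k).loc0 i
  during : ∀ c l, (loc X t i).phase = .propose c k l →
    (projConf X k t).pend i ≠ none ∧ (projConf X k t).loc i = l
  after : ¬ Before k (loc X t i) → (∀ c l, (loc X t i).phase ≠ .propose c k l) →
    (projConf X k t).pend i = none

theorem Related.of_eq {i : Fin n} (h : Related X k t i)
    (hl : (projConf X k (t + 1)).loc i = (projConf X k t).loc i)
    (hp : (projConf X k (t + 1)).pend i = (projConf X k t).pend i)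
    (hb : Before k (loc X (t + 1) i) → Before k (loc X t i))
    (hd : ∀ c l, (loc X (t + 1) i).phase = .propose c k l → (loc X t i).phase = .propose c k l)
    (ha : ¬ Before k (loc X (t + 1) i) → (∀ c l, (loc X (t + 1) i).phase ≠ .propose c k l) →
      (projConf X k t).pend i = none) : Related X k (t + 1) i := by
  refine ⟨fun hb' => ?_, fun c l hc => ?_, fun h1 h2 => ?_⟩
  · rw [hl, hp]; exact h.before (hb hb')
  · rw [hl, hp]; exact h.during c l (hd c l hc)
  · rw [hp]; exact ha h1 h2

/-- The registers of different `GCA_k` are disjoint, so only the steps projected to `GCA_k` change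
its registers. The local state of `GCA_k` is carried in the phase `propose`; before it nothing has
happened in `GCA_k`, and after it nothing is pending there. -/
theorem related_all : (projConf X k t).mem = (mem X t).g k ∧ ∀ i, Related X k t i := by
  classical
  induction t with
  | zero =>
    refine ⟨by rw [mem_zero]; rfl, fun i => ⟨fun _ => ⟨rfl, rfl⟩, fun c l h => ?_, fun _ _ => rfl⟩⟩
    rw [loc_zero] at h
    cases h
  | succ t ih =>
    obtain ⟨ihm, ih⟩ := ih
    have hmem : ∀ (_ : projEv X k t = none) (_ : (mem X (t + 1)).g k = (mem X t).g k),
        (projConf X k (t + 1)).mem = (mem X (t + 1)).g k := by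
      intro h1 h2
      rw [projConf_succ_none X k t h1, h2, ihm]
    suffices hs : ∀ i, X.ev t = some (.step i) →
        (projConf X k (t + 1)).mem = (mem X (t + 1)).g k ∧ Related X k (t + 1) i by
      constructor
      · by_cases h : ∃ i, X.ev t = some (.step i)
        · obtain ⟨i, hi⟩ := h
          exact (hs i hi).1
        · push Not at h
          refine hmem ?_ (by rw [mem_of_not_step X t h])
          cases he : projEv X k t with
          | none => rfl
          | some e => exact absurd (projEv_eq_some X k t he).1 (h _)
      · intro i
        cases trans_cases X t i with
        | step y he => exact (hs i he).2
        | other h hl hp =>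
          obtain ⟨h1, h2⟩ := projConf_other X k t h
          refine (ih i).of_eq X k t h1 h2 ?_ ?_ ?_
          · rw [hl]; exact id
          · rw [hl]; exact fun _ _ => id
          · rw [hl]; exact (ih i).after
        | inv o he _ _ hl =>
          have h0 : projEv X k t = none := by rw [projEv, he]
          refine (ih i).of_eq X k t (by rw [projConf_succ_none X k t h0])
            (by rw [projConf_succ_none X k t h0]) (before_of_succ X t i) ?_ ?_
          · rw [hl]; intro c l h; cases h
          · intro h1 _
            by_cases hb : Before k (loc X t i)
            · exact ((ih i).before hb).1
            · refine (ih i).after hb ?_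
              intro c l hc
              have hcmd := cmd_eq X t i
              rw [hc, show pend X t i = none by assumption] at hcmd
              cases hcmd
    intro i he
    cases trans_cases X t i with
    | other h => exact absurd rfl (h _ he)
    | inv o h => rw [he] at h; cases h
    | step y _ hm hpend =>
      have hw := wf X t i
      have hR := ih i
      have hev := projEv_of_step X k t he
      have hbs := before_of_succ X t i (k := k)
      -- steps that are not events of `GCA_k`
      have key : projEv X k t = none → (mem X (t + 1)).g k = (mem X t).g k →
          (∀ c l, (loc X t i).phase ≠ .propose c k l) →
          (∀ c l, (loc X (t + 1) i).phase ≠ .propose c k l) →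
          (projConf X k (t + 1)).mem = (mem X (t + 1)).g k ∧ Related X k (t + 1) i := by
        intro h0 h1 h2 h3
        refine ⟨hmem h0 h1, hR.of_eq X k t (by rw [projConf_succ_none X k t h0])
          (by rw [projConf_succ_none X k t h0]) hbs (fun c l h => absurd h (h3 c l)) ?_⟩
        intro h1 _
        by_cases hb : Before k (loc X t i)
        · exact (hR.before hb).1
        · exact hR.after hb h2
      generalize hL : loc X t i = L at hm hw hev key
      generalize hL' : loc X (t + 1) i = L' at hm key
      cases hm with
      | idle _ h0 hmm =>
        exact key (by rw [hev, projStep, h0]) (by rw [hmm]) (by simp [h0]) (by simp [h0])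
      | announce r seq s cmd hmm => exact key hev (by rw [hmm]) (by simp) (by simp)
      | startRead r seq s cmd j js best hmm => exact key hev (by rw [hmm]) (by simp) (by simp)
      | startEnd r seq s cmd best hmm => exact key hev (by rw [hmm]) (by simp) (by simp)
      | helpNew r seq s cmd j js found d h1 h2 hmm => exact key hev (by rw [hmm]) (by simp) (by simp)
      | helpSkip r seq s cmd j js found h1 hmm => exact key hev (by rw [hmm]) (by simp) (by simp)
      | record r seq s cmd hmm => exact key hev (by rw [hmm]) (by simp) (by simp)
      | checkRead r seq s cmd j js best hmm => exact key hev (by rw [hmm]) (by simp) (by simp)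
      | checkRet r seq s cmd best h hmm => exact key hev (by rw [hmm]) (by simp) (by simp)
      | checkLoop r seq s cmd best h hmm => exact key hev (by rw [hmm]) (by simp) (by simp)
      | helpEnd r seq s cmd found hmm =>
        by_cases hr : r = k
        · subst hr
          have hev' : projEv X r t = some (.invoke i (s * Trace.mk _ (arr i found))) := by
            rw [hev, projStep]; simp
          have hb : Before r (loc X t i) := by
            rw [hL]; exact .inr ⟨rfl, _, _, _, rfl⟩
          have h1 := (hR.before hb).2
          rw [projConf_succ_some X r t hev']
          refine ⟨by rw [hmm]; exact ihm, ⟨fun hb' => ?_, fun c l hc => ?_, fun _ h2 => ?_⟩⟩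
          · rw [hL'] at hb'
            simp [Before] at hb'
          · rw [hL'] at hc
            rw [projConf_succ_some X r t hev']
            simp only [Phase.propose.injEq, heq_eq_eq, true_and] at hc
            simp [Implementation.Config.after, h1, hc.2]
          · rw [hL'] at h2
            exact absurd rfl (h2 _ _)
        · exact key (by rw [hev, projStep]; simp [hr]) (by rw [hmm]) (by simp) (by
            intro c l h
            simp only [Phase.propose.injEq] at h
            exact hr h.2.1)
      | propStep r seq s cmd k' l hn h1 h2 h3 h4 =>
        by_cases hk : k' = k
        · subst hk
          have hev' : projEv X k' t = some (.step i) := by rw [hev, projStep]; simp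
          obtain ⟨hp, hl⟩ := hR.during cmd l (by rw [hL])
          obtain ⟨e1, e2, e3⟩ := (projConf X k' t).after_step i
          rw [hl] at e1 e2 e3
          have e3' : ((projConf X k' t).after (.step i)).pend = (projConf X k' t).pend := by
            rw [e3]
            split
            · next h => exact absurd h (hn _ _)
            · rfl
          rw [projConf_succ_some X k' t hev']
          refine ⟨by rw [e1, h3, ihm], ⟨fun hb' => ?_, fun c l' hc => ?_, fun _ h2 => ?_⟩⟩
          · have hb := hbs hb'
            exact absurd (hR.before hb).1 hp
          · rw [hL'] at hc
            rw [projConf_succ_some X k' t hev', e3', e2]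
            simp only [Phase.propose.injEq, heq_eq_eq, true_and] at hc
            refine ⟨hp, ?_⟩
            rw [Function.update_self, ihm]
            exact hc.2
          · rw [hL'] at h2
            exact absurd rfl (h2 _ _)
        · exact key (by rw [hev, projStep]; simp [hk]) (h4 k (Ne.symm hk)) (by simp [hk])
            (by simp [hk])
      | propRet r seq s cmd k' l l' x c hn hmm =>
        have h3 : ∀ (c' : Cmd n O) l, (if c = true then (.record cmd : Phase A G) else
            .check cmd (List.finRange n) (0, 1)) ≠ .propose c' k l := by
          intro c' l
          split_ifs <;> simp
        by_cases hk : k' = k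
        · subst hk
          have hev' : projEv X k' t = some (.step i) := by rw [hev, projStep]; simp
          obtain ⟨hp, hl⟩ := hR.during cmd l (by rw [hL])
          obtain ⟨e1, e2, e3⟩ := (projConf X k' t).after_step i
          rw [hl] at e1 e2 e3
          rw [hn] at e3
          rw [projConf_succ_some X k' t hev']
          refine ⟨?_, ⟨fun hb' => ?_, fun c l' hc => ?_, fun _ h2 => ?_⟩⟩
          · rw [e1, Implementation.effect, hn, hmm]
            exact ihm
          · have hb := hbs hb'
            exact absurd (hR.before hb).1 hp
          · rw [hL'] at hc
            exact absurd hc (h3 _ _)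
          · rw [projConf_succ_some X k' t hev', e3]
            simp
        · exact key (by rw [hev, projStep]; simp [hk]) (by rw [hmm]) (by simp [hk]) h3

/-- The execution of `GCA_k` inside an execution of the construction. -/
noncomputable def proj : (G k).Execution where
  ev := projEv X k
  conf := projConf X k
  conf_zero := rfl
  conf_none t h := projConf_succ_none X k t h
  conf_some t e h := by
    refine ⟨?_, projConf_succ_some X k t h⟩
    obtain ⟨-, h2⟩ := projEv_eq_some X k t h
    have hR := (related_all X k t).2 e.proc
    rw [projStep] at h2
    split at h2
    · next c found hph =>
      split_ifs at h2 with hr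
      rw [← Option.some.inj h2]
      exact (hR.before (.inr ⟨hr, _, _, _, hph⟩)).1
    · next c k' l hph =>
      split_ifs at h2 with hr
      subst hr
      rw [← Option.some.inj h2]
      exact (hR.during c l hph).1
    · cases h2

variable {X k t}

theorem proj_invoke {i : Fin n} {s : A.CmdTrace n} :
    (proj X k).ev t = some (.invoke i s) ↔ X.ev t = some (.step i) ∧
      ∃ c found, (loc X t i).phase = .help c [] found ∧ (loc X t i).r = k ∧
        s = (loc X t i).s * Trace.mk _ (arr i found) := by
  constructor
  · intro h
    obtain ⟨h1, h2⟩ := projEv_eq_some X k t h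
    refine ⟨h1, ?_⟩
    simp only [Event.proc] at h2
    rw [projStep] at h2
    split at h2
    · next c found hph =>
      split_ifs at h2 with hr
      simp only [Option.some.injEq, Event.invoke.injEq, true_and] at h2
      exact ⟨c, found, hph, hr, h2.symm⟩
    · split_ifs at h2
      simp at h2
    · cases h2
  · rintro ⟨h1, c, found, h2, h3, rfl⟩
    have := projEv_of_step X k t h1
    rw [projStep, h2] at this
    simp only [h3, if_true] at this
    exact this

theorem proj_step_iff {i : Fin n} :
    (proj X k).ev t = some (.step i) ↔ X.ev t = some (.step i) ∧
      ∃ c l, (loc X t i).phase = .propose c k l := by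
  constructor
  · intro h
    obtain ⟨h1, h2⟩ := projEv_eq_some X k t h
    refine ⟨h1, ?_⟩
    simp only [Event.proc] at h2
    rw [projStep] at h2
    split at h2
    · split_ifs at h2
      simp at h2
    · next c k' l hph =>
      split_ifs at h2 with hr
      subst hr
      exact ⟨c, l, hph⟩
    · cases h2
  · rintro ⟨h1, c, l, h2⟩
    have := projEv_of_step X k t h1
    rw [projStep, h2] at this
    simp only [if_true] at this
    exact this

theorem proj_loc {i : Fin n} {c : Cmd n O} {l : (G k).Loc}
    (h : (loc X t i).phase = .propose c k l) : ((proj X k).conf t).loc i = l :=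
  (((related_all X k t).2 i).during c l h).2

theorem proj_pend {i : Fin n} {c : Cmd n O} {l : (G k).Loc}
    (h : (loc X t i).phase = .propose c k l) : ((proj X k).conf t).pend i ≠ none :=
  (((related_all X k t).2 i).during c l h).1

theorem before_of_proj_invoke {i : Fin n} {s : A.CmdTrace n}
    (h : (proj X k).ev t = some (.invoke i s)) :
    Before k (loc X t i) ∧ ¬ Before k (loc X (t + 1) i) := by
  obtain ⟨h1, c, found, h2, h3, -⟩ := proj_invoke.1 h
  refine ⟨.inr ⟨h3, _, _, _, h2⟩, fun hb => ?_⟩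
  have hp := (proj X k).pend_of_invoke h
  have := ((related_all X k (t + 1)).2 i).before hb
  rw [show (projConf X k (t + 1)).pend i = some s from hp.2] at this
  cases this.1

/-- Proposing in round `k` leaves the states `Before k`, and these are never reached again. -/
theorem proj_oneShot : (proj X k).OneShot := by
  intro t t' i o o' h h'
  obtain ⟨h1, h2⟩ := before_of_proj_invoke h
  obtain ⟨h1', h2'⟩ := before_of_proj_invoke h'
  rcases lt_trichotomy t t' with hlt | rfl | hlt
  · exact absurd (before_anti hlt h1') h2
  · rfl
  · exact absurd (before_anti hlt h1) h2'

end Helping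

/-! ### Safety of the construction -/

namespace Helping

variable {n : ℕ} {Q : Type v} {O : Type u} {R : Type w}
variable {A : SeqObject Q O R} {G : ℕ → Implementation.{u} n (A.CmdTrace n) (A.CmdTrace n × Bool)}
  {arr : Fin n → Finset (Cmd n O) → List (Cmd n O)}

theorem Move.S_cases {i : Fin n} {m m' : Mem A G} {L L' : Local A G} {y : Option R}
    (h : Move A G arr i m m' L L' y) : m'.S = m.S ∨
      ∃ c, L.phase = .record c ∧ m'.S = Function.update m.S i (L.r, L.s) := by
  cases h with
  | record r seq s cmd hm => exact .inr ⟨cmd, rfl, by rw [hm]⟩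
  | announce r seq s cmd hm => exact .inl (by rw [hm])
  | propStep _ _ _ _ _ _ _ _ h => exact .inl h
  | _ => simp_all

theorem Move.M_cases {i : Fin n} {m m' : Mem A G} {L L' : Local A G} {y : Option R}
    (h : Move A G arr i m m' L L' y) : m'.M = m.M ∨
      ∃ c b, L.phase = .announce c ∧ m'.M = Function.update m.M i (some c) ∧
        L'.phase = .start c (List.finRange n) b := by
  cases h with
  | announce r seq s cmd hm => exact .inr ⟨cmd, _, rfl, by rw [hm], rfl⟩
  | propStep _ _ _ _ _ _ _ h => exact .inl h
  | _ => simp_all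

theorem Move.not_announce {i : Fin n} {m m' : Mem A G} {L L' : Local A G} {y : Option R}
    (h : Move A G arr i m m' L L' y) (c : Cmd n O) : L'.phase ≠ .announce c := by
  cases h with
  | propRet r seq s cmd k l l' x b => cases b <;> simp
  | _ => simp_all

section

variable (X : (construction A G arr).Execution) (t : ℕ)

theorem S_succ (j : Fin n) : (mem X (t + 1)).S j = (mem X t).S j ∨
    X.ev t = some (.step j) ∧ (∃ c, (loc X t j).phase = .record c) ∧
      (mem X (t + 1)).S j = ((loc X t j).r, (loc X t j).s) := by
  by_cases h : ∃ i, X.ev t = some (.step i)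
  · obtain ⟨i, hi⟩ := h
    obtain ⟨y, hm, -⟩ := move_of_step hi
    rcases hm.S_cases with hS | ⟨c, hc, hS⟩
    · exact .inl (by rw [hS])
    · by_cases hj : j = i
      · subst hj
        exact .inr ⟨hi, ⟨c, hc⟩, by rw [hS, Function.update_self]⟩
      · exact .inl (by rw [hS, Function.update_of_ne hj])
  · push Not at h
    exact .inl (by rw [mem_of_not_step X t h])

theorem M_succ (j : Fin n) : (mem X (t + 1)).M j = (mem X t).M j ∨
    X.ev t = some (.step j) ∧ ∃ c b, (loc X t j).phase = .announce c ∧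
      (mem X (t + 1)).M j = some c ∧ (loc X (t + 1) j).phase = .start c (List.finRange n) b := by
  by_cases h : ∃ i, X.ev t = some (.step i)
  · obtain ⟨i, hi⟩ := h
    obtain ⟨y, hm, -⟩ := move_of_step hi
    rcases hm.M_cases with hS | ⟨c, b, hc, hS, hb⟩
    · exact .inl (by rw [hS])
    · by_cases hj : j = i
      · subst hj
        exact .inr ⟨hi, c, b, hc, by rw [hS, Function.update_self], hb⟩
      · exact .inl (by rw [hS, Function.update_of_ne hj])
  · push Not at h
    exact .inl (by rw [mem_of_not_step X t h])

theorem cmd_of_phase {t : ℕ} {i : Fin n} {c : Cmd n O} (h : (loc X t i).phase.cmd = some c) :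
    c.proc = i ∧ c.seq = (loc X t i).seq ∧ pend X t i = some c.op := by
  rw [cmd_eq, Option.map_eq_some_iff] at h
  obtain ⟨o, ho, rfl⟩ := h
  exact ⟨rfl, rfl, ho⟩

theorem proc_of_M {j : Fin n} {c : Cmd n O} (h : (mem X t).M j = some c) : c.proc = j := by
  induction t with
  | zero => rw [mem_zero] at h; cases h
  | succ t ih =>
    rcases M_succ X t j with h' | ⟨-, c', b, h1, h2, -⟩
    · exact ih (h' ▸ h)
    · rw [h2] at h
      cases h
      exact (cmd_of_phase X (by rw [h1]; rfl)).1

/-- The candidate that a process has found in `S` at the end of the loop. -/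
theorem check_best {i : Fin n} {c : Cmd n O} {todo : List (Fin n)} {b : ℕ × A.CmdTrace n}
    (h : (loc X t i).phase = .check c todo b) :
    b = (0, 1) ∨ ∃ t' ≤ t, ∃ j, b = (mem X t').S j := by
  induction t generalizing c todo b with
  | zero => rw [loc_zero] at h; cases h
  | succ t ih =>
    have lift : (b = (0, 1) ∨ ∃ t' ≤ t, ∃ j, b = (mem X t').S j) →
        b = (0, 1) ∨ ∃ t' ≤ t + 1, ∃ j, b = (mem X t').S j :=
      Or.imp_right fun ⟨t', ht, hh⟩ => ⟨t', ht.trans t.le_succ, hh⟩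
    cases trans_cases X t i with
    | other _ h' => exact lift (ih (h' ▸ h))
    | inv o _ _ _ h' => rw [h'] at h; cases h
    | step y _ hm =>
      generalize hL : loc X t i = L at hm
      generalize loc X (t + 1) i = L' at hm h
      cases hm with
      | idle L h0 => rw [h0] at h; cases h
      | propRet r seq s cmd k l l' x b =>
        cases b
        · simp only [Bool.false_eq_true, if_false, Phase.check.injEq] at h
          exact .inl h.2.2.symm
        · simp at h
      | record r seq s cmd =>
        simp only [Phase.check.injEq] at h
        exact .inl h.2.2.symm
      | checkRead r seq s cmd j js best =>
        simp only [Phase.check.injEq] at h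
        obtain ⟨-, -, rfl⟩ := h
        rcases later_eq best ((mem X t).S j) with h | h
        · rw [h] at lift ⊢
          exact lift (ih (by rw [hL]))
        · rw [h]
          exact .inr ⟨t, t.le_succ, j, rfl⟩
      | _ => simp at h

end

theorem returned_of_step {X : (construction A G arr).Execution} {t k : ℕ} {i : Fin n} {c : Cmd n O}
    {l l' : (G k).Loc} {y : A.CmdTrace n × Bool} (h : X.ev t = some (.step i))
    (hp : (loc X t i).phase = .propose c k l) (hn : (G k).next i l = .ret y l') :
    (proj X k).ev t = some (.step i) ∧ (G k).next i (((proj X k).conf t).loc i) = .ret y l' :=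
  ⟨proj_step_iff.2 ⟨h, c, l, hp⟩, by rw [proj_loc hp, hn]⟩

/-! #### Rounds and traces -/

/-- `x` is an output of round `k`; the empty trace for round `0`. -/
def OutPair (X : (construction A G arr).Execution) (k : ℕ) (x : A.CmdTrace n) : Prop :=
  k = 0 ∧ x = 1 ∨ 0 < k ∧ ∃ i c, (proj X k).Returned i (x, c)

/-- `x` is committed in round `k`; the empty trace for round `0`. -/
def ComPair (X : (construction A G arr).Execution) (k : ℕ) (x : A.CmdTrace n) : Prop :=
  k = 0 ∧ x = 1 ∨ 0 < k ∧ ∃ i, (proj X k).Returned i (x, true)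

theorem ComPair.out {X : (construction A G arr).Execution} {k : ℕ} {x : A.CmdTrace n}
    (h : ComPair X k x) : OutPair X k x :=
  h.imp_right fun ⟨h0, i, hi⟩ => ⟨h0, i, true, hi⟩

/-- What the variables `r` and `s` of a process hold. -/
def PairOK (X : (construction A G arr).Execution) (L : Local A G) : Prop :=
  match L.phase with
  | .start _ _ best => OutPair X L.r L.s ∧ OutPair X best.1 best.2
  | .help _ _ _ => ∃ k, L.r = k + 1 ∧ OutPair X k L.s
  | .propose _ _ _ => True
  | .record _ => ComPair X L.r L.s
  | _ => OutPair X L.r L.s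

/-- Pairs in `S` were committed in their round, and outside the loop body `(r, s)` is an output of
round `r`. While commands are collected `r` is already increased, so that `s` is an output of round
`r - 1`; this links consecutive rounds. -/
theorem pairOK (X : (construction A G arr).Execution) (t : ℕ) :
    (∀ j, ComPair X ((mem X t).S j).1 ((mem X t).S j).2) ∧ ∀ i, PairOK X (loc X t i) := by
  induction t with
  | zero =>
    refine ⟨fun j => ?_, fun i => ?_⟩
    · rw [mem_zero]; exact .inl ⟨rfl, rfl⟩
    · rw [loc_zero]; exact .inl ⟨rfl, rfl⟩
  | succ t ih =>
    obtain ⟨ihS, ih⟩ := ih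
    refine ⟨fun j => ?_, fun i => ?_⟩
    · rcases S_succ X t j with h | ⟨-, ⟨c, hc⟩, h⟩
      · rw [h]; exact ihS j
      · rw [h]
        have := ih j
        rw [PairOK, hc] at this
        exact this
    · have ih := ih i
      cases trans_cases X t i with
      | other _ h => rw [h]; exact ih
      | inv o _ hp _ h =>
        have hc := cmd_eq X t i
        rw [hp] at hc
        have h0 : (loc X t i).phase = .idle := by
          cases hph : (loc X t i).phase with
          | idle => rfl
          | _ => rw [hph] at hc; cases hc
        rw [h]
        rw [PairOK, h0] at ih
        exact ih
      | step y he hm =>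
        have hw := wf X t i
        generalize hL : loc X t i = L at hm ih hw
        generalize loc X (t + 1) i = L' at hm
        cases hm with
        | idle => exact ih
        | announce r seq s cmd => exact ⟨ih, ih⟩
        | startRead r seq s cmd j js best =>
          refine ⟨ih.1, ?_⟩
          rcases later_eq best ((mem X t).S j) with h | h
          · rw [h]; exact ih.2
          · rw [h]; exact (ihS j).out
        | startEnd r seq s cmd best => exact ⟨best.1, rfl, ih.2⟩
        | helpNew => exact ih
        | helpSkip => exact ih
        | helpEnd => trivial
        | propStep => trivial
        | propRet r seq s cmd k l l' x c hn =>
          obtain ⟨h1, h2⟩ := returned_of_step he (by rw [hL]) hn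
          simp only [Local.WF] at hw
          obtain ⟨rfl, hk⟩ := hw
          cases c with
          | false => exact .inr ⟨hk, i, false, t, l', h1, h2⟩
          | true => exact .inr ⟨hk, i, t, l', h1, h2⟩
        | record => exact ComPair.out ih
        | checkRead => exact ih
        | checkRet => exact ih
        | checkLoop r seq s cmd best => exact ⟨r, rfl, ih⟩

theorem exists_out_le_input {X : (construction A G arr).Execution} {k : ℕ} {i : Fin n}
    {s : A.CmdTrace n} (h : (proj X k).Invoked i s) :
    ∃ k' x, k = k' + 1 ∧ OutPair X k' x ∧ x ≤ s := by
  obtain ⟨t, ht⟩ := h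
  obtain ⟨-, c, found, h2, rfl, rfl⟩ := proj_invoke.1 ht
  have := (pairOK X t).2 i
  rw [PairOK, h2] at this
  obtain ⟨k, hk, ho⟩ := this
  exact ⟨k, _, hk, ho, Trace.le_mul _ _⟩

section Safety

variable (hG : ∀ k, IsGCA (G k))

include hG

/-- A common prefix of the inputs is a prefix of the outputs, for one round of the construction. -/
theorem le_output (X : (construction A G arr).Execution) {k : ℕ} (hk : 0 < k) {x e : A.CmdTrace n}
    (h : OutPair X k x) (he : ∀ j s, (proj X k).Invoked j s → e ≤ s) : e ≤ x := by
  rcases h with ⟨rfl, -⟩ | ⟨-, i, c, h⟩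
  · cases hk
  · exact (hG k).common_prefix _ proj_oneShot e he i x c h

/-- Adoption gives the claim in the round of the commit. All inputs of the next round extend outputs
of this one, hence `x`, and the common prefix property passes `x` on to the outputs of the next
round. -/
theorem com_le_out (X : (construction A G arr).Execution) {k k' : ℕ} {x x' : A.CmdTrace n}
    (h : ComPair X k x) (h' : OutPair X k' x') (hk : k ≤ k') : x ≤ x' := by
  induction k', hk using Nat.le_induction generalizing x' with
  | base =>
    rcases h with ⟨-, rfl⟩ | ⟨h0, i, h⟩
    · exact Trace.one_le _
    · rcases h' with ⟨rfl, -⟩ | ⟨-, j, c, h'⟩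
      · cases h0
      · exact (hG k).adoption _ proj_oneShot i x h j x' c h'
  | succ k' _ ih =>
    refine le_output hG X k'.succ_pos h' fun j s hs => ?_
    obtain ⟨k'', x'', hk, ho, hle⟩ := exists_out_le_input hs
    obtain rfl : k' = k'' := by omega
    exact (ih ho).trans hle

theorem com_le_input (X : (construction A G arr).Execution) {k k' : ℕ} {x s : A.CmdTrace n}
    {i : Fin n} (h : ComPair X k x) (h' : (proj X k').Invoked i s) (hk : k < k') : x ≤ s := by
  obtain ⟨k'', x'', rfl, ho, hle⟩ := exists_out_le_input h'
  exact (com_le_out hG X h ho (by omega)).trans hle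

theorem com_unique (X : (construction A G arr).Execution) {k : ℕ} {x x' : A.CmdTrace n}
    (h : ComPair X k x) (h' : ComPair X k x') : x = x' :=
  le_antisymm (com_le_out hG X h h'.out le_rfl) (com_le_out hG X h' h.out le_rfl)

end Safety

/-! #### Announced commands -/

/-- The command `c` has been announced by time `t`. -/
def Announced (X : (construction A G arr).Execution) (t : ℕ) (c : Cmd n O) : Prop :=
  ∃ t' ≤ t, (mem X t').M c.proc = some c

/-- The command `c` has been recorded in `S` by time `t`. -/
def Recorded (X : (construction A G arr).Execution) (t : ℕ) (c : Cmd n O) : Prop :=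
  ∃ t' ≤ t, ∃ j, c ∈ ((mem X t').S j).2.ops

/-- The command `c` is announced and pending at time `t`. -/
def PendingAt (X : (construction A G arr).Execution) (t : ℕ) (c : Cmd n O) : Prop :=
  (loc X t c.proc).phase.cmd = some c ∧ ∀ c', (loc X t c.proc).phase ≠ .announce c'

theorem Announced.mono {X : (construction A G arr).Execution} {t t' : ℕ} {c : Cmd n O}
    (h : Announced X t c) (ht : t ≤ t') : Announced X t' c :=
  h.imp fun _ ⟨h1, h2⟩ => ⟨h1.trans ht, h2⟩

theorem Recorded.mono {X : (construction A G arr).Execution} {t t' : ℕ} {c : Cmd n O}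
    (h : Recorded X t c) (ht : t ≤ t') : Recorded X t' c :=
  h.imp fun _ ⟨h1, h2⟩ => ⟨h1.trans ht, h2⟩

theorem announced_succ {X : (construction A G arr).Execution} {t : ℕ} {c : Cmd n O}
    (h : Announced X (t + 1) c) : Announced X t c ∨ PendingAt X (t + 1) c := by
  obtain ⟨t', ht', hM⟩ := h
  rcases Nat.lt_or_ge t t' with hlt | hle
  · obtain rfl : t' = t + 1 := by omega
    rcases M_succ X t c.proc with h' | ⟨-, c', b, -, h2, h3⟩
    · exact .inl ⟨t, le_rfl, h' ▸ hM⟩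
    · rw [h2] at hM
      cases hM
      exact .inr ⟨by rw [h3]; rfl, by simp [h3]⟩
  · exact .inl ⟨t', hle, hM⟩

/-- A process that returns has found its command in `S`. -/
theorem pendingAt_succ {X : (construction A G arr).Execution} {t : ℕ} {c : Cmd n O}
    (h : PendingAt X t c) : Recorded X t c ∨ PendingAt X (t + 1) c := by
  obtain ⟨h1, h2⟩ := h
  cases trans_cases X t c.proc with
  | other _ h => exact .inr (by rw [PendingAt, h]; exact ⟨h1, h2⟩)
  | inv o _ hp =>
    rw [cmd_eq, hp] at h1
    cases h1
  | step y _ hm =>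
    cases y with
    | none => exact .inr ⟨by rw [hm.cmd_eq]; simpa using h1, hm.not_announce⟩
    | some y =>
      left
      generalize hL : loc X t c.proc = L at hm h1
      generalize loc X (t + 1) c.proc = L' at hm
      cases hm with
      | checkRet r seq s cmd best hb =>
        simp only [Phase.cmd, Option.some.injEq] at h1
        subst h1
        rcases check_best X t (by rw [hL]) with rfl | ⟨t', ht', j, rfl⟩
        · simp at hb
        · exact ⟨t', ht', j, hb⟩

/-- A command stays pending from its announcement to its response, and its process responds only
after reading it in a record. -/
theorem recorded_or_pending {X : (construction A G arr).Execution} {t : ℕ} {c : Cmd n O}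
    (h : Announced X t c) : Recorded X t c ∨ PendingAt X t c := by
  induction t with
  | zero =>
    obtain ⟨t', ht', hM⟩ := h
    obtain rfl : t' = 0 := by omega
    rw [mem_zero] at hM
    cases hM
  | succ t ih =>
    rcases announced_succ h with h | h
    · rcases ih h with h | h
      · exact .inl (h.mono t.le_succ)
      · exact (pendingAt_succ h).imp_left fun h => h.mono t.le_succ
    · exact .inr h

/-- `M[i]` is overwritten only when process `i` announces its next command, so helpers can read a
pending command throughout. -/
theorem M_of_pendingAt {X : (construction A G arr).Execution} {t : ℕ} {c : Cmd n O}
    (h : PendingAt X t c) : (mem X t).M c.proc = some c := by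
  induction t with
  | zero =>
    rw [PendingAt, loc_zero] at h
    cases h.1
  | succ t ih =>
    rcases M_succ X t c.proc with hM | ⟨-, c', b, -, h2, h3⟩
    · rw [hM]
      cases trans_cases X t c.proc with
      | other _ h' => exact ih (by rwa [PendingAt, h'] at h)
      | inv o _ _ _ h' =>
        rw [PendingAt, h'] at h
        exact absurd rfl (h.2 _)
      | step y he hm =>
        have h1 := h.1
        rw [hm.cmd_eq] at h1
        split_ifs at h1 with hy
        by_cases ha : ∀ c', (loc X t c.proc).phase ≠ .announce c'
        · exact ih ⟨h1, ha⟩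
        · push Not at ha
          obtain ⟨c', hc'⟩ := ha
          rw [hc'] at h1
          cases h1
          generalize loc X t c.proc = L at hm hc'
          generalize loc X (t + 1) c.proc = L' at hm
          cases hm with
          | announce r seq s cmd hmm =>
            simp only [Phase.announce.injEq] at hc'
            subst hc'
            rw [hmm] at hM
            simpa using hM.symm
          | _ => simp_all
    · have h1 := h.1
      rw [h3] at h1
      cases h1
      exact h2

/-- The operations of the trace are announced, and each occurs only once. -/
def TraceOK (X : (construction A G arr).Execution) (t : ℕ) (x : A.CmdTrace n) : Prop :=
  x.ops.Nodup ∧ ∀ c ∈ x.ops, Announced X t c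

theorem TraceOK.mono {X : (construction A G arr).Execution} {t t' : ℕ} {x : A.CmdTrace n}
    (h : TraceOK X t x) (ht : t ≤ t') : TraceOK X t' x :=
  ⟨h.1, fun c hc => (h.2 c hc).mono ht⟩

theorem traceOK_one (X : (construction A G arr).Execution) (t : ℕ) : TraceOK X t 1 := by
  simp [TraceOK]

/-- What holds for the traces and commands among the variables of a process. -/
def VarsOK (X : (construction A G arr).Execution) (t : ℕ) (L : Local A G) : Prop :=
  TraceOK X t L.s ∧ match L.phase with
    | .start _ _ best => TraceOK X t best.2
    | .help _ _ found => ∀ d ∈ found, d ∉ L.s.ops ∧ Announced X t d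
    | _ => True

theorem VarsOK.mono {X : (construction A G arr).Execution} {t t' : ℕ} {L : Local A G}
    (h : VarsOK X t L) (ht : t ≤ t') : VarsOK X t' L := by
  obtain ⟨h1, h2⟩ := h
  refine ⟨h1.mono ht, ?_⟩
  split
  · next h => rw [h] at h2; exact h2.mono ht
  · next h => rw [h] at h2; exact fun d hd => ⟨(h2 d hd).1, (h2 d hd).2.mono ht⟩
  · trivial

theorem TraceOK.help {X : (construction A G arr).Execution}
    (harr : ∀ i F, (arr i F : Multiset (Cmd n O)) = F.val) {t : ℕ} {i : Fin n} {s : A.CmdTrace n}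
    {found : Finset (Cmd n O)} (hs : TraceOK X t s)
    (hf : ∀ d ∈ found, d ∉ s.ops ∧ Announced X t d) :
    TraceOK X t (s * Trace.mk _ (arr i found)) := by
  constructor
  · rw [Trace.ops_mul, Trace.ops_mk, harr, Multiset.nodup_add]
    refine ⟨hs.1, found.nodup, ?_⟩
    rw [Multiset.disjoint_left]
    exact fun hd hd' => (hf _ hd').1 hd
  · intro c hc
    rw [Trace.ops_mul, Trace.ops_mk, harr, Multiset.mem_add] at hc
    rcases hc with hc | hc
    · exact hs.2 c hc
    · exact (hf c hc).2

section TraceOK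

variable (hG : ∀ k, IsGCA (G k)) (harr : ∀ i F, (arr i F : Multiset (Cmd n O)) = F.val)

include hG harr

-- Collected commands are announced, missing in `s` and listed once, so inputs have no repetitions.
-- Validity bounds the multiplicities of an output by those of single inputs, which carries both
-- properties through a round.
open Classical in
theorem traceOK (X : (construction A G arr).Execution) (t : ℕ) :
    (∀ j, TraceOK X t ((mem X t).S j).2) ∧ (∀ i, VarsOK X t (loc X t i)) ∧
      ∀ k i s, ∀ t' < t, (proj X k).ev t' = some (.invoke i s) → TraceOK X t s := by
  induction t with
  | zero =>
    refine ⟨fun j => ?_, fun i => ?_, fun k i s t' ht' => absurd ht' (by omega)⟩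
    · rw [mem_zero]; exact traceOK_one X 0
    · rw [loc_zero]; exact ⟨traceOK_one X 0, trivial⟩
  | succ t ih =>
    obtain ⟨ihS, ih, ihI⟩ := ih
    refine ⟨fun j => ?_, fun i => ?_, fun k i s t' ht' he => ?_⟩
    · rcases S_succ X t j with h | ⟨-, ⟨c, hc⟩, h⟩
      · rw [h]; exact (ihS j).mono t.le_succ
      · rw [h]; exact (ih j).1.mono t.le_succ
    · cases trans_cases X t i with
      | other _ h => rw [h]; exact (ih i).mono t.le_succ
      | inv o _ hp _ h => rw [h]; exact ⟨(ih i).1.mono t.le_succ, trivial⟩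
      | step y he hm =>
        have ih0 := ih i
        have ih := (ih i).mono t.le_succ
        generalize hL : loc X t i = L at hm ih ih0
        generalize loc X (t + 1) i = L' at hm
        cases hm with
        | idle => exact ih
        | announce r seq s cmd => exact ⟨ih.1, ih.1⟩
        | startRead r seq s cmd j js best =>
          refine ⟨ih.1, ?_⟩
          rcases later_eq best ((mem X t).S j) with h | h
          · simp only [h]; exact ih.2
          · simp only [h]; exact (ihS j).mono t.le_succ
        | startEnd r seq s cmd best => exact ⟨ih.2, by simp⟩
        | helpNew r seq s cmd j js found d h1 h2 =>
          refine ⟨ih.1, fun d' hd' => ?_⟩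
          rcases Finset.mem_insert.1 hd' with rfl | hd'
          · refine ⟨h2, t, t.le_succ, ?_⟩
            rw [proc_of_M X t h1]
            exact h1
          · exact ih.2 d' hd'
        | helpSkip => exact ih
        | helpEnd r seq s cmd found => exact ⟨ih.1.help harr ih.2, trivial⟩
        | propStep => exact ih
        | propRet r seq s cmd k l l' x c hn =>
          obtain ⟨h1, h2⟩ := returned_of_step he (by rw [hL]) hn
          have hx : TraceOK X (t + 1) x := by
            have hval := (hG k).validity _ ((proj X k).trunc_oneShot (T := t + 1) proj_oneShot)
              i x c ((proj X k).trunc_returned t.lt_succ_self h1 h2)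
            have hval' : ∀ o ∈ x.ops, ∃ s, TraceOK X t s ∧ x.ops.count o ≤ s.ops.count o := by
              intro o ho
              obtain ⟨j, s, ⟨t', ht'⟩, hle⟩ := hval o ho
              obtain ⟨hlt, hev⟩ := (proj X k).trunc_ev.1 ht'
              refine ⟨s, ihI k j s t' ?_ hev, by convert hle⟩
              rcases Nat.lt_succ_iff_lt_or_eq.1 hlt with h | rfl
              · exact h
              · rw [h1] at hev; cases hev
            refine ⟨Multiset.nodup_iff_count_le_one.2 fun o => ?_, fun o ho => ?_⟩
            · by_cases ho : o ∈ x.ops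
              · obtain ⟨s, hs, hle⟩ := hval' o ho
                exact hle.trans (Multiset.nodup_iff_count_le_one.1 hs.1 o)
              · rw [Multiset.count_eq_zero.2 ho]
                omega
            · obtain ⟨s, hs, hle⟩ := hval' o ho
              refine (hs.2 o (Multiset.count_pos.1 ?_)).mono t.le_succ
              exact (Multiset.count_pos.2 ho).trans_le hle
          cases c <;> exact ⟨hx, trivial⟩
        | record => exact ih
        | checkRead => exact ih
        | checkRet => exact ih
        | checkLoop r seq s cmd best => exact ⟨ih.1, by simp⟩
    · rcases Nat.lt_succ_iff_lt_or_eq.1 ht' with h | rfl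
      · exact (ihI k i s t' h he).mono t.le_succ
      · obtain ⟨-, c, found, h2, -, rfl⟩ := proj_invoke.1 he
        have := ih i
        rw [VarsOK, h2] at this
        exact (this.1.help harr this.2).mono (Nat.le_succ _)

theorem input_traceOK {X : (construction A G arr).Execution} {k t : ℕ} {i : Fin n}
    {s : A.CmdTrace n} (h : (proj X k).ev t = some (.invoke i s)) : TraceOK X (t + 1) s :=
  (traceOK hG harr X (t + 1)).2.2 k i s t t.lt_succ_self h

/-- What is recorded in a step was announced before. -/
theorem announced_of_S_succ {X : (construction A G arr).Execution} {t : ℕ} {j : Fin n}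
    {c : Cmd n O} (h : c ∈ ((mem X (t + 1)).S j).2.ops) : Announced X t c := by
  rcases S_succ X t j with h' | ⟨-, -, h'⟩
  · rw [h'] at h
    exact ((traceOK hG harr X t).1 j).2 c h
  · rw [h'] at h
    exact ((traceOK hG harr X t).2.1 j).1.2 c h

end TraceOK

end Helping

/-! ### Linearizability of the construction -/

namespace SeqObject

variable {n : ℕ} {Q : Type v} {O : Type u} {R : Type w} (A : SeqObject Q O R)

/-- The sequential history of a schedule of commands that is run from state `q`. -/
def run : Q → List (Cmd n O) → List (Fin n × O × R)
  | _, [] => []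
  | q, c :: W => (c.proc, c.op, (A.σ c.op q).1) :: run (A.σ c.op q).2 W

theorem legalFrom_run (q : Q) (W : List (Cmd n O)) : LegalFrom A q (A.run q W) := by
  induction W generalizing q with
  | nil => trivial
  | cons c W ih => exact ⟨rfl, ih _⟩

theorem run_prefix (q : Q) {W W' : List (Cmd n O)} (h : W <+: W') : A.run q W <+: A.run q W' := by
  obtain ⟨Z, rfl⟩ := h
  induction W generalizing q with
  | nil => exact List.nil_prefix
  | cons c W ih => exact List.cons_prefix_cons.2 ⟨rfl, ih _⟩

/-- Without repetitions the first occurrence of a command, which `retFrom` evaluates, is its only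
one. -/
theorem run_eq_map (q : Q) {W : List (Cmd n O)} (h : W.Nodup) :
    A.run q W = W.map fun c => (c.proc, c.op, (A.cmdObj n).retFrom c q W) := by
  induction W generalizing q with
  | nil => rfl
  | cons c W ih =>
    rw [List.nodup_cons] at h
    rw [run, List.map_cons, ih _ h.2]
    congr 1
    · simp only [retFrom, if_true]; rfl
    · refine List.map_congr_left fun d hd => ?_
      have : c ≠ d := fun e => h.1 (e ▸ hd)
      simp only [retFrom, if_neg this]; rfl

theorem entries_run (q : Q) {W : List (Cmd n O)} (h : W.Nodup) (i : Fin n) :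
    entries (A.run q W) i = (W.filter fun c => c.proc = i).map
      fun c => (c.proc, c.op, (A.cmdObj n).retFrom c q W) := by
  rw [run_eq_map A q h, entries, List.filter_map]
  rfl

end SeqObject

namespace Implementation

variable {n : ℕ} {O : Type v} {R : Type w} {I : Implementation.{u} n O R}

theorem Config.proc_of_mem_label {c : I.Config} {e : Event n O} {x : HEvent n O R}
    (h : x ∈ c.label e) : x.proc = e.proc := by
  cases e with
  | invoke i o =>
    simp only [label, List.mem_singleton] at h
    subst h; rfl
  | step i =>
    simp only [label] at h
    split at h
    · rw [List.mem_singleton] at h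
      subst h; rfl
    · cases h

theorem Execution.restrict_history_other (X : I.Execution) {t : ℕ} {i : Fin n}
    (h : ∀ e, X.ev t = some e → e.proc ≠ i) :
    restrict (X.history (t + 1)) i = restrict (X.history t) i := by
  rw [history, restrict_append]
  cases he : X.ev t with
  | none => simp [restrict]
  | some e =>
    have : restrict ((X.conf t).label e) i = [] := by
      rw [restrict, List.filter_eq_nil_iff]
      intro x hx
      rw [Config.proc_of_mem_label hx]
      simpa using h e he
    simp [this]

end Implementation

namespace Helping

variable {n : ℕ} {Q : Type v} {O : Type u} {R : Type w}
variable {A : SeqObject Q O R} {G : ℕ → Implementation.{u} n (A.CmdTrace n) (A.CmdTrace n × Bool)}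
  {arr : Fin n → Finset (Cmd n O) → List (Cmd n O)}

section

variable (X : (construction A G arr).Execution) (t : ℕ)

/-! #### The latest record -/

theorem exists_top : ∃ p : ℕ × A.CmdTrace n, (p = (0, 1) ∨ ∃ j, p = (mem X t).S j) ∧
    ∀ j, ((mem X t).S j).1 ≤ p.1 := by
  by_cases h : Nonempty (Fin n)
  · obtain ⟨j, -, hj⟩ := Finset.exists_max_image Finset.univ (fun j => ((mem X t).S j).1)
      Finset.univ_nonempty
    exact ⟨_, .inr ⟨j, rfl⟩, fun j' => hj j' (Finset.mem_univ _)⟩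
  · exact ⟨(0, 1), .inl rfl, fun j => absurd ⟨j⟩ h⟩

/-- A pair with the largest round in `S` at time `t`. -/
noncomputable def top : ℕ × A.CmdTrace n := (exists_top X t).choose

theorem top_cases : top X t = (0, 1) ∨ ∃ j, top X t = (mem X t).S j :=
  (exists_top X t).choose_spec.1

theorem S_le_top (j : Fin n) : ((mem X t).S j).1 ≤ (top X t).1 := (exists_top X t).choose_spec.2 j

theorem top_com : ComPair X (top X t).1 (top X t).2 := by
  rcases top_cases X t with h | ⟨j, h⟩
  · rw [h]; exact .inl ⟨rfl, rfl⟩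
  · rw [h]; exact (pairOK X t).1 j

/-- What is written to `S[j]` is the current round, which never decreases. Hence overwriting never
lowers a recorded round, and the largest recorded round is monotone in time. -/
theorem S_le_r (j : Fin n) : ((mem X t).S j).1 ≤ (loc X t j).r := by
  induction t with
  | zero => rw [mem_zero, loc_zero]
  | succ t ih =>
    refine le_trans ?_ (r_le_succ X t j)
    rcases S_succ X t j with h | ⟨-, -, h⟩
    · rwa [h]
    · rw [h]

theorem S_le_succ (j : Fin n) : ((mem X t).S j).1 ≤ ((mem X (t + 1)).S j).1 := by
  rcases S_succ X t j with h | ⟨-, -, h⟩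
  · rw [h]
  · rw [h]; exact S_le_r X t j

theorem top_le_succ : (top X t).1 ≤ (top X (t + 1)).1 := by
  rcases top_cases X t with h | ⟨j, h⟩
  · rw [h]; exact Nat.zero_le _
  · rw [h]; exact (S_le_succ X t j).trans (S_le_top X (t + 1) j)

variable {X} in
theorem top_mono {t t' : ℕ} (h : t ≤ t') : (top X t).1 ≤ (top X t').1 :=
  monotone_nat_of_le_succ (f := fun t => (top X t).1) (top_le_succ X) h

theorem top_zero : (top X 0).2 = 1 := by
  rcases top_cases X 0 with h | ⟨j, h⟩
  · rw [h]
  · rw [h, mem_zero]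

theorem seq_le_succ (i : Fin n) : (loc X t i).seq ≤ (loc X (t + 1) i).seq := by
  cases trans_cases X t i with
  | other _ h => rw [h]
  | inv o _ _ _ h => rw [h]; exact Nat.le_succ _
  | step y _ h => exact h.seq_eq.ge

theorem seq_le_of_M {j : Fin n} {c : Cmd n O} (h : (mem X t).M j = some c) :
    c.seq ≤ (loc X t j).seq := by
  induction t with
  | zero => rw [mem_zero] at h; cases h
  | succ t ih =>
    refine le_trans ?_ (seq_le_succ X t j)
    rcases M_succ X t j with h' | ⟨-, c', b, h1, h2, -⟩
    · exact ih (h' ▸ h)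
    · rw [h2] at h
      cases h
      exact (cmd_of_phase X (by rw [h1]; rfl)).2.1.le

variable {X t} in
theorem Announced.seq_le {c : Cmd n O} (h : Announced X t c) :
    c.seq ≤ (loc X t c.proc).seq := by
  obtain ⟨t', ht, h⟩ := h
  exact (seq_le_of_M X t' h).trans
    (monotone_nat_of_le_succ (f := fun t => (loc X t c.proc).seq)
      (fun t => seq_le_succ X t c.proc) ht)

end

section

variable (hG : ∀ k, IsGCA (G k))

include hG

theorem top_trace_mono {X : (construction A G arr).Execution} {t t' : ℕ} (h : t ≤ t') :
    (top X t).2 ≤ (top X t').2 :=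
  com_le_out hG X (top_com X t) (top_com X t').out (top_mono h)

theorem S_trace_le_top {X : (construction A G arr).Execution} {t t' : ℕ} (h : t ≤ t')
    (j : Fin n) : ((mem X t).S j).2 ≤ (top X t').2 :=
  (com_le_out hG X ((pairOK X t).1 j) (top_com X t).out (S_le_top X t j)).trans
    (top_trace_mono hG h)

/-- Records may be overwritten, but all earlier ones are prefixes of the latest, so no recorded
command is lost. -/
theorem recorded_iff {X : (construction A G arr).Execution} {t : ℕ} {c : Cmd n O} :
    Recorded X t c ↔ c ∈ (top X t).2.ops := by
  constructor
  · rintro ⟨t', ht, j, h⟩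
    exact Multiset.mem_of_le (Trace.ops_le (S_trace_le_top hG ht j)) h
  · intro h
    rcases top_cases X t with h' | ⟨j, h'⟩
    · rw [h'] at h
      simp at h
    · rw [h'] at h
      exact ⟨t, le_rfl, j, h⟩

end

/-- The events `h` of process `i`, whose command is `p`, correspond to the schedule `W`. -/
def Served (A : SeqObject Q O R) (W : List (Cmd n O)) (i : Fin n) (p : Option (Cmd n O))
    (h : List (HEvent n O R)) : Prop :=
  (p = none ∧ h = seqHistory (entries (A.run A.q0 W) i)) ∨
    ∃ c, p = some c ∧ c.proc = i ∧
      (c ∉ W ∧ h = seqHistory (entries (A.run A.q0 W) i) ++ [.inv i c.op] ∨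
        c ∈ W ∧ h ++ [.res i ((A.cmdObj n).retFrom c A.q0 W)] =
          seqHistory (entries (A.run A.q0 W) i))

/-- The only command of `i` that can be added is its pending one. If it is added, the unserved
pending operation becomes a served one; otherwise the entries of `i` and their responses stay the
same. -/
theorem Served.extend {W Z : List (Cmd n O)} {i : Fin n} {p : Option (Cmd n O)}
    {h : List (HEvent n O R)} (hs : Served A W i p h) (hn : (W ++ Z).Nodup)
    (hZ : ∀ d ∈ Z, d.proc = i → p = some d) : Served A (W ++ Z) i p h := by
  classical
  have hW : W.Nodup := hn.of_append_left
  have key : entries (A.run A.q0 (W ++ Z)) i = entries (A.run A.q0 W) i ++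
      (Z.filter fun c => c.proc = i).map
        fun c => (c.proc, c.op, (A.cmdObj n).retFrom c A.q0 (W ++ Z)) := by
    rw [A.entries_run _ hn, A.entries_run _ hW, List.filter_append, List.map_append]
    congr 1
    refine List.map_congr_left fun c hc => ?_
    rw [SeqObject.retFrom_append _ (List.mem_of_mem_filter hc)]
  rcases hs with ⟨rfl, rfl⟩ | ⟨c, rfl, rfl, hs⟩
  · left
    have : (Z.filter fun c => c.proc = i) = [] := by
      rw [List.filter_eq_nil_iff]
      intro d hd hi
      cases hZ d hd (by simpa using hi)
    exact ⟨rfl, by rw [key, this]; simp⟩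
  · refine .inr ⟨c, rfl, rfl, ?_⟩
    by_cases hc : c ∈ Z
    · obtain ⟨hcW, rfl⟩ := hs.resolve_right fun h =>
        List.disjoint_of_nodup_append hn h.1 hc
      have : (Z.filter fun d => d.proc = c.proc) = [c] := by
        refine List.perm_singleton.1 ((List.perm_ext_iff_of_nodup
          (hn.of_append_right.filter _) (List.nodup_singleton c)).2 fun d => ?_)
        simp only [List.mem_filter, decide_eq_true_eq, List.mem_singleton]
        constructor
        · rintro ⟨hd, hi⟩
          exact (Option.some.inj (hZ d hd hi)).symm
        · rintro rfl
          exact ⟨hc, rfl⟩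
      refine .inr ⟨List.mem_append_right _ hc, ?_⟩
      rw [key, this, seqHistory_append]
      simp [seqHistory]
    · have : (Z.filter fun d => d.proc = c.proc) = [] := by
        rw [List.filter_eq_nil_iff]
        intro d hd hi
        obtain rfl := Option.some.inj (hZ d hd (by simpa using hi))
        exact hc hd
      rcases hs with ⟨hcW, rfl⟩ | ⟨hcW, hs⟩
      · exact .inl ⟨by simp [hcW, hc], by rw [key, this]; simp⟩
      · refine .inr ⟨List.mem_append_left _ hcW, ?_⟩
        rw [key, this, SeqObject.retFrom_append _ hcW, hs]
        simp

/-- `W t` represents the latest record at time `t`, and each `W t` is a prefix of `W (t + 1)`.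
Running the object on `W t` gives the sequential histories required by `linearizable_of_matches`. -/
theorem linearizable (hG : ∀ k, IsGCA (G k))
    (harr : ∀ i F, (arr i F : Multiset (Cmd n O)) = F.val) :
    (construction A G arr).Linearizable A := by
  intro X T
  obtain ⟨W, hW0, hW, hWt⟩ := Trace.exists_rep_seq (fun t => (top X t).2) (top_zero X)
    fun t => top_trace_mono hG t.le_succ
  have hops : ∀ t, (W t : Multiset (Cmd n O)) = (top X t).2.ops := fun t => by
    rw [← hWt, Trace.ops_mk]
  have hmem : ∀ {t c}, c ∈ W t ↔ Recorded X t c := fun {t c} => by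
    rw [recorded_iff hG, ← hops, Multiset.mem_coe]
  -- The record after event `t` contains only commands announced before event `t`. Therefore the
  -- schedule can be extended to `W (t + 1)` first, against the state at time `t`, and the event be
  -- added afterwards.
  have hann : ∀ {t c}, c ∈ W (t + 1) → Announced X t c := fun {t c} hc => by
    rw [← Multiset.mem_coe, hops] at hc
    rcases top_cases X (t + 1) with h' | ⟨j, h'⟩
    · rw [h'] at hc
      simp at hc
    · rw [h'] at hc
      exact announced_of_S_succ hG harr hc
  have hnd : ∀ t, (W t).Nodup := fun t => by
    rw [← Multiset.coe_nodup, hops]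
    rcases top_cases X t with h' | ⟨j, h'⟩
    · rw [h']
      simp
    · rw [h']
      exact ((traceOK hG harr X t).1 j).1
  have key : ∀ t i, Served A (W t) i (loc X t i).phase.cmd (restrict (X.history t) i) := by
    intro t i
    induction t with
    | zero =>
      left
      rw [loc_zero, hW0]
      exact ⟨rfl, rfl⟩
    | succ t ih =>
      obtain ⟨Z, hZ⟩ := hW t
      have hn := hnd (t + 1)
      rw [← hZ] at hn
      have ih : Served A (W (t + 1)) i (loc X t i).phase.cmd (restrict (X.history t) i) := by
        rw [← hZ]
        refine ih.extend hn fun d hd hi => ?_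
        subst hi
        -- A command that enters the record is announced and, as `W (t + 1)` has no repetitions, was
        -- not recorded before; so it is pending.
        rcases recorded_or_pending (hann (hZ ▸ List.mem_append_right _ hd)) with h | h
        · exact absurd hd (List.disjoint_of_nodup_append hn (hmem.2 h))
        · exact h.1
      cases trans_cases X t i with
      | other h1 h2 => rwa [h2, X.restrict_history_other h1]
      | inv o h1 h2 _ h3 =>
        have hh : restrict (X.history (t + 1)) i = restrict (X.history t) i ++ [.inv i o] := by
          simp [Implementation.Execution.history, h1,
            Implementation.Config.label, restrict, HEvent.proc]
        rcases ih with ⟨-, ih⟩ | ⟨c, hc, -⟩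
        · refine .inr ⟨⟨o, i, (loc X t i).seq + 1⟩, by rw [h3]; rfl, rfl, .inl ⟨fun hc => ?_, ?_⟩⟩
          -- The sequence number of the new command exceeds those of all commands its process has
          -- announced, so the command is not in the schedule.
          · have := (hann hc).seq_le
            simp at this
          · rw [hh, ih]
        · rw [cmd_eq, h2] at hc
          cases hc
      | step y h1 hm _ _ hl =>
        have hh : restrict (X.history (t + 1)) i =
            restrict (X.history t) i ++ y.toList.map (.res i) := by
          rw [Implementation.Execution.history, restrict_append, h1]
          simp only [hl]
          cases y <;> simp [restrict, HEvent.proc]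
        rw [hh, hm.cmd_eq]
        cases y with
        | none => simpa using ih
        | some y =>
          generalize hL : loc X t i = L at hm ih
          generalize loc X (t + 1) i = L' at hm
          cases hm with
          | checkRet r seq s cmd best hb =>
            rcases ih with ⟨h, -⟩ | ⟨c, hc, -, ih⟩
            · cases h
            · simp only [Phase.cmd, Option.some.injEq] at hc
              subst hc
              rcases check_best X t (by rw [hL]) with rfl | ⟨t', ht', j, rfl⟩
              · simp at hb
              -- The record from which the response is computed may be old, but it is a prefix of
              -- the latest one, and the two responses agree.
              · have hle := S_trace_le_top (X := X) hG (ht'.trans t.le_succ) j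
                rw [← hWt] at hle
                have hcW : cmd ∈ W (t + 1) := hmem.2 ⟨t', ht'.trans t.le_succ, j, hb⟩
                obtain ⟨-, ih⟩ := ih.resolve_left fun h => h.1 hcW
                left
                rw [SeqObject.ret_eq_of_le _ hb hle]
                exact ⟨rfl, ih⟩
  refine linearizable_of_matches X (fun t => A.run A.q0 (W t)) (fun t => A.run_prefix _ (hW t))
    (fun t => A.legalFrom_run _ _) (fun t i => ?_) T
  rcases key t i with ⟨h1, h2⟩ | ⟨c, h1, rfl, h2⟩
  · rw [cmd_eq, Option.map_eq_none_iff] at h1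
    exact .inl ⟨h1, h2⟩
  · exact .inr ⟨c.op, (cmd_of_phase X h1).2.2, h2.imp And.right fun h => ⟨_, h.2⟩⟩

end Helping

/-! ### Progress of the construction -/

namespace Implementation.Execution

variable {n : ℕ} {O : Type v} {R : Type w} {I : Implementation.{u} n O R} (X : I.Execution)

theorem exists_invoke_of_pend {t : ℕ} {i : Fin n} {o : O} (h : (X.conf t).pend i = some o) :
    ∃ t' < t, X.ev t' = some (.invoke i o) ∧ ∀ t'', t' < t'' → t'' ≤ t →
      (X.conf t'').pend i ≠ none := by
  induction t with
  | zero => rw [X.conf_zero] at h; cases h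
  | succ t ih =>
    have lift : (X.conf t).pend i = some o → ∃ t' < t + 1, X.ev t' = some (.invoke i o) ∧
        ∀ t'', t' < t'' → t'' ≤ t + 1 → (X.conf t'').pend i ≠ none := by
      intro h'
      obtain ⟨t', ht', he, hp⟩ := ih h'
      refine ⟨t', ht'.trans t.lt_succ_self, he, fun t'' h1 h2 => ?_⟩
      rcases Nat.le_succ_iff.1 h2 with h2 | rfl
      · exact hp t'' h1 h2
      · rw [h]; simp
    cases he : X.ev t with
    | none => exact lift (by rwa [X.conf_none t he] at h)
    | some e =>
      by_cases hi : e.proc = i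
      · cases e with
        | invoke j o' =>
          obtain rfl : j = i := hi
          rw [(X.pend_of_invoke he).2] at h
          cases h
          refine ⟨t, t.lt_succ_self, he, fun t'' h1 h2 => ?_⟩
          obtain rfl : t'' = t + 1 := by omega
          rw [(X.pend_of_invoke he).2]
          simp
        | step j =>
          obtain rfl : j = i := hi
          refine lift ?_
          rw [(X.conf_some t _ he).2, ((X.conf t).after_step j).2.2] at h
          split at h
          · simp at h
          · exact h
      · refine lift ?_
        rwa [(X.conf_other fun e' h' => by
          rw [he] at h'
          cases h'
          exact hi).2] at h

theorem invoked_of_pend {t : ℕ} {i : Fin n} (h : (X.conf t).pend i ≠ none) :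
    ∃ o, X.Invoked i o := by
  obtain ⟨o, ho⟩ := Option.ne_none_iff_exists'.1 h
  obtain ⟨t', -, h, -⟩ := X.exists_invoke_of_pend ho
  exact ⟨o, t', h⟩

theorem Returned.invoked {X : I.Execution} {i : Fin n} {r : R} (h : X.Returned i r) :
    ∃ o, X.Invoked i o := by
  obtain ⟨t, l, h, -⟩ := h
  exact X.invoked_of_pend (X.pend_of_step h)

/-- After the return of its operation, a process of a one-shot execution has nothing pending. -/
theorem OneShot.pend_of_return {X : I.Execution} (hX : X.OneShot) {t t' : ℕ} {i : Fin n} {r : R}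
    {l : I.Loc} (h : X.ev t = some (.step i)) (hn : I.next i ((X.conf t).loc i) = .ret r l)
    (ht : t < t') : (X.conf t').pend i = none := by
  by_contra hp
  obtain ⟨o, ho⟩ := Option.ne_none_iff_exists'.1 hp
  obtain ⟨o', ho'⟩ := Option.ne_none_iff_exists'.1 (X.pend_of_step h)
  obtain ⟨t₁, -, h₁, hp₁⟩ := X.exists_invoke_of_pend ho
  obtain ⟨t₂, ht₂, h₂, -⟩ := X.exists_invoke_of_pend ho'
  obtain rfl := hX _ _ _ _ _ h₁ h₂
  refine hp₁ (t + 1) (by omega) ht ?_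
  rw [(X.conf_some t _ h).2, ((X.conf t).after_step i).2.2, hn]
  simp

end Implementation.Execution

namespace Helping

variable {n : ℕ} {Q : Type v} {O : Type u} {R : Type w}
variable {A : SeqObject Q O R} {G : ℕ → Implementation.{u} n (A.CmdTrace n) (A.CmdTrace n × Bool)}
  {arr : Fin n → Finset (Cmd n O) → List (Cmd n O)}

/-- From time `T` on, process `i` is executing `c`, and it takes infinitely many steps. -/
structure Stuck (X : (construction A G arr).Execution) (T : ℕ) (i : Fin n) (c : Cmd n O) :
    Prop where
  cmd : ∀ t, T ≤ t → (loc X t i).phase.cmd = some c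
  step : ∀ t, ∃ t', t ≤ t' ∧ X.ev t' = some (.step i)

section

variable {X : (construction A G arr).Execution} {T : ℕ} {i : Fin n} {c : Cmd n O}

/-- Take the first step of `i` from time `t` on. Until then its local state is frozen, and the step
gives no response since `c` remains the command. -/
theorem Stuck.next (h : Stuck X T i c) {t : ℕ} (ht : T ≤ t) :
    ∃ t', t ≤ t' ∧ X.ev t' = some (.step i) ∧ loc X t' i = loc X t i ∧
      Move A G arr i (mem X t') (mem X (t' + 1)) (loc X t i) (loc X (t' + 1) i) none := by
  classical
  have hex := h.step t
  obtain ⟨h1, h2⟩ := Nat.find_spec hex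
  have hmin := fun m => Nat.find_min hex (m := m)
  set t' := Nat.find hex
  have key : ∀ m, t ≤ m → m ≤ t' → loc X m i = loc X t i := by
    intro m hm
    induction m, hm using Nat.le_induction with
    | base => exact fun _ => rfl
    | succ m hm ih =>
      intro hm'
      rw [← ih (by omega)]
      cases trans_cases X m i with
      | other _ h' => exact h'
      | inv o _ hp =>
        have := h.cmd m (by omega)
        rw [cmd_eq, hp] at this
        cases this
      | step y he => exact absurd ⟨hm, he⟩ (hmin m (by omega))
  have hl := key t' h1 le_rfl
  refine ⟨t', h1, h2, hl, ?_⟩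
  cases trans_cases X t' i with
  | other h' => exact absurd rfl (h' _ h2)
  | inv o h' => rw [h2] at h'; cases h'
  | step y _ hm =>
    have := h.cmd (t' + 1) (by omega)
    rw [hm.cmd_eq] at this
    split_ifs at this with hy
    rw [← hl, ← hy]
    exact hm

theorem Stuck.start (h : Stuck X T i c) {t : ℕ} (ht : T ≤ t) {todo : List (Fin n)}
    {b : ℕ × A.CmdTrace n} (hp : (loc X t i).phase = .start c todo b) :
    ∃ t', t ≤ t' ∧ ∃ todo' found, (loc X t' i).phase = .help c todo' found := by
  induction todo generalizing t b with
  | nil =>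
    obtain ⟨t', ht', -, -, hm⟩ := h.next ht
    refine ⟨t' + 1, by omega, ?_⟩
    generalize loc X t i = L at hm hp
    generalize loc X (t' + 1) i = L' at hm
    cases hm with
    | startEnd =>
      cases hp
      exact ⟨_, _, rfl⟩
    | _ => simp_all
  | cons j js ih =>
    obtain ⟨t', ht', -, -, hm⟩ := h.next ht
    have hs : ∃ b', (loc X (t' + 1) i).phase = .start c js b' := by
      generalize loc X t i = L at hm hp
      generalize loc X (t' + 1) i = L' at hm
      cases hm with
      | startRead =>
        cases hp
        exact ⟨_, rfl⟩
      | _ => simp_all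
    obtain ⟨b', hb'⟩ := hs
    obtain ⟨t'', ht'', h'⟩ := ih (by omega) hb'
    exact ⟨t'', by omega, h'⟩

theorem Stuck.help (h : Stuck X T i c) {t : ℕ} (ht : T ≤ t) {todo : List (Fin n)}
    {found : Finset (Cmd n O)} (hp : (loc X t i).phase = .help c todo found) :
    ∃ t', t ≤ t' ∧ ∃ l, (loc X t' i).phase = .propose c (loc X t i).r l := by
  induction todo generalizing t found with
  | nil =>
    obtain ⟨t', ht', -, -, hm⟩ := h.next ht
    refine ⟨t' + 1, by omega, ?_⟩
    generalize loc X t i = L at hm hp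
    generalize loc X (t' + 1) i = L' at hm
    cases hm with
    | helpEnd =>
      cases hp
      exact ⟨_, rfl⟩
    | _ => simp_all
  | cons j js ih =>
    obtain ⟨t', ht', -, -, hm⟩ := h.next ht
    have hs : ∃ found', (loc X (t' + 1) i).phase = .help c js found' ∧
        (loc X (t' + 1) i).r = (loc X t i).r := by
      generalize loc X t i = L at hm hp
      generalize loc X (t' + 1) i = L' at hm
      cases hm with
      | helpNew =>
        cases hp
        exact ⟨_, rfl, rfl⟩
      | helpSkip =>
        cases hp
        exact ⟨_, rfl, rfl⟩
      | _ => simp_all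
    obtain ⟨b', hb', hr⟩ := hs
    obtain ⟨t'', ht'', h'⟩ := ih (by omega) hb'
    rw [hr] at h'
    exact ⟨t'', by omega, h'⟩

/-- If `GCA_k` never returned, all later steps of `i` would be steps of `GCA_k`, so `i` would be
correct there and termination would supply a return. It cannot precede `t`, when the proposal is
pending, and a later one is excluded by assumption. -/
theorem Stuck.propose (h : Stuck X T i c) (hG : ∀ k, IsGCA (G k)) {t k : ℕ}
    {l : (G k).Loc} (hp : (loc X t i).phase = .propose c k l) :
    ∃ t', t ≤ t' ∧ ∃ x b, (proj X k).Returned i (x, b) ∧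
      loc X t' i = ⟨k, (loc X t' i).seq, x,
        if b = true then .record c else .check c (List.finRange n) (0, 1)⟩ := by
  have hret : ∃ t', t ≤ t' ∧ ∃ l y l', X.ev t' = some (.step i) ∧
      (loc X t' i).phase = .propose c k l ∧ (G k).next i l = .ret y l' := by
    by_contra hno
    push Not at hno
    have hstay : ∀ t', t ≤ t' → ∃ l, (loc X t' i).phase = .propose c k l := by
      intro t' ht'
      induction t', ht' using Nat.le_induction with
      | base => exact ⟨l, hp⟩
      | succ t' ht' ih =>
        obtain ⟨l, hl⟩ := ih
        cases trans_cases X t' i with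
        | other _ h' => exact ⟨l, h' ▸ hl⟩
        | inv o _ hp' =>
          have := cmd_eq X t' i
          rw [hl, hp'] at this
          cases this
        | step y he hm =>
          have hno := hno t' ht' l
          generalize hL : loc X t' i = L at hm hl
          generalize loc X (t' + 1) i = L' at hm
          cases hm with
          | propStep =>
            cases hl
            exact ⟨_, rfl⟩
          | propRet r seq s cmd k l l' x b hn =>
            cases hl
            exact absurd hn (hno _ _ he (by rw [hL]))
          | _ => simp_all
    obtain ⟨s, hs⟩ := (proj X k).invoked_of_pend (proj_pend hp)
    obtain ⟨y, t₁, l', h1, h2⟩ := (hG k).termination _ proj_oneShot i s hs <| by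
      left
      intro T'
      obtain ⟨t', ht', he⟩ := h.step (max t T')
      obtain ⟨l, hl⟩ := hstay t' (by omega)
      exact ⟨t', _, by omega, proj_step_iff.2 ⟨he, c, l, hl⟩, rfl⟩
    rcases Nat.lt_or_ge t₁ t with hlt | hle
    · exact proj_pend hp (proj_oneShot.pend_of_return h1 h2 hlt)
    · obtain ⟨l₁, hl₁⟩ := hstay t₁ hle
      rw [proj_loc hl₁] at h2
      exact hno t₁ hle l₁ y l' (proj_step_iff.1 h1).1 hl₁ h2
  obtain ⟨t', ht', l, ⟨x, b⟩, l', he, hl, hn⟩ := hret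
  obtain ⟨h1, h2⟩ := returned_of_step he hl hn
  refine ⟨t' + 1, by omega, x, b, ⟨t', l', h1, h2⟩, ?_⟩
  cases trans_cases X t' i with
  | other h' => exact absurd rfl (h' _ he)
  | inv o h' => rw [he] at h'; cases h'
  | step y _ hm =>
    have hw := wf X t' i
    generalize loc X t' i = L at hm hl hw
    generalize loc X (t' + 1) i = L' at hm
    cases hm with
    | propStep r seq s cmd k l hn' =>
      cases hl
      exact absurd hn (hn' _ _)
    | propRet r seq s cmd k l l' x b hn' =>
      cases hl
      rw [hn] at hn'
      cases hn'
      rw [hw.1]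
    | _ => simp_all

/-- Recorded rounds only grow, so the pair selected at the end is at least as late as every entry
still to be read was at time `t`. Since `i` does not return, this pair lacks `c`. -/
theorem Stuck.check (h : Stuck X T i c) {t : ℕ} (ht : T ≤ t) {todo : List (Fin n)}
    {b : ℕ × A.CmdTrace n} (hp : (loc X t i).phase = .check c todo b) :
    ∃ t', t ≤ t' ∧ ∃ b', (loc X t' i).phase = .check c [] b' ∧ c ∉ b'.2.ops ∧ b.1 ≤ b'.1 ∧
      (∀ j ∈ todo, ((mem X t).S j).1 ≤ b'.1) ∧ (loc X (t' + 1) i).r = (loc X t i).r + 1 ∧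
      (loc X (t' + 1) i).phase = .help c (List.finRange n) ∅ := by
  induction todo generalizing t b with
  | nil =>
    obtain ⟨t', ht', -, hl, hm⟩ := h.next ht
    refine ⟨t', ht', b, hl ▸ hp, ?_⟩
    generalize loc X t i = L at hm hp
    generalize loc X (t' + 1) i = L' at hm
    cases hm with
    | checkLoop r seq s cmd best hb =>
      cases hp
      exact ⟨hb, le_rfl, by simp, rfl, rfl⟩
    | _ => simp_all
  | cons j js ih =>
    obtain ⟨t', ht', -, -, hm⟩ := h.next ht
    have hs : (loc X (t' + 1) i).phase = .check c js (later A b ((mem X t').S j)) ∧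
        (loc X (t' + 1) i).r = (loc X t i).r := by
      generalize loc X t i = L at hm hp
      generalize loc X (t' + 1) i = L' at hm
      cases hm with
      | checkRead =>
        cases hp
        exact ⟨rfl, rfl⟩
      | _ => simp_all
    obtain ⟨hb', hr⟩ := hs
    obtain ⟨t'', ht'', b'', h1, h2, h3, h4, h5, h6⟩ := ih (by omega) hb'
    rw [later_fst] at h3
    have hS : ∀ j' t₁, t ≤ t₁ → ((mem X t).S j').1 ≤ ((mem X t₁).S j').1 := fun j' t₁ ht₁ =>
      monotone_nat_of_le_succ (f := fun t => ((mem X t).S j').1) (fun t => S_le_succ X t j') ht₁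
    refine ⟨t'', by omega, b'', h1, h2, (le_max_left _ _).trans h3, fun j' hj' => ?_,
      by rw [h5, hr], h6⟩
    rcases List.mem_cons.1 hj' with rfl | hj'
    · exact (hS _ t' ht').trans ((le_max_right _ _).trans h3)
    · exact (hS j' (t' + 1) (by omega)).trans (h4 j' hj')

/-- A process that starts to collect commands for round `k` returns from `GCA_k`, records what it
commits, and reads `S`. -/
theorem Stuck.round (h : Stuck X T i c) (hG : ∀ k, IsGCA (G k)) {t : ℕ} (ht : T ≤ t)
    {todo : List (Fin n)} {found : Finset (Cmd n O)}
    (hp : (loc X t i).phase = .help c todo found) :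
    ∃ x b, (proj X (loc X t i).r).Returned i (x, b) ∧
      (b = true → ∃ t', (mem X t').S i = ((loc X t i).r, x)) ∧
      ∃ t', t ≤ t' ∧ (loc X t' i).r = (loc X t i).r ∧
        (loc X t' i).phase = .check c (List.finRange n) (0, 1) := by
  obtain ⟨t₁, ht₁, l, h₁⟩ := h.help ht hp
  obtain ⟨t₂, ht₂, x, b, hr, h₂⟩ := h.propose hG h₁
  refine ⟨x, b, hr, ?_⟩
  cases b with
  | false => exact ⟨by simp, t₂, by omega, by rw [h₂], by rw [h₂]; rfl⟩
  | true =>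
    obtain ⟨t₃, ht₃, he, -, hm⟩ := h.next (t := t₂) (by omega)
    rw [h₂, if_pos rfl] at hm
    generalize hL' : loc X (t₃ + 1) i = L' at hm
    cases hm with
    | record r seq s cmd hmm =>
      exact ⟨fun _ => ⟨t₃ + 1, by rw [hmm]; exact Function.update_self ..⟩, t₃ + 1, by omega,
        by rw [hL'], by rw [hL']⟩
    | idle => simp_all

theorem Stuck.exists_help (h : Stuck X T i c) (hG : ∀ k, IsGCA (G k)) :
    ∃ t, T ≤ t ∧ ∃ todo found, (loc X t i).phase = .help c todo found := by
  have hcheck : ∀ t todo b, T ≤ t → (loc X t i).phase = .check c todo b →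
      ∃ t, T ≤ t ∧ ∃ todo found, (loc X t i).phase = .help c todo found := by
    intro t todo b ht hp
    obtain ⟨t', ht', b', -, -, -, -, -, h'⟩ := h.check ht hp
    exact ⟨t' + 1, by omega, _, _, h'⟩
  have hrecord : ∀ t, T ≤ t → (loc X t i).phase = .record c →
      ∃ t, T ≤ t ∧ ∃ todo found, (loc X t i).phase = .help c todo found := by
    intro t ht hp
    obtain ⟨t', ht', -, -, hm⟩ := h.next ht
    refine hcheck (t' + 1) (List.finRange n) (0, 1) (by omega) ?_
    generalize loc X t i = L at hm hp
    generalize loc X (t' + 1) i = L' at hm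
    cases hm with
    | record =>
      cases hp
      rfl
    | _ => simp_all
  have hc := h.cmd T le_rfl
  cases hp : (loc X T i).phase with
  | idle => rw [hp] at hc; cases hc
  | announce d =>
    rw [hp] at hc
    cases hc
    obtain ⟨t', ht', -, -, hm⟩ := h.next (le_refl T)
    have hs : ∃ b, (loc X (t' + 1) i).phase = .start c (List.finRange n) b := by
      generalize loc X T i = L at hm hp
      generalize loc X (t' + 1) i = L' at hm
      cases hm with
      | announce =>
        cases hp
        exact ⟨_, rfl⟩
      | _ => simp_all
    obtain ⟨b, hb⟩ := hs
    obtain ⟨t'', ht'', h'⟩ := h.start (by omega) hb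
    exact ⟨t'', by omega, h'⟩
  | start d todo b =>
    rw [hp] at hc
    cases hc
    exact h.start le_rfl hp
  | help d todo found =>
    rw [hp] at hc
    cases hc
    exact ⟨T, le_rfl, _, _, hp⟩
  | propose d k l =>
    rw [hp] at hc
    cases hc
    obtain ⟨t', ht', x, b, -, h'⟩ := h.propose hG hp
    cases b with
    | false => exact hcheck t' (List.finRange n) (0, 1) ht' (by rw [h']; rfl)
    | true => exact hrecord t' ht' (by rw [h']; rfl)
  | record d =>
    rw [hp] at hc
    cases hc
    exact hrecord T le_rfl hp
  | check d todo b =>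
    rw [hp] at hc
    cases hc
    exact hcheck T _ _ le_rfl hp

/-- Once inside the loop, the process never leaves it and each iteration raises `r` by exactly one,
so no round is skipped. -/
theorem Stuck.rounds (h : Stuck X T i c) (hG : ∀ k, IsGCA (G k)) :
    ∃ k₀, ∀ k, k₀ ≤ k → ∃ t, T ≤ t ∧ (loc X t i).r = k ∧
      ∃ todo found, (loc X t i).phase = .help c todo found := by
  obtain ⟨t, ht, hp⟩ := h.exists_help hG
  refine ⟨(loc X t i).r, fun k hk => ?_⟩
  induction k, hk using Nat.le_induction with
  | base => exact ⟨t, ht, rfl, hp⟩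
  | succ k _ ih =>
    obtain ⟨t, ht, rfl, todo, found, hp⟩ := ih
    obtain ⟨x, b, -, -, t', ht', hr, hp'⟩ := h.round hG ht hp
    obtain ⟨t'', ht'', b', -, -, -, -, hr', hh⟩ := h.check (by omega) hp'
    exact ⟨t'' + 1, by omega, by rw [hr', hr], _, _, hh⟩

/-- Once a round has been recorded from which on all committed traces contain `c`, nobody is stuck
with `c`. -/
theorem Stuck.false_of_record (h : Stuck X T i c) (hG : ∀ k, IsGCA (G k)) {k : ℕ}
    (hk : ∀ k' x, k ≤ k' → ComPair X k' x → c ∈ x.ops) {t : ℕ} {j : Fin n}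
    (hS : k ≤ ((mem X t).S j).1) : False := by
  obtain ⟨k₀, hk₀⟩ := h.rounds hG
  -- A round beyond the one of `i` at time `t` is run after `t`, so its reading of `S` sees a record
  -- of round at least `k`.
  obtain ⟨t₁, ht₁, hr₁, todo, found, hp₁⟩ := hk₀ (max k₀ ((loc X t i).r + 1)) (le_max_left _ _)
  obtain ⟨x, b, -, -, t₂, ht₂, hr₂, hp₂⟩ := h.round hG ht₁ hp₁
  have htt : t ≤ t₂ := by
    by_contra hlt
    have := r_mono (X := X) (i := i) (t := t₂) (t' := t) (by omega)
    omega
  obtain ⟨t₃, ht₃, b', hb', hc, -, hj, -⟩ := h.check (by omega) hp₂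
  have hkb : k ≤ b'.1 := hS.trans <| (monotone_nat_of_le_succ (f := fun t => ((mem X t).S j).1)
    (fun t => S_le_succ X t j) htt).trans (hj j (List.mem_finRange j))
  refine hc (hk _ _ hkb ?_)
  rcases check_best X t₃ hb' with rfl | ⟨t', -, j', rfl⟩
  · exact .inl ⟨rfl, rfl⟩
  · exact (pairOK X t').1 j'

/-- A recorded trace is a prefix of everything committed in its round or later, so a record of `c`
is one that all later records preserve. -/
theorem Stuck.not_recorded (h : Stuck X T i c) (hG : ∀ k, IsGCA (G k)) (t : ℕ) :
    ¬ Recorded X t c := by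
  rintro ⟨t', -, j, hc⟩
  exact h.false_of_record hG (fun k x hk hx => Multiset.mem_of_le
    (Trace.ops_le (com_le_out hG X ((pairOK X t').1 j) hx.out hk)) hc) le_rfl

end

end Helping

/-! ### Helping and conflict-freedom -/

namespace Helping

variable {n : ℕ} {Q : Type v} {O : Type u} {R : Type w}
variable {A : SeqObject Q O R} {G : ℕ → Implementation.{u} n (A.CmdTrace n) (A.CmdTrace n × Bool)}
  {arr : Fin n → Finset (Cmd n O) → List (Cmd n O)}

section

variable {X : (construction A G arr).Execution}

theorem exists_r_le (X : (construction A G arr).Execution) (t : ℕ) :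
    ∃ K, ∀ i, (loc X t i).r ≤ K :=
  ⟨Finset.univ.sup fun i => (loc X t i).r,
    fun i => Finset.le_sup (f := fun i => (loc X t i).r) (Finset.mem_univ i)⟩

/-- A command that stays announced is in all inputs from some round on. -/
theorem exists_mem_input (harr : ∀ i F, (arr i F : Multiset (Cmd n O)) = F.val) {T : ℕ}
    {d : Cmd n O} (h : ∀ t, T ≤ t → (mem X t).M d.proc = some d) :
    ∃ K, ∀ k, K < k → ∀ i s, (proj X k).Invoked i s → d ∈ s.ops := by
  classical
  obtain ⟨K, hK⟩ := exists_r_le X T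
  -- `K` bounds all rounds at time `T`, so a collection for a round beyond `K` begins after `T` and
  -- meets `d` when it reads the register of `d.proc`.
  have key : ∀ i t, T ≤ t → K < (loc X t i).r → ∀ c todo found,
      (loc X t i).phase = .help c todo found →
      d ∈ (loc X t i).s.ops ∨ d.proc ∈ todo ∨ d ∈ found := by
    intro i t ht
    induction t, ht using Nat.le_induction with
    | base => exact fun hr => absurd (hK i) (by omega)
    | succ t ht ih =>
      intro hr c todo found hp
      have hM := h t ht
      cases trans_cases X t i with
      | other _ h' =>
        rw [h'] at hr hp ⊢
        exact ih hr c todo found hp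
      | inv o _ _ _ h' => rw [h'] at hp; cases hp
      | step y _ hm =>
        generalize loc X t i = L at hm ih
        generalize loc X (t + 1) i = L' at hm hr hp
        cases hm with
        | startEnd => cases hp; exact .inr (.inl (List.mem_finRange _))
        | checkLoop => cases hp; exact .inr (.inl (List.mem_finRange _))
        | helpNew r seq s cmd j js found d' h1 =>
          cases hp
          rcases ih hr _ _ _ rfl with h | h | h
          · exact .inl h
          · rcases List.mem_cons.1 h with rfl | h
            · rw [hM] at h1
              cases h1
              exact .inr (.inr (Finset.mem_insert_self ..))
            · exact .inr (.inl h)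
          · exact .inr (.inr (Finset.mem_insert_of_mem h))
        | helpSkip r seq s cmd j js found h1 =>
          cases hp
          rcases ih hr _ _ _ rfl with h | h | h
          · exact .inl h
          · rcases List.mem_cons.1 h with rfl | h
            · exact .inl (h1 d hM)
            · exact .inr (.inl h)
          · exact .inr (.inr h)
        | propRet r seq s cmd k l l' x b => cases b <;> simp at hp
        | _ => simp_all
  refine ⟨K, fun k hk i s ⟨t, ht⟩ => ?_⟩
  obtain ⟨-, c, found, hp, rfl, rfl⟩ := proj_invoke.1 ht
  have htT : T ≤ t := by
    by_contra hlt
    have := (r_mono (X := X) (i := i) (t := t) (t' := T) (by omega)).trans (hK i)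
    omega
  rw [Trace.ops_mul, Trace.ops_mk, harr, Multiset.mem_add]
  refine (key i t htT hk c [] found hp).imp id fun h => ?_
  exact h.resolve_left (by simp)

/-- One step suffices: if the process is still about to announce `c`, that step is the announcement.
-/
theorem Stuck.eventually_pendingAt {T : ℕ} {i : Fin n} {c : Cmd n O} (h : Stuck X T i c) :
    c.proc = i ∧ ∃ T', T ≤ T' ∧ ∀ t, T' ≤ t → PendingAt X t c := by
  have hi : c.proc = i := (cmd_of_phase X (h.cmd T le_rfl)).1
  subst hi
  obtain ⟨t, ht, -, -, hm⟩ := h.next (le_refl T)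
  refine ⟨rfl, t + 1, by omega, fun t' ht' => ⟨h.cmd t' (by omega), ?_⟩⟩
  induction t', ht' using Nat.le_induction with
  | base => exact hm.not_announce
  | succ t' ht' ih =>
    cases trans_cases X t' c.proc with
    | other _ h' => rwa [h']
    | inv o _ hp =>
      have := h.cmd t' (by omega)
      rw [cmd_eq, hp] at this
      cases this
    | step y _ hm => exact hm.not_announce

/-- What is announced and not recorded by time `T` is pending at some later time. -/
theorem exists_pendingAt {T t : ℕ} {d : Cmd n O} (h : Announced X t d) (hT : ¬ Recorded X T d) :
    ∃ t', T ≤ t' ∧ PendingAt X t' d := by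
  rcases le_total t T with hle | hle
  · exact ⟨T, le_rfl, (recorded_or_pending (h.mono hle)).resolve_left hT⟩
  · induction t, hle using Nat.le_induction with
    | base => exact ⟨T, le_rfl, (recorded_or_pending h).resolve_left hT⟩
    | succ t ht ih =>
      rcases announced_succ h with h | h
      · exact ih h
      · exact ⟨t + 1, by omega, h⟩

theorem not_conflict_of_pendingAt {T t : ℕ} {c d : Cmd n O}
    (hT : ∀ t, T ≤ t → ∀ i j o o', i ≠ j → (X.conf t).pend i = some o →
      (X.conf t).pend j = some o' → ¬ A.Conflict o o')
    (ht : T ≤ t) (hc : PendingAt X t c) (hd : PendingAt X t d) (hcd : c ≠ d) :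
    ¬ (A.cmdObj n).Conflict c d ∧ ¬ (A.cmdObj n).Conflict d c := by
  have hij : c.proc ≠ d.proc := by
    intro h
    have := hc.1
    rw [h, hd.1] at this
    exact hcd (Option.some.inj this).symm
  have h1 := (cmd_of_phase X hc.1).2.2
  have h2 := (cmd_of_phase X hd.1).2.2
  exact ⟨hT t ht _ _ _ _ hij h1 h2, hT t ht _ _ _ _ hij.symm h2 h1⟩

variable (hG : ∀ k, IsGCA (G k)) (harr : ∀ i F, (arr i F : Multiset (Cmd n O)) = F.val)

include hG harr

/-- A process does not get stuck in a solo run. -/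
theorem Stuck.false_of_solo {T : ℕ} {i : Fin n} {c : Cmd n O} (h : Stuck X T i c) {T' : ℕ}
    (hT' : ∀ t e, T' ≤ t → X.ev t = some e → e.proc = i) : False := by
  obtain ⟨rfl, T₁, -, hp⟩ := h.eventually_pendingAt
  obtain ⟨K, hK⟩ := exists_mem_input harr fun t ht => M_of_pendingAt (hp t ht)
  obtain ⟨K', hK'⟩ := exists_r_le X T'
  -- Rounds beyond `K'` are entered after `T'`, when only one process takes steps.
  have honly : ∀ k, K' < k → ∀ j s, (proj X k).Invoked j s → j = c.proc := by
    rintro k hk j s ⟨t, ht⟩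
    obtain ⟨he, -, -, -, rfl, -⟩ := proj_invoke.1 ht
    refine hT' t _ ?_ he
    by_contra hlt
    have := (r_mono (X := X) (i := j) (t := t) (t' := T') (by omega)).trans (hK' j)
    omega
  have huniq : ∀ k, K' < k → ∀ j j' s s', (proj X k).Invoked j s → (proj X k).Invoked j' s' →
      s = s' := by
    intro k hk j j' s s' hj hj'
    obtain rfl := honly k hk j s hj
    obtain rfl := honly k hk j' s' hj'
    obtain ⟨t, ht⟩ := hj
    obtain ⟨t', ht'⟩ := hj'
    obtain rfl := proj_oneShot _ _ _ _ _ ht ht'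
    rw [ht] at ht'
    cases ht'
    rfl
  obtain ⟨k₀, hk₀⟩ := h.rounds hG
  obtain ⟨t, ht, hr, todo, found, hph⟩ := hk₀ (max k₀ (max K K' + 1)) (le_max_left _ _)
  obtain ⟨x, b, hret, hrec, -⟩ := h.round hG ht hph
  obtain rfl := (hG _).weak_agreement _ proj_oneShot (huniq _ (by omega)) _ _ _ hret
  obtain ⟨t', ht'⟩ := hrec rfl
  -- In these rounds the only input contains `c` and is its own common prefix, so every committed
  -- trace contains `c`.
  refine h.false_of_record hG (k := max K K' + 1) (t := t') (j := c.proc) (fun k x hk hx => ?_)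
    (by rw [ht']; simp only; omega)
  rcases hx with ⟨rfl, -⟩ | ⟨h0, j, hx⟩
  · omega
  · obtain ⟨s, hs⟩ := hx.invoked
    refine Multiset.mem_of_le (Trace.ops_le (le_output hG X h0 (.inr ⟨h0, j, true, hx⟩)
      fun j' s' hs' => ?_)) (hK k (by omega) j s hs)
    rw [huniq k (by omega) j j' s s' hs hs']

/-- Inputs extend every record of an earlier round by commands that were not recorded then. -/
theorem exists_input_eq {T k : ℕ} {j : Fin n} {s : A.CmdTrace n} (h : (proj X k).Invoked j s)
    (hk : (top X T).1 < k) : ∃ y : A.CmdTrace n, s = (top X T).2 * y ∧ y.ops.Nodup ∧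
      ∀ d ∈ y.ops, ¬ Recorded X T d ∧ ∃ t, Announced X t d := by
  obtain ⟨y, rfl⟩ := com_le_input hG X (top_com X T) h hk
  obtain ⟨t, ht⟩ := h
  obtain ⟨hn, ha⟩ := input_traceOK hG harr ht
  rw [Trace.ops_mul, Multiset.nodup_add] at hn
  refine ⟨y, rfl, hn.2.1, fun d hd => ⟨fun hr => ?_, t + 1, ha d ?_⟩⟩
  · exact Multiset.disjoint_left.1 hn.2.2 ((recorded_iff hG).1 hr) hd
  · rw [Trace.ops_mul, Multiset.mem_add]
    exact .inr hd

/-- A process does not get stuck in an eventually conflict-free execution. -/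
theorem Stuck.false_of_conflictFree {T : ℕ} {i : Fin n} {c : Cmd n O} (h : Stuck X T i c)
    (hX : X.EventuallyConflictFree A.Conflict) : False := by
  obtain ⟨T₀, hT₀⟩ := hX
  obtain ⟨rfl, T₁, -, hp⟩ := h.eventually_pendingAt
  obtain ⟨K, hK⟩ := exists_mem_input harr fun t ht => M_of_pendingAt (hp t ht)
  set T₂ := max T₀ T₁ with hT₂
  set k₁ := max K (top X T₂).1 with hk₁
  -- Beyond round `k₁` every input is the record of time `T₂` followed by commands that include `c`.
  -- The others were unrecorded at `T₂`, so each is pending at some time after `T₂` together with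
  -- `c` and does not conflict with it. Hence `c` can be moved directly behind the record, in all
  -- inputs alike.
  have hout : ∀ k x, k₁ + 1 ≤ k → ComPair X k x → c ∈ x.ops := by
    intro k x hk hx
    have hle : (top X T₂).2 * Trace.mk _ [c] ≤ x := by
      refine le_output hG X (by omega) hx.out fun j s hs => ?_
      have hc := hK k (by omega) j s hs
      obtain ⟨y, rfl, -, hy⟩ := exists_input_eq hG harr hs (T := T₂) (by omega)
      rw [Trace.ops_mul, Multiset.mem_add] at hc
      refine Trace.mul_le_mul_left' _ (Trace.singleton_le (hc.resolve_left fun h' =>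
        h.not_recorded hG T₂ ((recorded_iff hG).2 h')) fun d hd hdc => ?_)
      obtain ⟨h1, t, h2⟩ := hy d hd
      obtain ⟨t', ht', hd'⟩ := exists_pendingAt h2 h1
      exact not_conflict_of_pendingAt hT₀ (by omega) (hp t' (by omega)) hd' (Ne.symm hdc)
    refine Multiset.mem_of_le (Trace.ops_le hle) ?_
    simp [Trace.ops_mul, Trace.ops_mk]
  -- A single record beyond round `k₁` would release the process.
  have hbound : ∀ t j, ((mem X t).S j).1 ≤ k₁ := by
    intro t j
    by_contra hlt
    exact h.false_of_record hG hout (t := t) (j := j) (by omega)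
  -- the records become constant
  have htop : ∀ t, (top X t).1 ≤ k₁ := by
    intro t
    rcases top_cases X t with h' | ⟨j, h'⟩
    · rw [h']; exact Nat.zero_le _
    · rw [h']; exact hbound t j
  obtain ⟨T₃, hT₃, hconst⟩ : ∃ T₃, T₂ ≤ T₃ ∧ ∀ t, T₃ ≤ t → (top X t).2 = (top X T₃).2 := by
    -- `T₃` makes the latest recorded round as large as possible; afterwards the round is constant,
    -- and a round has only one committed trace.
    obtain ⟨T₃, hT₃, hmin⟩ := (measure fun t => k₁ - (top X t).1).wf.has_min {t | T₂ ≤ t}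
      ⟨T₂, le_refl T₂⟩
    refine ⟨T₃, hT₃, fun t ht => ?_⟩
    have h1 : ¬ k₁ - (top X t).1 < k₁ - (top X T₃).1 := hmin t (le_trans hT₃ ht)
    have h2 := htop t
    have h3 := top_mono (X := X) ht
    have h4 : (top X t).1 = (top X T₃).1 := by omega
    exact com_unique hG X (top_com X t) (h4 ▸ top_com X T₃)
  have hnew : ∀ t d, ¬ Recorded X T₃ d → ¬ Recorded X t d := by
    intro t d hd hr
    have := (recorded_iff hG).1 (hr.mono (le_max_left t T₃))
    rw [hconst _ (le_max_right _ _)] at this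
    exact hd ((recorded_iff hG).2 this)
  have hpend : ∀ t d, Announced X t d → ¬ Recorded X T₃ d → ∀ t', t ≤ t' → PendingAt X t' d :=
    fun t d ha hd t' ht' => (recorded_or_pending (ha.mono ht')).resolve_left (hnew t' d hd)
  -- A command announced but missing from the final record stays pending forever, so each process
  -- has at most one. This makes the threshold uniform in `d`, and over the finitely many processes.
  have hKj : ∀ j : Fin n, ∃ K, ∀ t d, d.proc = j → Announced X t d → ¬ Recorded X T₃ d →
      ∀ k, K < k → ∀ i s, (proj X k).Invoked i s → d ∈ s.ops := by
    intro j
    by_cases hex : ∃ t d, d.proc = j ∧ Announced X t d ∧ ¬ Recorded X T₃ d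
    · obtain ⟨t, d, hj, ha, hd⟩ := hex
      obtain ⟨K, hK⟩ := exists_mem_input harr fun t' ht' => M_of_pendingAt (hpend t d ha hd t' ht')
      refine ⟨K, fun t' d' hj' ha' hd' => ?_⟩
      have h1 := (hpend t d ha hd _ (le_max_left t t')).1
      rw [hj, ← hj', (hpend t' d' ha' hd' _ (le_max_right t t')).1] at h1
      cases h1
      exact hK
    · exact ⟨0, fun t d hj ha hd => absurd ⟨t, d, hj, ha, hd⟩ hex⟩
  choose Kf hKf using hKj
  set K₂ := max k₁ (Finset.univ.sup Kf) with hK₂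
  have hKf_le : ∀ j, Kf j ≤ K₂ := fun j =>
    (Finset.le_sup (Finset.mem_univ j)).trans (le_max_right _ _)
  -- Behind the final record, every input now has exactly the forever-pending commands, each once.
  -- They are pairwise non-conflicting, so their order does not matter.
  have hagree : ∀ k, K₂ < k → ∀ j j' s s', (proj X k).Invoked j s → (proj X k).Invoked j' s' →
      s = s' := by
    intro k hk j j' s s' hs hs'
    have htk : (top X T₃).1 < k := (htop T₃).trans_lt (by omega)
    have hmem : ∀ {j y}, (proj X k).Invoked j ((top X T₃).2 * y) →
        ∀ {d}, ¬ Recorded X T₃ d → (∃ t, Announced X t d) → d ∈ y.ops := by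
      rintro j y hj d hd ⟨t, ha⟩
      have := hKf d.proc t d rfl ha hd k ((hKf_le _).trans_lt hk) _ _ hj
      rw [Trace.ops_mul, Multiset.mem_add] at this
      exact this.resolve_left fun h' => hd ((recorded_iff hG).2 h')
    obtain ⟨y, rfl, hn, hy⟩ := exists_input_eq hG harr hs htk
    obtain ⟨y', rfl, hn', hy'⟩ := exists_input_eq hG harr hs' htk
    congr 1
    refine Trace.eq_of_ops ((Multiset.Nodup.ext hn hn').2 fun d =>
      ⟨fun hd => hmem hs' (hy d hd).1 (hy d hd).2,
        fun hd => hmem hs (hy' d hd).1 (hy' d hd).2⟩) hn fun a ha b hb hab => ?_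
    obtain ⟨ha1, t, ha2⟩ := hy a ha
    obtain ⟨hb1, t', hb2⟩ := hy b hb
    exact (not_conflict_of_pendingAt hT₀ (t := max T₀ (max t t')) (le_max_left _ _)
      (hpend t a ha2 ha1 _ (by omega)) (hpend t' b hb2 hb1 _ (by omega)) hab).1
  obtain ⟨k₀, hk₀⟩ := h.rounds hG
  obtain ⟨t, ht, hr, todo, found, hph⟩ := hk₀ (max k₀ (K₂ + 1)) (le_max_left _ _)
  obtain ⟨x, b, hret, hrec, -⟩ := h.round hG ht hph
  -- Equal inputs force a commit, and recording it in a round beyond `k₁` contradicts `hbound`.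
  obtain rfl := (hG _).weak_agreement _ proj_oneShot (hagree _ (by omega)) _ _ _ hret
  obtain ⟨t', ht'⟩ := hrec rfl
  have := hbound t' c.proc
  rw [ht'] at this
  simp only at this
  omega

/-- If the operation never completes, its process is always pending from then on and cannot invoke
anything, so correctness can only mean infinitely many steps; the process is stuck with a fixed
command, which both progress conditions exclude. -/
theorem conflictFree : (construction A G arr).ConflictFree A := by
  intro X _ i o t₀ h₀ hcor hfree
  by_contra hno
  have hp : ∀ t, t₀ < t → pend X t i ≠ none := fun t ht hp => hno ⟨t, ht, hp⟩
  have hstep : ∀ t, ∃ t', t ≤ t' ∧ X.ev t' = some (.step i) := by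
    intro t
    rcases hcor with h | ⟨T, h⟩
    · obtain ⟨t', e, ht', he, hi⟩ := h (max t (t₀ + 1))
      cases e with
      | invoke j o' =>
        obtain rfl : j = i := hi
        exact absurd (X.pend_of_invoke he).1 (hp t' (by omega))
      | step j =>
        obtain rfl : j = i := hi
        exact ⟨t', by omega, he⟩
    · exact absurd (h (max T (t₀ + 1)) (le_max_left _ _)) (hp _ (by omega))
  obtain ⟨c, hc⟩ : ∃ c, (loc X (t₀ + 1) i).phase.cmd = some c := by
    rw [cmd_eq, (X.pend_of_invoke h₀).2 |> fun h => (h : pend X (t₀ + 1) i = some o)]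
    exact ⟨_, rfl⟩
  have hstuck : Stuck X (t₀ + 1) i c := by
    refine ⟨fun t ht => ?_, hstep⟩
    induction t, ht using Nat.le_induction with
    | base => exact hc
    | succ t ht ih =>
      cases trans_cases X t i with
      | other _ h' => rwa [h']
      | inv o _ h' => exact absurd h' (hp t (by omega))
      | step y _ hm _ h' =>
        rw [hm.cmd_eq]
        split_ifs at h' ⊢ with hy
        · exact ih
        · exact absurd h' (hp _ (by omega))
  rcases hfree with (h | ⟨T, hT⟩) | h
  · exact hno h
  · exact hstuck.false_of_solo hG harr hT
  · exact hstuck.false_of_conflictFree hG harr h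

end

end Helping

/-! ### The theorem: the construction over the register-based GCA -/

theorem mainTheorem1 {Q : Type v} {O : Type u} {R : Type w} (n : ℕ) (A : SeqObject Q O R) :
    (∀ (arr : Fin n → Finset (Cmd n O) → List (Cmd n O)),
      (∀ i F, (arr i F : Multiset (Cmd n O)) = F.val) →
      ∀ (G : ℕ → Implementation.{u} n (A.CmdTrace n) (A.CmdTrace n × Bool)),
        (∀ k, IsGCA (G k)) →
        (Helping.construction A G arr).ConflictFree A ∧
        (Helping.construction A G arr).Linearizable A) ∧
    (∃ G : Implementation.{u} n (A.CmdTrace n) (A.CmdTrace n × Bool), IsGCA G) ∧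
    (∃ I : Implementation.{u} n O R, I.ConflictFree A ∧ I.Linearizable A) := by
  have h1 : ∀ (arr : Fin n → Finset (Cmd n O) → List (Cmd n O)),
      (∀ i F, (arr i F : Multiset (Cmd n O)) = F.val) →
      ∀ (G : ℕ → Implementation.{u} n (A.CmdTrace n) (A.CmdTrace n × Bool)),
        (∀ k, IsGCA (G k)) →
        (Helping.construction A G arr).ConflictFree A ∧
        (Helping.construction A G arr).Linearizable A := fun _ harr _ hG =>
    ⟨Helping.conflictFree hG harr, Helping.linearizable hG harr⟩
  exact ⟨h1, ⟨GCA.algorithm _ n, GCA.isGCA⟩, _, h1 (fun _ F => F.toList)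
    (fun _ F => F.coe_toList) (fun _ => GCA.algorithm _ n) fun _ => GCA.isGCA⟩
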